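/- **Setting.** On $\mathbb R\times S^3$, with $S^3\subset\mathbb R^4$ the round unit sphere, write $P=(T,X)$ and $X=(X_0,X_1,X_2,X_3)$. Let $R=\arccos X_0$ be the geodesic distance from $X$ to the north pole $\mathbf 1=(1,0,0,0)$, let $P_0=(\pi,\mathbf 1)$, and let $\mathrm{dist}(P,P_0)=\sqrt{(\pi-T)^2+R^2}$. Let $L^2$ refer to the measure $dT\,d\sigma$, with $\sigma$ the surface measure of $S^3$. Let $\Gamma_0=\partial_T$, let $\Gamma_1,\dots,\Gamma_6$ be the rotation fields $X_j\partial_{X_k}-X_k\partial_{X_j}$ ($0\le j<k\le 3$), and put $\Gamma^\alpha=\Gamma_0^{\alpha_0}\cdots\Gamma_6^{\alpha_6}$. Let $\square_g=\partial_T^2-\Delta_{S^3}$. Let $\mathcal E_+=\{(T,X): 0\le T,\ R+T<\pi\}$ be the upper half of the Einstein diamond. Let $\mathcal P$ be Penrose's map, which sends $(t,r\omega)\in\mathbb R\times\mathbb R^3$ ($r\ge0$, $|\omega|=1$) to $(T,(\cos R,\omega\sin R))$ with $T=\arctan(t+r)+\arctan(t-r)$ and $R=\arctan(t+r)-\arctan(t-r)$.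 **Lemma.** Let $A>0$, let $K\subset\{x\in\mathbb R^3:|x|\le A/2\}$ be compact (the obstacle), and let $$Y^{**}_+=\mathcal P\bigl(\{(t,x): t>0,\ x\in\mathbb R^3\setminus K,\ |x|<3A\}\bigr).$$ There is a finite constant $C$, depending only on $K$ and $A$, such that the following holds. Let $F\in L^2(\mathcal E_+)$ be real valued and have weak derivatives $\Gamma_iF$ in the interior of $\mathcal E_+$ with $\mathrm{dist}^2(P,P_0)\,\Gamma_iF\in L^2(\mathcal E_+)$, $0\le i\le 6$. Let $u_f\in L^1_{\rm loc}(\mathcal E_+)$ be a weak solution of the free (no obstacle) wave equation $$(\square_g+1)u_f=F\ \text{ in }\mathcal E_+,\qquad u_f|_{T=0}=\partial_Tu_f|_{T=0}=0,$$ that is, $\int_{\mathcal E_+}u_f\,(\square_g+1)\varphi\,dT\,d\sigma=\int_{\mathcal E_+}F\varphi\,dT\,d\sigma$ for every smooth $\varphi$ with compact support in $\{R+|T|<\pi\}$. (This holds in particular for the restriction to $\mathcal E_+$ of a weak solution on the Einstein cylinder $[0,\pi)\times S^3$ with zero Cauchy data.) Then $u_f$ has weak derivatives $\Gamma^\alpha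 u_f$ on $Y^{**}_+$ for all $|\alpha|\le2$, and $$\sum_{|\alpha|\le2}\bigl\|\mathrm{dist}^{1+2(|\alpha|-2)}(P,P_0)\,\Gamma^\alpha u_f\bigr\|_{L^2(Y^{**}_+)}\le C\sum_{|\alpha|\le1}\bigl\|(\mathrm{dist}^2(P,P_0)\,\Gamma)^\alpha F\bigr\|_{L^2(\mathcal E_+)}.$$ -/

import Mathlib

open Real MeasureTheory
open scoped ContDiff ENNReal NNReal

noncomputable section

namespace EinsteinCylinder

/-- Minkowski space `ℝ × ℝ³`, with points `(t, x)`. -/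
abbrev Minkowski : Type := ℝ × EuclideanSpace ℝ (Fin 3)

/-- The unit sphere `S³` in `ℝ⁴`; its points are `X = (X₀, X₁, X₂, X₃)`. -/
abbrev S3 : Type := Metric.sphere (0 : EuclideanSpace ℝ (Fin 4)) 1

/-- The product `ℝ × S³`, with points `P = (T, X)`. -/
abbrev Cyl : Type := ℝ × S3

/-- The ambient space `ℝ × ℝ⁴` of `ℝ × S³`. -/
abbrev Ambient : Type := ℝ × EuclideanSpace ℝ (Fin 4)

/-- The inclusion of `ℝ × S³` in `ℝ × ℝ⁴`. -/
def incl (p : Cyl) : Ambient := (p.1, (p.2 : EuclideanSpace ℝ (Fin 4)))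

/-- The measure `dT dσ` on `ℝ × S³`, with `σ` the surface measure of the round sphere. -/
def cylMeasure : Measure Cyl :=
  (volume : Measure ℝ).prod (volume : Measure (EuclideanSpace ℝ (Fin 4))).toSphere

/-- `R(X)`, the geodesic distance in `S³` from `X` to the north pole `(1, 0, 0, 0)`. -/
def polarR (X : S3) : ℝ := arccos ((X : EuclideanSpace ℝ (Fin 4)) 0)

/-- The distance on `ℝ × S³` (for `dT² + dX²`) from `P = (T, X)` to `P₀ = (π, north pole)`. -/
def distP0 (p : Cyl) : ℝ := √((π - p.1) ^ 2 + polarR p.2 ^ 2)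

/-- The Einstein diamond `{R + |T| < π}`. -/
def diamond : Set Cyl := {p | polarR p.2 + |p.1| < π}

/-- The upper half `{0 ≤ T, R + T < π}` of the Einstein diamond. -/
def diamondPlus : Set Cyl := diamond ∩ {p | 0 ≤ p.1}

/-! ### The Penrose transformation -/

/-- The time coordinate `T` of the image of `(t, x)`, where `r = |x|`. -/
def penroseT (q : Minkowski) : ℝ := arctan (q.1 + ‖q.2‖) + arctan (q.1 - ‖q.2‖)

/-- The polar coordinate `R` of the image of `(t, x)`, where `r = |x|`. -/
def penroseR (q : Minkowski) : ℝ := arctan (q.1 + ‖q.2‖) - arctan (q.1 - ‖q.2‖)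

/-- The vector `(cos R, ω sin R)` with `x = r ω` (it is the north pole when `x = 0`). -/
def penroseX (q : Minkowski) : EuclideanSpace ℝ (Fin 4) :=
  !₂[cos (penroseR q), q.2 0 / ‖q.2‖ * sin (penroseR q), q.2 1 / ‖q.2‖ * sin (penroseR q),
    q.2 2 / ‖q.2‖ * sin (penroseR q)]

theorem penroseX_mem (q : Minkowski) :
    penroseX q ∈ Metric.sphere (0 : EuclideanSpace ℝ (Fin 4)) 1 := by
  rw [mem_sphere_zero_iff_norm, EuclideanSpace.norm_eq, Real.sqrt_eq_one]
  simp only [penroseX, Fin.sum_univ_four, Real.norm_eq_abs, sq_abs]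
  simp only [Matrix.cons_val]
  by_cases h : ‖q.2‖ = 0
  · simp [penroseR, h]
  · have h2 : ‖q.2‖ ^ 2 = q.2 0 ^ 2 + q.2 1 ^ 2 + q.2 2 ^ 2 := by
      rw [EuclideanSpace.real_norm_sq_eq, Fin.sum_univ_three]
    have h3 : (q.2 0 / ‖q.2‖) ^ 2 + (q.2 1 / ‖q.2‖) ^ 2 + (q.2 2 / ‖q.2‖) ^ 2 = 1 := by
      rw [div_pow, div_pow, div_pow, ← add_div, ← add_div, ← h2]
      exact div_self (pow_ne_zero 2 h)
    linear_combination (sin (penroseR q)) ^ 2 * h3 + sin_sq_add_cos_sq (penroseR q)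

/-- Penrose's map `(t, rω) ↦ (T, (cos R, ω sin R))`. -/
def penrose (q : Minkowski) : Cyl := (penroseT q, ⟨penroseX q, penroseX_mem q⟩)

/-- The image under Penrose's map of `{t > 0, x ∉ K, |x| < B}`. -/
def nearObstacle (K : Set (EuclideanSpace ℝ (Fin 3))) (B : ℝ) : Set Cyl :=
  penrose '' {q | 0 < q.1 ∧ q.2 ∉ K ∧ ‖q.2‖ < B}

/-! ### Vector fields and the wave operator, on functions that are smooth on `ℝ × ℝ⁴`

The fields below are tangent to `ℝ × S³`, so their values on `ℝ × S³` depend only on the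
restriction of the function to `ℝ × S³`. -/

/-- The value at `x` of the rotation field `X_j ∂/∂X_k - X_k ∂/∂X_j` of `ℝ⁴`. -/
def rotField (j k : Fin 4) (x : EuclideanSpace ℝ (Fin 4)) : EuclideanSpace ℝ (Fin 4) :=
  x j • EuclideanSpace.single k (1 : ℝ) - x k • EuclideanSpace.single j (1 : ℝ)

/-- The vector fields `Γ₀ = ∂/∂T` and `Γ₁, …, Γ₆` (the rotation fields with `j < k`). -/
def gammaField (i : Fin 7) (p : Ambient) : Ambient :=
  (![(1, 0), (0, rotField 0 1 p.2), (0, rotField 0 2 p.2), (0, rotField 0 3 p.2),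
    (0, rotField 1 2 p.2), (0, rotField 1 3 p.2), (0, rotField 2 3 p.2)] : Fin 7 → Ambient) i

/-- `Γᵢ φ`. -/
def gamma (i : Fin 7) (φ : Ambient → ℝ) : Ambient → ℝ := fun p => fderiv ℝ φ p (gammaField i p)

/-- The wave operator `□_g = ∂²/∂T² - Δ`, where `Δ`, the Laplace-Beltrami operator of the round
sphere `S³`, is the sum of the squares of the six rotation fields. -/
def box (φ : Ambient → ℝ) : Ambient → ℝ := fun p =>
  gamma 0 (gamma 0 φ) p - ∑ i : Fin 6, gamma i.succ (gamma i.succ φ) p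

/-- `Γ₆^{α₆} ⋯ Γ₀^{α₀} φ`. As each `Γᵢ` is antisymmetric for `dT dσ`, this is, up to the sign
`(-1)^|α|`, the formal adjoint of `Γ^α = Γ₀^{α₀} ⋯ Γ₆^{α₆}`. -/
def gammaRev (α : Fin 7 → ℕ) (φ : Ambient → ℝ) : Ambient → ℝ :=
  (gamma 6)^[α 6] ((gamma 5)^[α 5] ((gamma 4)^[α 4] ((gamma 3)^[α 3]
    ((gamma 2)^[α 2] ((gamma 1)^[α 1] ((gamma 0)^[α 0] φ))))))

/-! ### Weak derivatives and weak solutions -/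

/-- `φ` restricts to a smooth function on `ℝ × S³` with compact support in `U`.  (Every smooth
function on `ℝ × S³` is the restriction of a smooth function on `ℝ × ℝ⁴`.) -/
structure IsTestOn (U : Set Cyl) (φ : Ambient → ℝ) : Prop where
  contDiff : ContDiff ℝ ∞ φ
  compact : HasCompactSupport fun p : Cyl => φ (incl p)
  subset : (tsupport fun p : Cyl => φ (incl p)) ⊆ U

/-- `Γ^α f = g` in the weak sense on the open set `U`. -/
structure HasWeakGamma (U : Set Cyl) (α : Fin 7 → ℕ) (f g : Cyl → ℝ) : Prop where
  locInt : LocallyIntegrableOn f U cylMeasure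
  locInt_deriv : LocallyIntegrableOn g U cylMeasure
  integral_eq : ∀ φ : Ambient → ℝ, IsTestOn U φ →
    ∫ p in U, f p * gammaRev α φ (incl p) ∂cylMeasure =
      (-1) ^ (∑ i, α i) * ∫ p in U, g p * φ (incl p) ∂cylMeasure

/-- `u` is a weak solution in `{0 ≤ T, R + T < π}` of `(□_g + 1) u = F` with `u = ∂u/∂T = 0` at
`T = 0`.  The test functions need not vanish at `T = 0`, which encodes the zero Cauchy data.
Such a test function is also one for the cylinder `(-π, π) × S³`, so the restriction of a weak
solution on `[0, π) × S³` with zero Cauchy data is a solution in this sense. -/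
structure IsFreeWave (u F : Cyl → ℝ) : Prop where
  locInt : LocallyIntegrableOn u diamondPlus cylMeasure
  locInt_source : LocallyIntegrableOn F diamondPlus cylMeasure
  integral_eq : ∀ φ : Ambient → ℝ, IsTestOn diamond φ →
    ∫ p in diamondPlus, u p * (box φ (incl p) + φ (incl p)) ∂cylMeasure =
      ∫ p in diamondPlus, F p * φ (incl p) ∂cylMeasure

end EinsteinCylinder

end

open EinsteinCylinder

set_option linter.unusedSectionVars false

noncomputable section

namespace EinsteinCylinder

/-! ### Smooth dependence of integrals on parameters -/

section Parametric

variable {E V F : Type} [NormedAddCommGroup E] [NormedSpace ℝ E] [FiniteDimensional ℝ E]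
  [NormedAddCommGroup V] [NormedSpace ℝ V] [FiniteDimensional ℝ V] [MeasurableSpace V]
  [BorelSpace V] [NormedAddCommGroup F] [NormedSpace ℝ F] [FiniteDimensional ℝ F]

/-! The proof is by duality. For a test function `φ` on `nearObstacle K (3 * A)`, Kirchhoff's
formula on `S³` gives an explicit smooth backward solution `w = potential φ` of `(□_g + 1) w = φ` on
`T ≥ 0`. Cut off below `T = 0`, it is admissible in the weak equation, so `∫ u φ = ∫ F w`
(`IsFreeWave.integral_eq_potential`). Since `potential` commutes with all `Γᵢ` (`gamma_potential`),
`∫ u Γ^α φ` becomes an integral of `F` against derivatives of `w`, and everything reduces to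
weighted `L²` bounds for `w`.

Write `h = π - T` and `N = π - T - R`. The image of a bounded set of `x` lies in `tube c`, where `R
≤ c N²` (`nearObstacle_subset_tube`). On a forward light cone through a point of this thin set,
`1/N` at the vertex and `1/h` at that point differ by at most `2c` (`nullDist_cone`). By Huygens'
principle, `w` on the shell `n ≤ 1/N < n + 1` therefore sees only the part of `φ` with `1/h` within
a bounded distance of `n`, a time interval of length about `n⁻²`. For a source living in time `τ`,
the energy estimate gains a factor `τ` in the square (`energy_le`). Poincaré's inequality in time
gains a further `n⁻⁴` for `w` itself, because `t ↦ w(t, X)` lives in a window of length about `n⁻²`.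
The shells are summed with bounded overlap (`IsCutoffFamily.tsum_sq_le`). With `d = distP0`, which
is comparable to `h` on the tube, this gives `‖w‖ ≲ ‖d³ φ‖`, `‖Γ w‖ ≲ ‖d φ‖`, `‖d⁻² Γ w‖ ≲ ‖d⁻¹ φ‖`
(`exists_potential_eLpNorm_bounds`).

The first two bounds handle `|α| = 0, 1`. For `|α| = 2` with a rotation among the two fields, that
rotation is moved onto `F`: it is tangent to `T = 0`, so there is no boundary term, and `d² Γ F` is
paired with `d⁻² Γ w`. For `∂_T²` the equation is used: `∂_T² w = ∑ Γₖ² w - w + φ`. The resulting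
bounds on the functionals `φ ↦ ∫ u Γ^α φ` (`exists_functional_bound`) give the weak derivatives and
their norms by Riesz representation (`exists_weak_gamma`). -/

theorem integrable_of_continuous_of_compl_null {μ : Measure V} [IsFiniteMeasure μ] {S : Set V}
    (hS : IsCompact S) (hμ : μ Sᶜ = 0) {g : V → F} (hg : Continuous g) : Integrable g μ := by
  have h : μ.restrict S = μ := Measure.restrict_eq_self_of_ae_mem (mem_ae_iff.2 hμ)
  rw [← h]
  exact hg.continuousOn.integrableOn_compact hS

theorem contDiff_fderiv_left {g : E → V → F} (hg : ContDiff ℝ ∞ (Function.uncurry g)) :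
    ContDiff ℝ ∞ (Function.uncurry fun x v => fderiv ℝ (fun y => g y v) x) := by
  have h : ContDiff ℝ ∞ (Function.uncurry fun (q : E × V) (y : E) => g y q.2) :=
    hg.comp (contDiff_snd.prodMk (contDiff_snd.comp contDiff_fst))
  exact h.fderiv (n := ∞) contDiff_fst (by simp)

/-- The derivative of the integrand is bounded on the compact set `closedBall x 1 ×ˢ S`, and a
constant bound is integrable for a finite measure, so dominated differentiation applies. -/
theorem hasFDerivAt_integral_param {μ : Measure V} [IsFiniteMeasure μ] {S : Set V}
    (hS : IsCompact S) (hμ : μ Sᶜ = 0) {g : E → V → F}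
    (hg : ContDiff ℝ ∞ (Function.uncurry g)) (x : E) :
    HasFDerivAt (fun y => ∫ v, g y v ∂μ) (∫ v, fderiv ℝ (fun y => g y v) x ∂μ) x := by
  have hc : ∀ y, Continuous (g y) := fun y =>
    hg.continuous.comp (continuous_const.prodMk continuous_id)
  have hd := (contDiff_fderiv_left hg).continuous
  have hdc : ∀ y, Continuous fun v => fderiv ℝ (fun z => g z v) y := fun y =>
    hd.comp (continuous_const.prodMk continuous_id)
  obtain ⟨M, hM⟩ := ((isCompact_closedBall x 1).prod hS).bddAbove_image hd.norm.continuousOn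
  refine hasFDerivAt_integral_of_dominated_of_fderiv_le (s := Metric.closedBall x 1)
    (bound := fun _ => M) (F' := fun y v => fderiv ℝ (fun z => g z v) y)
    (Metric.closedBall_mem_nhds x one_pos)
    (Filter.Eventually.of_forall fun y => (hc y).aestronglyMeasurable)
    (integrable_of_continuous_of_compl_null hS hμ (hc x)) (hdc x).aestronglyMeasurable
    ?_ (integrable_const M) (Filter.Eventually.of_forall fun v y _ => ?_)
  · filter_upwards [mem_ae_iff.2 hμ] with v hv y hy
    exact hM ⟨(y, v), ⟨hy, hv⟩, rfl⟩
  · have h : ContDiff ℝ ∞ fun z => g z v := hg.comp (contDiff_id.prodMk contDiff_const)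
    exact (h.differentiable (by simp) y).hasFDerivAt

theorem contDiff_integral_param {μ : Measure V} [IsFiniteMeasure μ] {S : Set V}
    (hS : IsCompact S) (hμ : μ Sᶜ = 0) {g : E → V → F}
    (hg : ContDiff ℝ ∞ (Function.uncurry g)) : ContDiff ℝ ∞ fun y => ∫ v, g y v ∂μ := by
  rw [contDiff_infty]
  intro n
  -- The derivative is an integral of the same kind with values in `E →L[ℝ] F`, so the target space
  -- has to vary.
  induction n generalizing F with
  | zero =>
    have : Continuous fun y => ∫ v, g y v ∂μ := continuous_iff_continuousAt.2 fun y =>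
      (hasFDerivAt_integral_param hS hμ hg y).continuousAt
    simpa using this
  | succ n ih =>
    refine contDiff_succ_iff_hasFDerivAt.2 ⟨_, ih (contDiff_fderiv_left hg), fun x => ?_⟩
    exact hasFDerivAt_integral_param hS hμ hg x

theorem fderiv_integral_param_apply {μ : Measure V} [IsFiniteMeasure μ] {S : Set V}
    (hS : IsCompact S) (hμ : μ Sᶜ = 0) {g : E → V → F}
    (hg : ContDiff ℝ ∞ (Function.uncurry g)) (x e : E) :
    fderiv ℝ (fun y => ∫ v, g y v ∂μ) x e = ∫ v, fderiv ℝ (fun y => g y v) x e ∂μ := by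
  rw [(hasFDerivAt_integral_param hS hμ hg x).fderiv, ContinuousLinearMap.integral_apply]
  refine integrable_of_continuous_of_compl_null hS hμ ?_
  exact (contDiff_fderiv_left hg).continuous.comp (continuous_const.prodMk continuous_id)

end Parametric

/-! ### Rotations and the surface measure of spheres -/

section Sphere

variable {n : ℕ}

/-- The infinitesimal rotation `x ↦ x_j e_k - x_k e_j`. -/
def planeRot (j k : Fin n) (x : EuclideanSpace ℝ (Fin n)) : EuclideanSpace ℝ (Fin n) :=
  x j • EuclideanSpace.single k (1 : ℝ) - x k • EuclideanSpace.single j (1 : ℝ)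

/-- The rotation by the angle `θ` in the plane of `e_j` and `e_k`. -/
def rotIsom (j k : Fin n) (hjk : j ≠ k) (θ : ℝ) :
    EuclideanSpace ℝ (Fin n) →ₗᵢ[ℝ] EuclideanSpace ℝ (Fin n) where
  toFun x := x + (cos θ - 1) • (x j • EuclideanSpace.single j (1 : ℝ) +
    x k • EuclideanSpace.single k (1 : ℝ)) + sin θ • planeRot j k x
  map_add' x y := by
    simp only [planeRot, PiLp.add_apply]; module
  map_smul' c x := by
    simp only [planeRot, PiLp.smul_apply, smul_eq_mul, RingHom.id_apply]; module
  norm_map' x := by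
    rw [← sq_eq_sq₀ (norm_nonneg _) (norm_nonneg _), ← real_inner_self_eq_norm_sq,
      ← real_inner_self_eq_norm_sq]
    change inner ℝ (x + (cos θ - 1) • (x j • EuclideanSpace.single j (1 : ℝ) +
      x k • EuclideanSpace.single k (1 : ℝ)) + sin θ • planeRot j k x) (x + (cos θ - 1) •
      (x j • EuclideanSpace.single j (1 : ℝ) + x k • EuclideanSpace.single k (1 : ℝ)) +
      sin θ • planeRot j k x) = _
    simp only [planeRot, inner_add_left, inner_add_right, inner_sub_left, inner_sub_right,
      real_inner_smul_left, real_inner_smul_right, EuclideanSpace.inner_single_left,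
      EuclideanSpace.inner_single_right, PiLp.single_apply, PiLp.add_apply, PiLp.sub_apply, PiLp.smul_apply, smul_eq_mul, hjk, hjk.symm, map_one,
      one_mul, conj_trivial, if_true, if_false]
    linear_combination (x j ^ 2 + x k ^ 2) * sin_sq_add_cos_sq θ

theorem rotIsom_apply (j k : Fin n) (hjk : j ≠ k) (θ : ℝ) (x : EuclideanSpace ℝ (Fin n)) :
    rotIsom j k hjk θ x = x + (cos θ - 1) • (x j • EuclideanSpace.single j (1 : ℝ) +
    x k • EuclideanSpace.single k (1 : ℝ)) + sin θ • planeRot j k x := rfl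

theorem rotIsom_zero (j k : Fin n) (hjk : j ≠ k) (x : EuclideanSpace ℝ (Fin n)) :
    rotIsom j k hjk 0 x = x := by simp [rotIsom_apply]

theorem hasDerivAt_rotIsom (j k : Fin n) (hjk : j ≠ k) (x : EuclideanSpace ℝ (Fin n)) :
    HasDerivAt (fun θ => rotIsom j k hjk θ x) (planeRot j k x) 0 := by
  simp only [rotIsom_apply]
  have h1 : HasDerivAt (fun θ : ℝ => cos θ - 1) 0 0 := by
    simpa using (hasDerivAt_cos 0).sub_const 1
  have h2 : HasDerivAt (fun θ : ℝ => sin θ) 1 0 := by simpa using hasDerivAt_sin 0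
  refine (((h1.smul_const (x j • EuclideanSpace.single j (1 : ℝ) +
    x k • EuclideanSpace.single k (1 : ℝ))).const_add x).fun_add
      (h2.smul_const (planeRot j k x))).congr_deriv ?_
  simp

/-- The surface measure of the unit sphere, as a measure on the ambient space. -/
def sphMeas (n : ℕ) : Measure (EuclideanSpace ℝ (Fin n)) :=
  (volume : Measure (EuclideanSpace ℝ (Fin n))).toSphere.map (↑)

instance : IsFiniteMeasure (sphMeas n) := by unfold sphMeas; infer_instance

theorem sphMeas_compl : sphMeas n (Metric.sphere 0 1)ᶜ = 0 := by
  rw [sphMeas, Measure.map_apply (by fun_prop) Metric.isClosed_sphere.measurableSet.compl]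
  simp

open scoped Pointwise in
theorem sphMeas_apply {s : Set (EuclideanSpace ℝ (Fin n))} (hs : MeasurableSet s) :
    sphMeas n s = n * volume (Set.Ioo (0 : ℝ) 1 • (Metric.sphere 0 1 ∩ s)) := by
  rw [sphMeas, Measure.map_apply (by fun_prop) hs,
    Measure.toSphere_apply' _ (measurable_subtype_coe hs), Subtype.image_preimage_coe]
  simp

theorem integral_sphMeas {F : Type} [NormedAddCommGroup F] [NormedSpace ℝ F]
    (g : EuclideanSpace ℝ (Fin n) → F) :
    ∫ x, g x ∂(sphMeas n) = ∫ x, g x ∂(volume : Measure (EuclideanSpace ℝ (Fin n))).toSphere :=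
  (MeasurableEmbedding.subtype_coe Metric.isClosed_sphere.measurableSet).integral_map _

open scoped Pointwise in
-- The surface measure of `s` is the volume of the cone over `s`, up to a factor; `L` maps cones to
-- cones and preserves volume.
theorem measurePreserving_isom (L : EuclideanSpace ℝ (Fin n) ≃ₗᵢ[ℝ] EuclideanSpace ℝ (Fin n)) :
    MeasurePreserving L (sphMeas n) (sphMeas n) := by
  refine ⟨L.continuous.measurable, ?_⟩
  ext s hs
  rw [Measure.map_apply L.continuous.measurable hs, sphMeas_apply hs,
    sphMeas_apply (L.continuous.measurable hs)]
  have h : Set.Ioo (0 : ℝ) 1 • (Metric.sphere (0 : EuclideanSpace ℝ (Fin n)) 1 ∩ L ⁻¹' s) =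
      L ⁻¹' (Set.Ioo (0 : ℝ) 1 • (Metric.sphere 0 1 ∩ s)) := by
    ext x
    simp only [Set.mem_smul, Set.mem_preimage, Set.mem_inter_iff, mem_sphere_zero_iff_norm]
    constructor
    · rintro ⟨r, hr, y, ⟨h1, h2⟩, rfl⟩
      exact ⟨r, hr, L y, ⟨by simpa using h1, h2⟩, by simp⟩
    · rintro ⟨r, hr, y, ⟨h1, h2⟩, h3⟩
      refine ⟨r, hr, L.symm y, ⟨by simpa using h1, by simpa using h2⟩, ?_⟩
      rw [← map_smul, h3, L.symm_apply_apply]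
  rw [h, L.measurePreserving.measure_preimage_emb L.toMeasurableEquiv.measurableEmbedding]

/-- By rotation invariance `θ ↦ ∫ ψ ∘ rotIsom θ` is constant; this is its derivative at `θ = 0`. It
replaces the divergence theorem on spheres, both on `S²` (Kirchhoff's formula) and on `S³` (the
energy identity). -/
theorem integral_planeRot {j k : Fin n} (hjk : j ≠ k) {ψ : EuclideanSpace ℝ (Fin n) → ℝ}
    (hψ : ContDiff ℝ ∞ ψ) : ∫ x, fderiv ℝ ψ x (planeRot j k x) ∂(sphMeas n) = 0 := by
  have h1 : ∀ θ : ℝ, ∫ x, ψ (rotIsom j k hjk θ x) ∂(sphMeas n) = ∫ x, ψ x ∂(sphMeas n) := by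
    intro θ
    let L := (rotIsom j k hjk θ).toLinearIsometryEquiv rfl
    exact (measurePreserving_isom L).integral_comp L.toMeasurableEquiv.measurableEmbedding ψ
  have hg : ContDiff ℝ ∞ (Function.uncurry fun (θ : ℝ) (x : EuclideanSpace ℝ (Fin n)) =>
      ψ (rotIsom j k hjk θ x)) := by
    refine hψ.comp ?_
    simp only [rotIsom_apply, planeRot]
    have hj : ∀ j : Fin n, ContDiff ℝ ∞ fun x : ℝ × EuclideanSpace ℝ (Fin n) => x.2 j :=
      fun j => (contDiff_euclidean.1 contDiff_snd j)
    have := hj j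
    have := hj k
    fun_prop
  have h2 := fderiv_integral_param_apply (isCompact_sphere 0 1) sphMeas_compl hg 0 1
  simp only [h1] at h2
  simp only [fderiv_fun_const, Pi.zero_apply, _root_.zero_apply,
    fderiv_apply_one_eq_deriv] at h2
  rw [h2]
  refine integral_congr_ae (Filter.Eventually.of_forall fun x => ?_)
  have h3 : HasFDerivAt ψ (fderiv ℝ ψ x) (rotIsom j k hjk 0 x) := by
    rw [rotIsom_zero]; exact (hψ.differentiable (by simp) x).hasFDerivAt
  exact (h3.comp_hasDerivAt 0 (hasDerivAt_rotIsom j k hjk x)).deriv.symm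

end Sphere

/-! ### Quaternionic translates of the unit sphere of `ℝ³` -/

/-- The product `X ω` of a quaternion `X` and a purely imaginary quaternion `ω`. -/
def quat : EuclideanSpace ℝ (Fin 4) →L[ℝ] EuclideanSpace ℝ (Fin 3) →L[ℝ]
    EuclideanSpace ℝ (Fin 4) :=
  LinearMap.toContinuousBilinearMap (LinearMap.mk₂ ℝ
    (fun X w => !₂[-(X 1 * w 0) - X 2 * w 1 - X 3 * w 2, X 0 * w 0 + X 2 * w 2 - X 3 * w 1,
      X 0 * w 1 + X 3 * w 0 - X 1 * w 2, X 0 * w 2 + X 1 * w 1 - X 2 * w 0])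
    (fun X X' w => by ext i; fin_cases i <;> simp <;> ring)
    (fun c X w => by ext i; fin_cases i <;> simp <;> ring)
    (fun X w w' => by ext i; fin_cases i <;> simp <;> ring)
    (fun c X w => by ext i; fin_cases i <;> simp <;> ring))

theorem quat_apply (X : EuclideanSpace ℝ (Fin 4)) (w : EuclideanSpace ℝ (Fin 3)) :
    quat X w = !₂[-(X 1 * w 0) - X 2 * w 1 - X 3 * w 2, X 0 * w 0 + X 2 * w 2 - X 3 * w 1,
      X 0 * w 1 + X 3 * w 0 - X 1 * w 2, X 0 * w 2 + X 1 * w 1 - X 2 * w 0] := rfl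

/-- Multiplicativity of the quaternion norm. Together with `inner_quat` it shows that `ω ↦ X ω`
identifies `S²` with the unit tangent vectors at `X`, smoothly in `X`. This global frame lets
spherical means be written as integrals over one fixed `S²`. -/
theorem norm_quat (X : EuclideanSpace ℝ (Fin 4)) (w : EuclideanSpace ℝ (Fin 3)) :
    ‖quat X w‖ = ‖X‖ * ‖w‖ := by
  rw [← sq_eq_sq₀ (norm_nonneg _) (by positivity), mul_pow, EuclideanSpace.real_norm_sq_eq,
    EuclideanSpace.real_norm_sq_eq, EuclideanSpace.real_norm_sq_eq, quat_apply]
  simp [Fin.sum_univ_four, Fin.sum_univ_three]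
  ring

theorem inner_quat (X : EuclideanSpace ℝ (Fin 4)) (w : EuclideanSpace ℝ (Fin 3)) :
    inner ℝ X (quat X w) = 0 := by
  simp [PiLp.inner_apply, Fin.sum_univ_four, quat_apply]
  ring

/-- The infinitesimal rotation `planeRot j k` as a continuous linear map. -/
def planeRotL {n : ℕ} (j k : Fin n) :
    EuclideanSpace ℝ (Fin n) →L[ℝ] EuclideanSpace ℝ (Fin n) :=
  LinearMap.toContinuousLinearMap
    { toFun := planeRot j k
      map_add' := fun x y => by simp only [planeRot, PiLp.add_apply]; module
      map_smul' := fun c x => by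
        simp only [planeRot, PiLp.smul_apply, smul_eq_mul, RingHom.id_apply]; module }

/-- The component of `gammaField i` along `ℝ⁴`. -/
def gammaLin (i : Fin 7) : EuclideanSpace ℝ (Fin 4) →L[ℝ] EuclideanSpace ℝ (Fin 4) :=
  ![0, planeRotL 0 1, planeRotL 0 2, planeRotL 0 3, planeRotL 1 2, planeRotL 1 3,
    planeRotL 2 3] i

theorem gammaField_eq (i : Fin 7) (p : Ambient) :
    gammaField i p = (if i = 0 then 1 else 0, gammaLin i p.2) := by
  fin_cases i <;> rfl

theorem gammaLin_zero : gammaLin 0 = 0 := rfl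

theorem gammaLin_succ_exists (i : Fin 6) : ∃ j k : Fin 4, j ≠ k ∧ gammaLin i.succ = planeRotL j k := by
  fin_cases i
  exacts [⟨0, 1, by decide, rfl⟩, ⟨0, 2, by decide, rfl⟩, ⟨0, 3, by decide, rfl⟩,
    ⟨1, 2, by decide, rfl⟩, ⟨1, 3, by decide, rfl⟩, ⟨2, 3, by decide, rfl⟩]

/-- An infinitesimal rotation of `ℝ⁴` is `X ↦ aX + Xb` with `a, b` imaginary, and `a(Xω) + (Xω)b =
(aX + Xb)ω + X(ωb - bω)`. The commutator is an infinitesimal rotation of `ω`. -/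
theorem gammaLin_quat (i : Fin 6) : ∃ j k : Fin 3, j ≠ k ∧ ∀ X w,
    gammaLin i.succ (quat X w) = quat (gammaLin i.succ X) w + quat X (planeRot j k w) := by
  fin_cases i
  · refine ⟨2, 1, by decide, fun X w => ?_⟩
    change planeRot 0 1 _ = quat (planeRot 0 1 _) _ + _
    ext i; fin_cases i <;> simp [quat_apply, planeRot] <;> ring
  · refine ⟨0, 2, by decide, fun X w => ?_⟩
    change planeRot 0 2 _ = quat (planeRot 0 2 _) _ + _
    ext i; fin_cases i <;> simp [quat_apply, planeRot] <;> ring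
  · refine ⟨1, 0, by decide, fun X w => ?_⟩
    change planeRot 0 3 _ = quat (planeRot 0 3 _) _ + _
    ext i; fin_cases i <;> simp [quat_apply, planeRot] <;> ring
  · refine ⟨0, 1, by decide, fun X w => ?_⟩
    change planeRot 1 2 _ = quat (planeRot 1 2 _) _ + _
    ext i; fin_cases i <;> simp [quat_apply, planeRot] <;> ring
  · refine ⟨0, 2, by decide, fun X w => ?_⟩
    change planeRot 1 3 _ = quat (planeRot 1 3 _) _ + _
    ext i; fin_cases i <;> simp [quat_apply, planeRot] <;> ring
  · refine ⟨1, 2, by decide, fun X w => ?_⟩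
    change planeRot 2 3 _ = quat (planeRot 2 3 _) _ + _
    ext i; fin_cases i <;> simp [quat_apply, planeRot] <;> ring

/-! ### The fields `Γᵢ` on smooth functions -/

theorem contDiff_gammaField (i : Fin 7) : ContDiff ℝ ∞ (gammaField i) := by
  have h : gammaField i = fun p : Ambient => ((if i = 0 then 1 else 0 : ℝ), gammaLin i p.2) :=
    funext (gammaField_eq i)
  rw [h]
  fun_prop

theorem contDiff_gamma {φ : Ambient → ℝ} (hφ : ContDiff ℝ ∞ φ) (i : Fin 7) :
    ContDiff ℝ ∞ (gamma i φ) :=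
  (hφ.fderiv_right (m := ∞) (by simp)).clm_apply (contDiff_gammaField i)

theorem gamma_add {φ ψ : Ambient → ℝ} (hφ : ContDiff ℝ ∞ φ) (hψ : ContDiff ℝ ∞ ψ) (i : Fin 7) :
    gamma i (fun p => φ p + ψ p) = fun p => gamma i φ p + gamma i ψ p := by
  ext p
  simp only [gamma]
  rw [fderiv_fun_add (hφ.differentiable (by simp) p) (hψ.differentiable (by simp) p)]
  rfl

theorem gamma_mul {φ ψ : Ambient → ℝ} (hφ : ContDiff ℝ ∞ φ) (hψ : ContDiff ℝ ∞ ψ) (i : Fin 7)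
    (p : Ambient) :
    gamma i (fun p => φ p * ψ p) p = φ p * gamma i ψ p + gamma i φ p * ψ p := by
  simp only [gamma]
  rw [fderiv_fun_mul (hφ.differentiable (by simp) p) (hψ.differentiable (by simp) p)]
  simp [mul_comm]

theorem gamma_const_smul {φ : Ambient → ℝ} (hφ : ContDiff ℝ ∞ φ) (c : ℝ) (i : Fin 7) :
    gamma i (fun p => c * φ p) = fun p => c * gamma i φ p := by
  ext p
  simp only [gamma]
  rw [fderiv_const_mul (hφ.differentiable (by simp) p)]
  rfl

theorem gamma_gamma {φ : Ambient → ℝ} (hφ : ContDiff ℝ ∞ φ) (i : Fin 7) (p : Ambient) :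
    gamma i (gamma i φ) p = fderiv ℝ (fderiv ℝ φ) p (gammaField i p) (gammaField i p) +
      fderiv ℝ φ p (0, gammaLin i (gammaLin i p.2)) := by
  have h1 : HasFDerivAt (fderiv ℝ φ) (fderiv ℝ (fderiv ℝ φ) p) p :=
    ((hφ.fderiv_right (m := ∞) (by simp)).differentiable (by simp) p).hasFDerivAt
  have h2 : HasFDerivAt (gammaField i)
      ((0 : Ambient →L[ℝ] ℝ).prod ((gammaLin i).comp (ContinuousLinearMap.snd ℝ _ _))) p := by
    have h : gammaField i = fun p : Ambient => ((if i = 0 then 1 else 0 : ℝ), gammaLin i p.2) :=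
      funext (gammaField_eq i)
    rw [h]
    exact (hasFDerivAt_const _ p).prodMk
      ((gammaLin i).hasFDerivAt.comp p hasFDerivAt_snd)
  have h3 : HasFDerivAt (gamma i φ) _ p := h1.clm_apply h2
  change fderiv ℝ (gamma i φ) p (gammaField i p) = _
  rw [h3.fderiv]
  simp [gammaField_eq, add_comm]

/-! ### The backward potential -/

/-- The measure `ds dω` on `[0, π] × S²`. -/
def kerMeas : Measure (ℝ × EuclideanSpace ℝ (Fin 3)) :=
  (volume.restrict (Set.Icc 0 π)).prod (sphMeas 3)

/-- The compact set `[0, π] × S²`. -/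
def kerSet : Set (ℝ × EuclideanSpace ℝ (Fin 3)) := Set.Icc 0 π ×ˢ Metric.sphere 0 1

instance : IsFiniteMeasure kerMeas := by unfold kerMeas; infer_instance

theorem isCompact_kerSet : IsCompact kerSet := isCompact_Icc.prod (isCompact_sphere 0 1)

theorem kerMeas_compl : kerMeas kerSetᶜ = 0 := by
  rw [kerSet, kerMeas, Set.compl_prod_eq_union]
  refine measure_union_null ?_ ?_
  · rw [Measure.prod_prod, Measure.restrict_apply measurableSet_Icc.compl]; simp
  · rw [Measure.prod_prod, sphMeas_compl, mul_zero]

/-- The total mass of `S²`. -/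
def sphMass : ℝ := (sphMeas 3).real Set.univ

theorem sphMass_pos : 0 < sphMass := by
  refine ENNReal.toReal_pos ?_ (measure_ne_top _ _)
  rw [sphMeas, Measure.map_apply (by fun_prop) MeasurableSet.univ, Set.preimage_univ]
  exact (Measure.measure_univ_ne_zero).2 (Measure.toSphere_ne_zero _)

/-- The point at distance `s` from `X` on `S³`, in the direction `X ω`. -/
def geo (X : EuclideanSpace ℝ (Fin 4)) (k : ℝ × EuclideanSpace ℝ (Fin 3)) :
    EuclideanSpace ℝ (Fin 4) := cos k.1 • X + sin k.1 • quat X k.2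

/-- The point of the forward light cone of `p` with parameters `(s, ω)`. -/
def cone (p : Ambient) (k : ℝ × EuclideanSpace ℝ (Fin 3)) : Ambient := (p.1 + k.1, geo p.2 k)

/-- The backward solution of `(□_g + 1) w = φ`, by Kirchhoff's formula. -/
def potential (φ : Ambient → ℝ) : Ambient → ℝ :=
  fun p => sphMass⁻¹ * ∫ k, sin k.1 * φ (cone p k) ∂kerMeas

theorem contDiff_cone : ContDiff ℝ ∞ (Function.uncurry cone) := by
  unfold Function.uncurry cone geo
  fun_prop

theorem continuous_cone (p : Ambient) : Continuous (cone p) := by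
  unfold cone geo
  fun_prop

theorem contDiff_kernel {φ : Ambient → ℝ} (hφ : ContDiff ℝ ∞ φ) : ContDiff ℝ ∞
    (Function.uncurry fun (p : Ambient) (k : ℝ × EuclideanSpace ℝ (Fin 3)) =>
      sin k.1 * φ (cone p k)) := by
  have h := hφ.comp contDiff_cone
  have h2 : ContDiff ℝ ∞ fun q : Ambient × (ℝ × EuclideanSpace ℝ (Fin 3)) => sin q.2.1 := by
    fun_prop
  exact h2.mul h

theorem contDiff_potential {φ : Ambient → ℝ} (hφ : ContDiff ℝ ∞ φ) :
    ContDiff ℝ ∞ (potential φ) :=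
  contDiff_const.mul (contDiff_integral_param isCompact_kerSet kerMeas_compl (contDiff_kernel hφ))

theorem hasFDerivAt_cone (p : Ambient) (k : ℝ × EuclideanSpace ℝ (Fin 3)) :
    HasFDerivAt (fun p => cone p k) ((ContinuousLinearMap.fst ℝ ℝ _).prod
      ((cos k.1 • ContinuousLinearMap.id ℝ _ + sin k.1 • (quat.flip k.2)).comp
        (ContinuousLinearMap.snd ℝ ℝ (EuclideanSpace ℝ (Fin 4))))) p := by
  refine HasFDerivAt.prodMk ?_ ?_
  · exact hasFDerivAt_fst.add_const k.1
  · exact ((cos k.1 • ContinuousLinearMap.id ℝ _ + sin k.1 • (quat.flip k.2)).comp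
        (ContinuousLinearMap.snd ℝ ℝ (EuclideanSpace ℝ (Fin 4)))).hasFDerivAt

theorem integrable_kernel {g : ℝ × EuclideanSpace ℝ (Fin 3) → ℝ} (hg : Continuous g) :
    Integrable g kerMeas := integrable_of_continuous_of_compl_null isCompact_kerSet kerMeas_compl hg

theorem fderiv_kernel_apply {φ : Ambient → ℝ} (hφ : ContDiff ℝ ∞ φ) (p v : Ambient)
    (k : ℝ × EuclideanSpace ℝ (Fin 3)) :
    fderiv ℝ (fun y => sin k.1 * φ (cone y k)) p v =
      sin k.1 * fderiv ℝ φ (cone p k) (v.1, geo v.2 k) := by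
  have h1 := (hφ.differentiable (by simp) (cone p k)).hasFDerivAt.comp p (hasFDerivAt_cone p k)
  have h2 := (h1.const_mul (sin k.1)).fderiv
  simp only [Function.comp_def] at h2
  rw [h2]
  rfl

theorem fderiv_potential_apply {φ : Ambient → ℝ} (hφ : ContDiff ℝ ∞ φ) (p v : Ambient) :
    fderiv ℝ (potential φ) p v = sphMass⁻¹ *
      ∫ k, sin k.1 * fderiv ℝ φ (cone p k) (v.1, geo v.2 k) ∂kerMeas := by
  have h := hasFDerivAt_integral_param isCompact_kerSet kerMeas_compl (contDiff_kernel hφ) p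
  unfold potential
  rw [fderiv_const_mul h.differentiableAt]
  simp only [_root_.smul_apply, smul_eq_mul]
  rw [fderiv_integral_param_apply isCompact_kerSet kerMeas_compl (contDiff_kernel hφ)]
  simp only [fderiv_kernel_apply hφ]

theorem continuous_kernel_deriv {φ : Ambient → ℝ} (hφ : ContDiff ℝ ∞ φ) (p v : Ambient) :
    Continuous fun k : ℝ × EuclideanSpace ℝ (Fin 3) =>
      sin k.1 * fderiv ℝ φ (cone p k) (v.1, geo v.2 k) := by
  have hD : Continuous fun k => fderiv ℝ φ (cone p k) :=
    (hφ.continuous_fderiv (by simp)).comp (continuous_cone p)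
  have h2 : Continuous fun k : ℝ × EuclideanSpace ℝ (Fin 3) => (v.1, geo v.2 k) := by
    unfold geo; fun_prop
  exact (continuous_sin.comp continuous_fst).mul (hD.clm_apply h2)

theorem continuous_kernel {φ : Ambient → ℝ} (hφ : ContDiff ℝ ∞ φ) (p : Ambient) :
    Continuous fun k : ℝ × EuclideanSpace ℝ (Fin 3) => sin k.1 * φ (cone p k) :=
  (continuous_sin.comp continuous_fst).mul (hφ.continuous.comp (continuous_cone p))

theorem hasFDerivAt_cone_sphere (p : Ambient) (s : ℝ) (w : EuclideanSpace ℝ (Fin 3)) :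
    HasFDerivAt (fun w => cone p (s, w))
      ((0 : EuclideanSpace ℝ (Fin 3) →L[ℝ] ℝ).prod (sin s • quat p.2)) w :=
  (hasFDerivAt_const (p.1 + s) w).prodMk
    ((sin s • quat p.2).hasFDerivAt.const_add (cos s • p.2))

theorem fderiv_cone_sphere_apply {φ : Ambient → ℝ} (hφ : ContDiff ℝ ∞ φ) (p : Ambient) (s : ℝ)
    (w v : EuclideanSpace ℝ (Fin 3)) : fderiv ℝ (fun w => φ (cone p (s, w))) w v =
      fderiv ℝ φ (cone p (s, w)) (0, sin s • quat p.2 v) := by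
  have h3 := ((hφ.differentiable (by simp) (cone p (s, w))).hasFDerivAt.comp w
    (hasFDerivAt_cone_sphere p s w)).fderiv
  simp only [Function.comp_def] at h3
  rw [h3]
  rfl

theorem contDiff_cone_sphere {φ : Ambient → ℝ} (hφ : ContDiff ℝ ∞ φ) (p : Ambient) (s : ℝ) :
    ContDiff ℝ ∞ fun w => φ (cone p (s, w)) :=
  hφ.comp (contDiff_cone.comp (contDiff_const.prodMk (contDiff_const.prodMk contDiff_id)))

/-- The kernel is invariant under time translation, which settles `Γ₀`. For a rotation,
`gammaLin_quat` shows that the two integrands differ by a derivative along a rotation of `ω`, which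
integrates to zero over `S²`. -/
theorem gamma_potential {φ : Ambient → ℝ} (hφ : ContDiff ℝ ∞ φ) (i : Fin 7) :
    gamma i (potential φ) = potential (gamma i φ) := by
  ext p
  change fderiv ℝ (potential φ) p (gammaField i p) = _
  rw [fderiv_potential_apply hφ]
  unfold potential
  congr 1
  refine Fin.cases ?_ (fun i => ?_) i
  · simp only [gamma, gammaField_eq, gammaLin_zero]
    simp [geo]
  · obtain ⟨j, k, hjk, hB⟩ := gammaLin_quat i
    have hi1 := integrable_kernel (continuous_kernel_deriv hφ p (gammaField i.succ p))
    have hi2 := integrable_kernel (continuous_kernel (contDiff_gamma hφ i.succ) p)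
    rw [← sub_eq_zero, ← integral_sub hi1 hi2]
    have h1 : ∀ k' : ℝ × EuclideanSpace ℝ (Fin 3), sin k'.1 * fderiv ℝ φ (cone p k')
        ((gammaField i.succ p).1, geo (gammaField i.succ p).2 k') -
          sin k'.1 * gamma i.succ φ (cone p k') =
        sin k'.1 * (- fderiv ℝ (fun w => φ (cone p (k'.1, w))) k'.2 (planeRot j k k'.2)) := by
      rintro ⟨s, w⟩
      rw [fderiv_cone_sphere_apply hφ, ← mul_sub, ← map_neg, gamma, ← map_sub]
      congr 2
      simp only [gammaField_eq, cone, geo, map_add, map_smul, hB, Fin.succ_ne_zero, if_false]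
      ext1
      · simp
      · simp only [Prod.snd_sub, Prod.snd_neg]
        module
    have hi := (hi1.sub hi2).congr (Filter.Eventually.of_forall h1)
    rw [integral_congr_ae (Filter.Eventually.of_forall h1)]
    rw [kerMeas] at hi ⊢
    rw [integral_prod _ hi]
    refine integral_eq_zero_of_ae (Filter.Eventually.of_forall fun s => ?_)
    simp only [Pi.zero_apply]
    rw [integral_const_mul, integral_neg,
      integral_planeRot hjk (contDiff_cone_sphere hφ p s), neg_zero, mul_zero]

/-! ### The Laplacian of `S³` in polar coordinates -/

theorem bilin_expand {n : ℕ} (B : EuclideanSpace ℝ (Fin n) →L[ℝ] EuclideanSpace ℝ (Fin n) →L[ℝ] ℝ)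
    (x y : EuclideanSpace ℝ (Fin n)) : B x y = ∑ i, ∑ j, x i * y j *
      B (EuclideanSpace.single i 1) (EuclideanSpace.single j 1) := by
  have h : ∀ z : EuclideanSpace ℝ (Fin n), z = ∑ i, z i • EuclideanSpace.single i (1 : ℝ) := by
    intro z
    ext j
    simp [Pi.single_apply]
  conv_lhs => rw [h x, h y]
  simp only [map_sum, map_smul, _root_.sum_apply, _root_.smul_apply, smul_eq_mul,
    Finset.mul_sum]
  rw [Finset.sum_comm]
  refine Finset.sum_congr rfl fun i _ => Finset.sum_congr rfl fun j _ => by ring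

/-- Lagrange's identity `∑_{j<k} (Y_j e_k - Y_k e_j)^{⊗2} = |Y|² I - Y ⊗ Y`: for unit `Y`, the trace
over the tangent space of the sphere at `Y`. -/
theorem sum_gammaLin_sq (B : EuclideanSpace ℝ (Fin 4) →L[ℝ] EuclideanSpace ℝ (Fin 4) →L[ℝ] ℝ)
    (Y : EuclideanSpace ℝ (Fin 4)) :
    ∑ i : Fin 6, B (gammaLin i.succ Y) (gammaLin i.succ Y) =
      ‖Y‖ ^ 2 * ∑ i, B (EuclideanSpace.single i 1) (EuclideanSpace.single i 1) - B Y Y := by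
  rw [EuclideanSpace.real_norm_sq_eq, Fin.sum_univ_six]
  change B (planeRot 0 1 Y) (planeRot 0 1 Y) + B (planeRot 0 2 Y) (planeRot 0 2 Y) +
    B (planeRot 0 3 Y) (planeRot 0 3 Y) + B (planeRot 1 2 Y) (planeRot 1 2 Y) +
    B (planeRot 1 3 Y) (planeRot 1 3 Y) + B (planeRot 2 3 Y) (planeRot 2 3 Y) = _
  rw [bilin_expand B Y Y]
  simp only [planeRot, map_sub, map_smul, _root_.sub_apply, _root_.smul_apply, smul_eq_mul,
    Fin.sum_univ_four]
  ring

theorem sum_gammaLin_gammaLin (Y : EuclideanSpace ℝ (Fin 4)) :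
    ∑ i : Fin 6, gammaLin i.succ (gammaLin i.succ Y) = (-3 : ℝ) • Y := by
  rw [Fin.sum_univ_six]
  change planeRot 0 1 (planeRot 0 1 Y) + planeRot 0 2 (planeRot 0 2 Y) +
    planeRot 0 3 (planeRot 0 3 Y) + planeRot 1 2 (planeRot 1 2 Y) +
    planeRot 1 3 (planeRot 1 3 Y) + planeRot 2 3 (planeRot 2 3 Y) = _
  ext i; fin_cases i <;> simp [planeRot] <;> ring

/-- The planes of rotation in `ℝ³`. -/
def plane3 (i : Fin 3) : Fin 3 × Fin 3 := ![(0, 1), (0, 2), (1, 2)] i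

theorem plane3_ne (i : Fin 3) : (plane3 i).1 ≠ (plane3 i).2 := by
  fin_cases i <;> simp [plane3]

/-- The rotation fields of `ℝ³`. -/
def rot3 (i : Fin 3) : EuclideanSpace ℝ (Fin 3) →L[ℝ] EuclideanSpace ℝ (Fin 3) :=
  planeRotL (plane3 i).1 (plane3 i).2

theorem sum_rot3_sq (B : EuclideanSpace ℝ (Fin 3) →L[ℝ] EuclideanSpace ℝ (Fin 3) →L[ℝ] ℝ)
    (w : EuclideanSpace ℝ (Fin 3)) : ∑ i, B (rot3 i w) (rot3 i w) =
      ‖w‖ ^ 2 * ∑ i, B (EuclideanSpace.single i 1) (EuclideanSpace.single i 1) - B w w := by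
  rw [EuclideanSpace.real_norm_sq_eq, Fin.sum_univ_three]
  change B (planeRot 0 1 w) (planeRot 0 1 w) + B (planeRot 0 2 w) (planeRot 0 2 w) +
    B (planeRot 1 2 w) (planeRot 1 2 w) = _
  rw [bilin_expand B w w]
  simp only [planeRot, map_sub, map_smul, _root_.sub_apply, _root_.smul_apply, smul_eq_mul,
    Fin.sum_univ_three]
  ring

theorem sum_rot3_rot3 (w : EuclideanSpace ℝ (Fin 3)) :
    ∑ i, rot3 i (rot3 i w) = (-2 : ℝ) • w := by
  rw [Fin.sum_univ_three]
  change planeRot 0 1 (planeRot 0 1 w) + planeRot 0 2 (planeRot 0 2 w) +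
    planeRot 1 2 (planeRot 1 2 w) = _
  ext i; fin_cases i <;> simp [planeRot] <;> ring

/-- For unit `X`, the three vectors `X e_i` form an orthonormal basis of the orthogonal complement
of `X`. -/
theorem sum_quat_sq (B : EuclideanSpace ℝ (Fin 4) →L[ℝ] EuclideanSpace ℝ (Fin 4) →L[ℝ] ℝ)
    (X : EuclideanSpace ℝ (Fin 4)) :
    ∑ i, B (quat X (EuclideanSpace.single i 1)) (quat X (EuclideanSpace.single i 1)) =
      ‖X‖ ^ 2 * ∑ i, B (EuclideanSpace.single i 1) (EuclideanSpace.single i 1) - B X X := by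
  rw [EuclideanSpace.real_norm_sq_eq, bilin_expand B X X, Fin.sum_univ_three,
    bilin_expand B (quat X (EuclideanSpace.single 0 1)) _,
    bilin_expand B (quat X (EuclideanSpace.single 1 1)) _,
    bilin_expand B (quat X (EuclideanSpace.single 2 1)) _]
  simp only [Fin.sum_univ_four, quat_apply]
  simp
  ring

/-- The velocity of the geodesic `s ↦ geo X (s, ω)`. -/
def geoVel (X : EuclideanSpace ℝ (Fin 4)) (k : ℝ × EuclideanSpace ℝ (Fin 3)) :
    EuclideanSpace ℝ (Fin 4) := -(sin k.1 • X) + cos k.1 • quat X k.2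

theorem norm_geo {X : EuclideanSpace ℝ (Fin 4)} {k : ℝ × EuclideanSpace ℝ (Fin 3)}
    (hX : ‖X‖ = 1) (hk : ‖k.2‖ = 1) : ‖geo X k‖ = 1 := by
  have h : ‖geo X k‖ ^ 2 = 1 := by
    rw [← real_inner_self_eq_norm_sq, geo]
    simp only [inner_add_left, inner_add_right, real_inner_smul_left, real_inner_smul_right,
      inner_quat, real_inner_comm X (quat X k.2)]
    simp only [real_inner_self_eq_norm_sq, norm_quat, hX, hk]
    linear_combination sin_sq_add_cos_sq k.1
  exact (pow_eq_one_iff_of_nonneg (norm_nonneg _) two_ne_zero).1 h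

/-- The second order part of `□_g` at a point of the light cone, split into a part along the
generators of the cone and the Laplacian of `S²`. -/
theorem sum_second_polar (H : EuclideanSpace ℝ (Fin 4) →L[ℝ] EuclideanSpace ℝ (Fin 4) →L[ℝ] ℝ)
    (D : EuclideanSpace ℝ (Fin 4) →L[ℝ] ℝ) {X : EuclideanSpace ℝ (Fin 4)}
    {k : ℝ × EuclideanSpace ℝ (Fin 3)} (hX : ‖X‖ = 1) (hk : ‖k.2‖ = 1) :
    sin k.1 ^ 2 * ∑ i : Fin 6, (H (gammaLin i.succ (geo X k)) (gammaLin i.succ (geo X k)) +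
      D (gammaLin i.succ (gammaLin i.succ (geo X k)))) =
    sin k.1 ^ 2 * H (geoVel X k) (geoVel X k) - sin k.1 ^ 2 * D (geo X k) +
      2 * sin k.1 * cos k.1 * D (geoVel X k) +
      ∑ i, (sin k.1 ^ 2 * H (quat X (rot3 i k.2)) (quat X (rot3 i k.2)) +
        sin k.1 * D (quat X (rot3 i (rot3 i k.2)))) := by
  have e1 := sum_gammaLin_sq H (geo X k)
  have e2 := sum_rot3_sq (((ContinuousLinearMap.compL ℝ _ _ ℝ).flip (quat X)).comp
    (H.comp (quat X))) k.2
  have e3 := sum_quat_sq H X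
  simp only [ContinuousLinearMap.comp_apply, ContinuousLinearMap.flip_apply,
    ContinuousLinearMap.compL_apply] at e2
  have e4 : ∑ i : Fin 6, D (gammaLin i.succ (gammaLin i.succ (geo X k))) = -3 * D (geo X k) := by
    rw [← map_sum, sum_gammaLin_gammaLin, map_smul, smul_eq_mul]
  have e5 : ∑ i, D (quat X (rot3 i (rot3 i k.2))) = -2 * D (quat X k.2) := by
    rw [← map_sum, ← map_sum, sum_rot3_rot3, map_smul, map_smul, smul_eq_mul]
  -- `geo X k` and `geoVel X k` are `X` and `quat X k.2` rotated by the angle `k.1`, so the trace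
  -- over their plane is unchanged.
  have e6 : H (geoVel X k) (geoVel X k) + H (geo X k) (geo X k) =
      H X X + H (quat X k.2) (quat X k.2) := by
    simp only [geoVel, geo, map_add, map_neg, map_smul, _root_.add_apply,
      _root_.neg_apply, _root_.smul_apply, smul_eq_mul]
    linear_combination (H X X + H (quat X k.2) (quat X k.2)) * sin_sq_add_cos_sq k.1
  rw [norm_geo hX hk] at e1
  rw [hk] at e2
  rw [hX] at e3
  simp only [Finset.sum_add_distrib, ← Finset.mul_sum, e1, e2, e3, e4, e5]
  have e7 : D (geo X k) = cos k.1 * D X + sin k.1 * D (quat X k.2) := by simp [geo]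
  have e8 : D (geoVel X k) = -(sin k.1 * D X) + cos k.1 * D (quat X k.2) := by simp [geoVel]
  rw [e7, e8]
  linear_combination (-(sin k.1)^2) * e6 - 2 * sin k.1 * D (quat X k.2) * sin_sq_add_cos_sq k.1

/-- The spherical Laplacian of `ω ↦ φ (cone p (s, ω))`. -/
def angLap (φ : Ambient → ℝ) (p : Ambient) (k : ℝ × EuclideanSpace ℝ (Fin 3)) : ℝ :=
  ∑ i, fderiv ℝ (fun w => fderiv ℝ (fun w => φ (cone p (k.1, w))) w (rot3 i w)) k.2 (rot3 i k.2)

theorem contDiff_rot3_deriv {ψ : EuclideanSpace ℝ (Fin 3) → ℝ} (hψ : ContDiff ℝ ∞ ψ) (i : Fin 3) :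
    ContDiff ℝ ∞ fun w => fderiv ℝ ψ w (rot3 i w) :=
  (hψ.fderiv_right (m := ∞) (by simp)).clm_apply (rot3 i).contDiff

theorem integral_angLap {φ : Ambient → ℝ} (hφ : ContDiff ℝ ∞ φ) (p : Ambient) (s : ℝ) :
    ∫ w, angLap φ p (s, w) ∂(sphMeas 3) = 0 := by
  unfold angLap
  have hc := contDiff_cone_sphere hφ p s
  rw [integral_finsetSum]
  · refine Finset.sum_eq_zero fun i _ => ?_
    exact integral_planeRot (plane3_ne i) (contDiff_rot3_deriv hc i)
  · intro i _
    exact integrable_of_continuous_of_compl_null (isCompact_sphere 0 1) sphMeas_compl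
      (contDiff_rot3_deriv (contDiff_rot3_deriv hc i) i).continuous

theorem angLap_eq {φ : Ambient → ℝ} (hφ : ContDiff ℝ ∞ φ) (p : Ambient)
    (k : ℝ × EuclideanSpace ℝ (Fin 3)) : angLap φ p k = ∑ i,
      (sin k.1 ^ 2 * fderiv ℝ (fderiv ℝ φ) (cone p k) (0, quat p.2 (rot3 i k.2))
        (0, quat p.2 (rot3 i k.2)) +
        sin k.1 * fderiv ℝ φ (cone p k) (0, quat p.2 (rot3 i (rot3 i k.2)))) := by
  obtain ⟨s, w⟩ := k
  refine Finset.sum_congr rfl fun i _ => ?_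
  simp only [fderiv_cone_sphere_apply hφ]
  have h1 : HasFDerivAt (fderiv ℝ φ) (fderiv ℝ (fderiv ℝ φ) (cone p (s, w))) (cone p (s, w)) :=
    ((hφ.fderiv_right (m := ∞) (by simp)).differentiable (by simp) _).hasFDerivAt
  have h2 := h1.comp w (hasFDerivAt_cone_sphere p s w)
  have h3 : HasFDerivAt (fun w => ((0 : ℝ), sin s • quat p.2 (rot3 i w)))
      ((0 : EuclideanSpace ℝ (Fin 3) →L[ℝ] ℝ).prod ((sin s • quat p.2).comp (rot3 i))) w :=
    (hasFDerivAt_const _ w).prodMk ((sin s • quat p.2).comp (rot3 i)).hasFDerivAt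
  have h4 := (h2.clm_apply h3).fderiv
  simp only [Function.comp_def] at h4
  rw [h4]
  have e : ∀ v : EuclideanSpace ℝ (Fin 4), ((0 : ℝ), sin s • v) = sin s • ((0 : ℝ), v) := by
    intro v; simp
  simp only [_root_.add_apply, ContinuousLinearMap.comp_apply, ContinuousLinearMap.prod_apply,
    ContinuousLinearMap.flip_apply, _root_.zero_apply, _root_.smul_apply, e, map_smul,
    smul_eq_mul]
  ring

/-! ### Kirchhoff's formula solves the wave equation -/

theorem contDiff_box {φ : Ambient → ℝ} (hφ : ContDiff ℝ ∞ φ) : ContDiff ℝ ∞ (box φ) := by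
  unfold box
  exact (contDiff_gamma (contDiff_gamma hφ 0) 0).sub
    (ContDiff.sum fun i _ => contDiff_gamma (contDiff_gamma hφ i.succ) i.succ)

theorem box_eq {φ : Ambient → ℝ} (hφ : ContDiff ℝ ∞ φ) (p : Ambient) : box φ p =
    fderiv ℝ (fderiv ℝ φ) p (1, 0) (1, 0) - ∑ i : Fin 6,
      (fderiv ℝ (fderiv ℝ φ) p (0, gammaLin i.succ p.2) (0, gammaLin i.succ p.2) +
        fderiv ℝ φ p (0, gammaLin i.succ (gammaLin i.succ p.2))) := by
  simp only [box, gamma_gamma hφ, gammaField_eq, gammaLin_zero, if_true, Fin.succ_ne_zero,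
    if_false, _root_.zero_apply]
  rw [show ((0 : ℝ), (0 : EuclideanSpace ℝ (Fin 4))) = 0 from rfl, map_zero, add_zero]

/-- The derivative along a generator of the light cone of
`sin s (∂_T φ - ∂_s φ) - cos s φ`. -/
def coneFluxDeriv (φ : Ambient → ℝ) (p : Ambient) (k : ℝ × EuclideanSpace ℝ (Fin 3)) : ℝ :=
  -2 * cos k.1 * fderiv ℝ φ (cone p k) (0, geoVel p.2 k) +
    sin k.1 * (fderiv ℝ (fderiv ℝ φ) (cone p k) (1, 0) (1, 0) -
      fderiv ℝ (fderiv ℝ φ) (cone p k) (0, geoVel p.2 k) (0, geoVel p.2 k) +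
      fderiv ℝ φ (cone p k) (0, geo p.2 k)) + sin k.1 * φ (cone p k)

/-- The polar form `∂_s² + 2 cot s ∂_s + (sin s)⁻² Δ_{S²}` of the Laplacian. With the weight `sin
s`, the operator `□_g + 1` on the cone is an exact derivative along the generator, up to an angular
Laplacian whose mean over `S²` vanishes. -/
theorem sin_mul_box_add {φ : Ambient → ℝ} (hφ : ContDiff ℝ ∞ φ) {p : Ambient} (hp : ‖p.2‖ = 1)
    {k : ℝ × EuclideanSpace ℝ (Fin 3)} (hk : ‖k.2‖ = 1) (hs : sin k.1 ≠ 0) :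
    sin k.1 * (box φ (cone p k) + φ (cone p k)) =
      coneFluxDeriv φ p k - (sin k.1)⁻¹ * angLap φ p k := by
  have h := sum_second_polar (((ContinuousLinearMap.compL ℝ _ _ ℝ).flip
    (ContinuousLinearMap.inr ℝ ℝ (EuclideanSpace ℝ (Fin 4)))).comp
      ((fderiv ℝ (fderiv ℝ φ) (cone p k)).comp (ContinuousLinearMap.inr ℝ ℝ _)))
    ((fderiv ℝ φ (cone p k)).comp (ContinuousLinearMap.inr ℝ ℝ _)) hp hk
  simp only [ContinuousLinearMap.comp_apply, ContinuousLinearMap.flip_apply,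
    ContinuousLinearMap.compL_apply, ContinuousLinearMap.inr_apply] at h
  rw [← angLap_eq hφ] at h
  rw [box_eq hφ, coneFluxDeriv]
  have e : (cone p k).2 = geo p.2 k := rfl
  rw [e]
  field_simp
  linear_combination -h

theorem hasDerivAt_geo (X : EuclideanSpace ℝ (Fin 4)) (w : EuclideanSpace ℝ (Fin 3)) (s : ℝ) :
    HasDerivAt (fun s => geo X (s, w)) (geoVel X (s, w)) s := by
  refine (((hasDerivAt_cos s).smul_const X).fun_add
    ((hasDerivAt_sin s).smul_const (quat X w))).congr_deriv ?_
  simp [geoVel]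

theorem hasDerivAt_geoVel (X : EuclideanSpace ℝ (Fin 4)) (w : EuclideanSpace ℝ (Fin 3)) (s : ℝ) :
    HasDerivAt (fun s => geoVel X (s, w)) (-geo X (s, w)) s := by
  refine ((((hasDerivAt_sin s).smul_const X).fun_neg).fun_add
    ((hasDerivAt_cos s).smul_const (quat X w))).congr_deriv ?_
  simp only [geo]
  module

theorem hasDerivAt_cone (p : Ambient) (w : EuclideanSpace ℝ (Fin 3)) (s : ℝ) :
    HasDerivAt (fun s => cone p (s, w)) (1, geoVel p.2 (s, w)) s :=
  ((hasDerivAt_id s).const_add p.1).prodMk (hasDerivAt_geo p.2 w s)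

/-- The flux `sin s (∂_T φ - ∂_s φ) - cos s φ` on the light cone. -/
def coneFlux (φ : Ambient → ℝ) (p : Ambient) (k : ℝ × EuclideanSpace ℝ (Fin 3)) : ℝ :=
  sin k.1 * fderiv ℝ φ (cone p k) (1, -geoVel p.2 k) - cos k.1 * φ (cone p k)

theorem hasDerivAt_coneFlux {φ : Ambient → ℝ} (hφ : ContDiff ℝ ∞ φ) (p : Ambient)
    (w : EuclideanSpace ℝ (Fin 3)) (s : ℝ) :
    HasDerivAt (fun s => coneFlux φ p (s, w)) (coneFluxDeriv φ p (s, w)) s := by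
  have h1 : HasFDerivAt (fderiv ℝ φ) (fderiv ℝ (fderiv ℝ φ) (cone p (s, w))) (cone p (s, w)) :=
    ((hφ.fderiv_right (m := ∞) (by simp)).differentiable (by simp) _).hasFDerivAt
  have h2 := h1.comp_hasDerivAt s (hasDerivAt_cone p w s)
  have h3 : HasDerivAt (fun s => ((1 : ℝ), -geoVel p.2 (s, w))) (0, geo p.2 (s, w)) s := by
    simpa using (hasDerivAt_const s (1 : ℝ)).prodMk (hasDerivAt_geoVel p.2 w s).fun_neg
  have h4 := (hφ.differentiable (by simp) (cone p (s, w))).hasFDerivAt.comp_hasDerivAt s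
    (hasDerivAt_cone p w s)
  have h5 := ((hasDerivAt_sin s).fun_mul (h2.clm_apply h3)).fun_sub
    ((hasDerivAt_cos s).fun_mul h4)
  refine h5.congr_deriv ?_
  -- Symmetry cancels the mixed terms, as in `(∂_T + ∂_s)(∂_T - ∂_s) = ∂_T² - ∂_s²`.
  have hsymm := (hφ.contDiffAt (x := cone p (s, w))).isSymmSndFDerivAt
    (by rw [minSmoothness_of_isRCLikeNormedField]; exact WithTop.coe_le_coe.2 le_top)
  have e1 : ((1 : ℝ), geoVel p.2 (s, w)) = (1, 0) + (0, geoVel p.2 (s, w)) := by simp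
  have e2 : ((1 : ℝ), -geoVel p.2 (s, w)) = (1, 0) - (0, geoVel p.2 (s, w)) := by simp
  have e3 := hsymm (1, 0) (0, geoVel p.2 (s, w))
  simp only [Function.comp_def, coneFluxDeriv, e1, e2, map_add, map_sub, _root_.add_apply]
  rw [e3]
  ring

theorem continuous_geoVel (X : EuclideanSpace ℝ (Fin 4)) : Continuous (geoVel X) := by
  unfold geoVel; fun_prop

theorem continuous_geo (X : EuclideanSpace ℝ (Fin 4)) : Continuous (geo X) := by
  unfold geo; fun_prop

theorem continuous_coneFluxDeriv {φ : Ambient → ℝ} (hφ : ContDiff ℝ ∞ φ) (p : Ambient) :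
    Continuous (coneFluxDeriv φ p) := by
  have h0 := hφ.continuous.comp (continuous_cone p)
  have h1 : Continuous fun k => fderiv ℝ φ (cone p k) :=
    (hφ.continuous_fderiv (by simp)).comp (continuous_cone p)
  have h2 : Continuous fun k => fderiv ℝ (fderiv ℝ φ) (cone p k) :=
    ((hφ.fderiv_right (m := ∞) (by simp)).continuous_fderiv (by simp)).comp (continuous_cone p)
  have h3 : Continuous fun k => ((0 : ℝ), geoVel p.2 k) :=
    continuous_const.prodMk (continuous_geoVel p.2)
  have h4 : Continuous fun k => ((0 : ℝ), geo p.2 k) :=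
    continuous_const.prodMk (continuous_geo p.2)
  have hs : Continuous fun k : ℝ × EuclideanSpace ℝ (Fin 3) => sin k.1 := by fun_prop
  have hc : Continuous fun k : ℝ × EuclideanSpace ℝ (Fin 3) => -2 * cos k.1 := by fun_prop
  exact ((hc.mul (h1.clm_apply h3)).add (hs.mul ((((h2.clm_apply continuous_const).clm_apply
    continuous_const).sub ((h2.clm_apply h3).clm_apply h3)).add (h1.clm_apply h4)))).add
      (hs.mul h0)

theorem box_add_potential {φ : Ambient → ℝ} (hφ : ContDiff ℝ ∞ φ) (p : Ambient) :
    box (potential φ) p + potential φ p =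
      sphMass⁻¹ * ∫ k, sin k.1 * (box φ (cone p k) + φ (cone p k)) ∂kerMeas := by
  have hi : ∀ i, Integrable (fun k => sin k.1 * gamma i (gamma i φ) (cone p k)) kerMeas :=
    fun i => integrable_kernel (continuous_kernel (contDiff_gamma (contDiff_gamma hφ i) i) p)
  have h1 : ∀ k : ℝ × EuclideanSpace ℝ (Fin 3), sin k.1 * (box φ (cone p k) + φ (cone p k)) =
      (sin k.1 * gamma 0 (gamma 0 φ) (cone p k) - ∑ i : Fin 6,
        sin k.1 * gamma i.succ (gamma i.succ φ) (cone p k)) + sin k.1 * φ (cone p k) := by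
    intro k
    rw [box, mul_add, mul_sub, Finset.mul_sum]
  have hs : Integrable (fun k => ∑ i : Fin 6, sin k.1 * gamma i.succ (gamma i.succ φ) (cone p k))
      kerMeas := integrable_finsetSum _ fun i _ => hi i.succ
  have hd : Integrable (fun k => sin k.1 * gamma 0 (gamma 0 φ) (cone p k) - ∑ i : Fin 6,
      sin k.1 * gamma i.succ (gamma i.succ φ) (cone p k)) kerMeas := (hi 0).sub hs
  simp only [h1]
  rw [integral_add hd
    (integrable_kernel (continuous_kernel hφ p)), integral_sub (hi 0) hs, integral_finsetSum _ fun i _ => hi i.succ]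
  simp only [box, gamma_potential hφ, gamma_potential (contDiff_gamma hφ _)]
  simp only [potential, mul_add, mul_sub, Finset.mul_sum]

theorem integrable_sphere_slice {g : ℝ × EuclideanSpace ℝ (Fin 3) → ℝ} (hg : Continuous g)
    (s : ℝ) : Integrable (fun w => g (s, w)) (sphMeas 3) := by
  have h : Continuous fun w => g (s, w) := hg.comp (Continuous.prodMk_right s)
  exact integrable_of_continuous_of_compl_null (isCompact_sphere 0 1) sphMeas_compl h

/-- The angular term integrates to zero on each sphere. The remaining derivative is integrated along
each generator, where the flux leaves the value at the vertex (`s = 0`) and at the antipodal focus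
(`s = π`). -/
theorem integral_cone_box {φ : Ambient → ℝ} (hφ : ContDiff ℝ ∞ φ) {p : Ambient}
    (hp : ‖p.2‖ = 1) : ∫ k, sin k.1 * (box φ (cone p k) + φ (cone p k)) ∂kerMeas =
      sphMass * (φ p + φ (p.1 + π, -p.2)) := by
  have hcont : Continuous fun k => sin k.1 * (box φ (cone p k) + φ (cone p k)) :=
    continuous_kernel ((contDiff_box hφ).add hφ) p
  have hi := integrable_kernel hcont
  have hi2 := integrable_kernel (continuous_coneFluxDeriv hφ p)
  have hae : ∀ᵐ w ∂(sphMeas 3), ‖w‖ = 1 := by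
    filter_upwards [mem_ae_iff.2 (sphMeas_compl (n := 3))] with w hw
    simpa using hw
  have h1 : ∫ k, sin k.1 * (box φ (cone p k) + φ (cone p k)) ∂kerMeas =
      ∫ k, coneFluxDeriv φ p k ∂kerMeas := by
    rw [kerMeas] at hi hi2 ⊢
    -- The open interval drops only a null set and excludes the zeros of `sin`.
    rw [integral_prod _ hi, integral_prod _ hi2, ← Measure.restrict_congr_set Ioo_ae_eq_Icc]
    refine setIntegral_congr_fun measurableSet_Ioo fun s hs => ?_
    have hs0 : sin s ≠ 0 := (sin_pos_of_mem_Ioo hs).ne'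
    have hc1 : Integrable (fun w => coneFluxDeriv φ p (s, w)) (sphMeas 3) :=
      integrable_sphere_slice (continuous_coneFluxDeriv hφ p) s
    have hc2 : Integrable (fun w => sin s * (box φ (cone p (s, w)) + φ (cone p (s, w))))
        (sphMeas 3) := integrable_sphere_slice hcont s
    have he : ∀ᵐ w ∂(sphMeas 3), coneFluxDeriv φ p (s, w) -
        sin s * (box φ (cone p (s, w)) + φ (cone p (s, w))) =
          (sin s)⁻¹ * angLap φ p (s, w) := by
      filter_upwards [hae] with w hw
      rw [sin_mul_box_add hφ hp (k := (s, w)) hw hs0]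
      ring
    have h3 := integral_congr_ae he
    rw [integral_sub hc1 hc2, integral_const_mul (sin s)⁻¹, integral_angLap hφ, mul_zero, sub_eq_zero] at h3
    exact h3.symm
  rw [h1]
  rw [kerMeas] at hi2 ⊢
  rw [integral_prod_symm _ hi2]
  have h2 : ∀ w, ∫ s in Set.Icc 0 π, coneFluxDeriv φ p (s, w) = φ p + φ (p.1 + π, -p.2) := by
    intro w
    rw [integral_Icc_eq_integral_Ioc, ← intervalIntegral.integral_of_le pi_pos.le,
      intervalIntegral.integral_eq_sub_of_hasDerivAt (fun s _ => hasDerivAt_coneFlux hφ p w s)]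
    · simp [coneFlux, cone, geo]
      ring
    · have h : Continuous fun s => coneFluxDeriv φ p (s, w) :=
        (continuous_coneFluxDeriv hφ p).comp (Continuous.prodMk_left w)
      exact h.intervalIntegrable _ _
  simp only [h2, integral_const, smul_eq_mul, sphMass]

/-- On `S³`, the potential solves the wave equation. -/
theorem box_potential {φ : Ambient → ℝ} (hφ : ContDiff ℝ ∞ φ) {p : Ambient} (hp : ‖p.2‖ = 1) :
    box (potential φ) p + potential φ p = φ p + φ (p.1 + π, -p.2) := by
  rw [box_add_potential hφ, integral_cone_box hφ hp, inv_mul_cancel_left₀ sphMass_pos.ne']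

/-! ### Huygens' principle -/

theorem potential_congr {φ ψ : Ambient → ℝ} {p : Ambient}
    (h : ∀ k ∈ kerSet, φ (cone p k) = ψ (cone p k)) : potential φ p = potential ψ p := by
  unfold potential
  congr 1
  refine integral_congr_ae ?_
  filter_upwards [mem_ae_iff.2 kerMeas_compl] with k hk
  rw [h k hk]

theorem potential_eq_zero {φ : Ambient → ℝ} {p : Ambient}
    (h : ∀ k ∈ kerSet, φ (cone p k) = 0) : potential φ p = 0 := by
  rw [potential_congr (ψ := fun _ => 0) h]
  simp [potential]

theorem polarR_eq_angle (X : S3) : polarR X =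
    InnerProductGeometry.angle (EuclideanSpace.single (0 : Fin 4) (1 : ℝ)) X.1 := by
  have hX : ‖(X : EuclideanSpace ℝ (Fin 4))‖ = 1 := by simp
  rw [polarR, InnerProductGeometry.angle, hX]
  simp [EuclideanSpace.inner_single_left]

/-- The points of the light cone of `P` at distance `s`. -/
theorem exists_cone_eq_incl (P : Cyl) {k : ℝ × EuclideanSpace ℝ (Fin 3)} (hk : k ∈ kerSet) :
    ∃ Q : Cyl, cone (incl P) k = incl Q ∧ Q.1 = P.1 + k.1 ∧ polarR P.2 ≤ k.1 + polarR Q.2 ∧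
      polarR Q.2 ≤ polarR P.2 + k.1 ∧ k.1 ≤ polarR P.2 + polarR Q.2 := by
  have hX : ‖(P.2 : EuclideanSpace ℝ (Fin 4))‖ = 1 := by simp
  have hw : ‖k.2‖ = 1 := by simpa using hk.2
  have hg : ‖geo P.2 k‖ = 1 := norm_geo hX hw
  have ha : InnerProductGeometry.angle (P.2 : EuclideanSpace ℝ (Fin 4)) (geo P.2 k) = k.1 := by
    rw [InnerProductGeometry.angle, hX, hg]
    simp only [geo, inner_add_right, real_inner_smul_right, inner_quat,
      real_inner_self_eq_norm_sq, hX]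
    rw [show (cos k.1 * 1 ^ 2 + sin k.1 * 0) / (1 * 1) = cos k.1 by ring]
    exact arccos_cos hk.1.1 hk.1.2
  refine ⟨(P.1 + k.1, ⟨geo P.2 k, by simpa using hg⟩), rfl, rfl, ?_⟩
  simp only [polarR_eq_angle]
  have t1 := InnerProductGeometry.angle_le_angle_add_angle
    (EuclideanSpace.single (0 : Fin 4) (1 : ℝ)) (geo P.2 k) P.2
  have t2 := InnerProductGeometry.angle_le_angle_add_angle
    (EuclideanSpace.single (0 : Fin 4) (1 : ℝ)) P.2 (geo P.2 k)
  have t3 := InnerProductGeometry.angle_le_angle_add_angle (P.2 : EuclideanSpace ℝ (Fin 4))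
    (EuclideanSpace.single (0 : Fin 4) (1 : ℝ)) (geo P.2 k)
  rw [InnerProductGeometry.angle_comm (geo _ _), ha] at t1
  rw [ha] at t2 t3
  rw [InnerProductGeometry.angle_comm (P.2 : EuclideanSpace ℝ (Fin 4))] at t3
  exact ⟨by linarith, by linarith, by linarith⟩

/-! ### The energy identity on `S³` -/

theorem ae_norm_eq_one {n : ℕ} : ∀ᵐ x ∂(sphMeas n), ‖x‖ = 1 := by
  filter_upwards [mem_ae_iff.2 (sphMeas_compl (n := n))] with x hx
  simpa using hx

theorem integrable_slice {g : Ambient → ℝ} (hg : Continuous g) (T : ℝ) :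
    Integrable (fun x => g (T, x)) (sphMeas 4) := by
  have h : Continuous fun x => g (T, x) := hg.comp (Continuous.prodMk_right T)
  exact integrable_of_continuous_of_compl_null (isCompact_sphere 0 1) sphMeas_compl h

theorem fderiv_slice {g : Ambient → ℝ} (hg : ContDiff ℝ ∞ g) (p : Ambient)
    (v : EuclideanSpace ℝ (Fin 4)) :
    fderiv ℝ (fun x => g (p.1, x)) p.2 v = fderiv ℝ g p (0, v) := by
  have h := ((hg.differentiable (by simp) p).hasFDerivAt.comp p.2
    (hasFDerivAt_prodMk_right (𝕜 := ℝ) p.1 p.2)).fderiv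
  simp only [Function.comp_def] at h
  rw [h]
  rfl

theorem integral_gamma_succ {g : Ambient → ℝ} (hg : ContDiff ℝ ∞ g) (i : Fin 6) (T : ℝ) :
    ∫ x, gamma i.succ g (T, x) ∂(sphMeas 4) = 0 := by
  obtain ⟨j, k, hjk, h⟩ := gammaLin_succ_exists i
  have hc : ContDiff ℝ ∞ fun x => g (T, x) := hg.comp (contDiff_const.prodMk contDiff_id)
  rw [← integral_planeRot hjk hc]
  refine integral_congr_ae (Filter.Eventually.of_forall fun x => ?_)
  change fderiv ℝ g (T, x) (gammaField i.succ (T, x)) = _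
  rw [gammaField_eq, if_neg (Fin.succ_ne_zero i), h]
  exact (fderiv_slice hg (T, x) _).symm

theorem hasDerivAt_integral_slice {g : Ambient → ℝ} (hg : ContDiff ℝ ∞ g) (T : ℝ) :
    HasDerivAt (fun T => ∫ x, g (T, x) ∂(sphMeas 4)) (∫ x, gamma 0 g (T, x) ∂(sphMeas 4)) T := by
  have h := hasFDerivAt_integral_param (isCompact_sphere 0 1) (sphMeas_compl (n := 4))
    (g := fun T x => g (T, x)) hg T
  have h1 := h.hasDerivAt
  rw [← h.fderiv, fderiv_integral_param_apply (isCompact_sphere 0 1) (sphMeas_compl (n := 4))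
    (g := fun T x => g (T, x)) hg] at h1
  refine h1.congr_deriv (integral_congr_ae (Filter.Eventually.of_forall fun x => ?_))
  have h2 := ((hg.differentiable (by simp) (T, x)).hasFDerivAt.comp T
    (hasFDerivAt_prodMk_left (𝕜 := ℝ) T x)).fderiv
  simp only [Function.comp_def] at h2
  simp only [h2]
  change _ = fderiv ℝ g (T, x) (gammaField 0 (T, x))
  rw [gammaField_eq, if_pos rfl, gammaLin_zero]
  rfl

theorem gamma_comm_zero {g : Ambient → ℝ} (hg : ContDiff ℝ ∞ g) (i : Fin 7) (p : Ambient) :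
    gamma 0 (gamma i g) p = gamma i (gamma 0 g) p := by
  refine Fin.cases rfl (fun i => ?_) i
  have h1 : HasFDerivAt (fderiv ℝ g) (fderiv ℝ (fderiv ℝ g) p) p :=
    ((hg.fderiv_right (m := ∞) (by simp)).differentiable (by simp) p).hasFDerivAt
  have h2 : ∀ i, HasFDerivAt (gammaField i)
      ((0 : Ambient →L[ℝ] ℝ).prod ((gammaLin i).comp (ContinuousLinearMap.snd ℝ _ _))) p := by
    intro i
    have h : gammaField i = fun p : Ambient => ((if i = 0 then 1 else 0 : ℝ), gammaLin i p.2) :=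
      funext (gammaField_eq i)
    rw [h]
    exact (hasFDerivAt_const _ p).prodMk ((gammaLin i).hasFDerivAt.comp p hasFDerivAt_snd)
  have h3 : ∀ i, HasFDerivAt (gamma i g) _ p := fun i => h1.clm_apply (h2 i)
  have hsymm := (hg.contDiffAt (x := p)).isSymmSndFDerivAt
    (by rw [minSmoothness_of_isRCLikeNormedField]; exact WithTop.coe_le_coe.2 le_top)
  change fderiv ℝ (gamma i.succ g) p (gammaField 0 p) = fderiv ℝ (gamma 0 g) p (gammaField i.succ p)
  rw [(h3 i.succ).fderiv, (h3 0).fderiv]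
  simp only [gammaField_eq, gammaLin_zero, if_true, Fin.succ_ne_zero, if_false, _root_.add_apply,
    ContinuousLinearMap.flip_apply, ContinuousLinearMap.comp_apply,
    ContinuousLinearMap.prod_apply, _root_.zero_apply, ContinuousLinearMap.coe_snd', map_zero]
  rw [hsymm (1, 0)]

/-- The energy density of `w`. -/
def energyDensity (w : Ambient → ℝ) (p : Ambient) : ℝ :=
  (∑ i, gamma i w p * gamma i w p + w p * w p) / 2

/-- The energy of `w` at time `T`. -/
def energy (w : Ambient → ℝ) (T : ℝ) : ℝ := ∫ x, energyDensity w (T, x) ∂(sphMeas 4)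

theorem contDiff_energyDensity {w : Ambient → ℝ} (hw : ContDiff ℝ ∞ w) :
    ContDiff ℝ ∞ (energyDensity w) :=
  ((ContDiff.sum fun i _ => (contDiff_gamma hw i).mul (contDiff_gamma hw i)).add
    (hw.mul hw)).div_const _

/-- The energy identity in divergence form, from `Γᵢw · ΓᵢΓ₀w = Γᵢ(Γ₀w · Γᵢw) - Γ₀w · Γᵢ²w`. The
term `w²` in the density accounts for the `+ 1` in `□_g + 1`. -/
theorem gamma_zero_energyDensity {w : Ambient → ℝ} (hw : ContDiff ℝ ∞ w) (p : Ambient) :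
    gamma 0 (energyDensity w) p = gamma 0 w p * (box w p + w p) +
      ∑ i : Fin 6, gamma i.succ (fun q => gamma 0 w q * gamma i.succ w q) p := by
  have hΓ := contDiff_gamma hw
  have hd : ∀ {g : Ambient → ℝ}, ContDiff ℝ ∞ g → HasFDerivAt g (fderiv ℝ g p) p :=
    fun hg => (hg.differentiable (by simp) p).hasFDerivAt
  have h1 : HasFDerivAt (energyDensity w) _ p :=
    ((HasFDerivAt.fun_sum fun i (_ : i ∈ Finset.univ) => (hd (hΓ i)).mul (hd (hΓ i))).add
    ((hd hw).mul (hd hw))).mul_const 2⁻¹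
  have h2 : gamma 0 (energyDensity w) p =
      ∑ i, gamma i w p * gamma 0 (gamma i w) p + w p * gamma 0 w p := by
    simp only [gamma] at h1 ⊢
    rw [h1.fderiv]
    simp only [_root_.smul_apply, _root_.add_apply, _root_.sum_apply, smul_eq_mul,
      Finset.sum_add_distrib]
    ring
  rw [h2, Fin.sum_univ_succ]
  simp only [gamma_mul (hΓ 0) (hΓ _), box, gamma_comm_zero hw, Finset.sum_add_distrib,
    ← Finset.mul_sum]
  simp only [mul_comm (gamma (Fin.succ _) w p)]
  ring

theorem hasDerivAt_energy {w f : Ambient → ℝ} (hw : ContDiff ℝ ∞ w) {T : ℝ}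
    (h : ∀ x, ‖x‖ = 1 → box w (T, x) + w (T, x) = f (T, x)) :
    HasDerivAt (energy w) (∫ x, gamma 0 w (T, x) * f (T, x) ∂(sphMeas 4)) T := by
  refine (hasDerivAt_integral_slice (contDiff_energyDensity hw) T).congr_deriv ?_
  have hc : ∀ i : Fin 6, ContDiff ℝ ∞ fun q => gamma 0 w q * gamma i.succ w q :=
    fun i => (contDiff_gamma hw 0).mul (contDiff_gamma hw i.succ)
  have hb : Continuous fun q => gamma 0 w q * (box w q + w q) :=
    ((contDiff_gamma hw 0).mul ((contDiff_box hw).add hw)).continuous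
  simp only [gamma_zero_energyDensity hw]
  rw [integral_add (integrable_slice hb T) (integrable_finsetSum _ fun i _ =>
      integrable_slice (contDiff_gamma (hc i) i.succ).continuous T), integral_finsetSum _ fun i _ =>
      integrable_slice (contDiff_gamma (hc i) i.succ).continuous T]
  simp only [integral_gamma_succ (hc _), Finset.sum_const_zero, add_zero]
  refine integral_congr_ae ?_
  filter_upwards [ae_norm_eq_one] with x hx
  rw [h x hx]

theorem sq_le_energyDensity (w : Ambient → ℝ) (i : Fin 7) (p : Ambient) :
    gamma i w p ^ 2 ≤ 2 * energyDensity w p := by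
  have h := Finset.single_le_sum (f := fun i => gamma i w p * gamma i w p)
    (fun i _ => mul_self_nonneg _) (Finset.mem_univ i)
  beta_reduce at h
  rw [energyDensity]
  nlinarith [mul_self_nonneg (w p)]

theorem integral_gamma_sq_le_energy {w : Ambient → ℝ} (hw : ContDiff ℝ ∞ w) (i : Fin 7) (T : ℝ) :
    ∫ x, gamma i w (T, x) ^ 2 ∂(sphMeas 4) ≤ 2 * energy w T := by
  rw [energy, ← integral_const_mul]
  exact integral_mono (integrable_slice ((contDiff_gamma hw i).pow 2).continuous T)
    (integrable_slice (continuous_const.mul (contDiff_energyDensity hw).continuous) T)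
    fun x => sq_le_energyDensity w i _

theorem energy_nonneg (w : Ambient → ℝ) (T : ℝ) : 0 ≤ energy w T :=
  integral_nonneg fun x => by
    have := sq_le_energyDensity w 0 (T, x)
    simp only [Pi.zero_apply]
    nlinarith [sq_nonneg (gamma 0 w (T, x))]

theorem continuous_integral_slice {g : Ambient → ℝ} (hg : ContDiff ℝ ∞ g) :
    Continuous fun T => ∫ x, g (T, x) ∂(sphMeas 4) :=
  continuous_iff_continuousAt.2 fun T => (hasDerivAt_integral_slice hg T).continuousAt

/-- The energy estimate for a source supported in a short time interval. -/
theorem energy_le {w f : Ambient → ℝ} (hw : ContDiff ℝ ∞ w) (hf : ContDiff ℝ ∞ f)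
    (h : ∀ T ∈ Set.Icc 0 π, ∀ x, ‖x‖ = 1 → box w (T, x) + w (T, x) = f (T, x))
    (hfin : energy w π = 0) {a τ : ℝ} (hτ : 0 < τ)
    (hsupp : ∀ T ∈ Set.Icc 0 π, T ∉ Set.Icc a (a + τ) → ∀ x, ‖x‖ = 1 → f (T, x) = 0)
    {T : ℝ} (hT : T ∈ Set.Icc 0 π) :
    energy w T ≤ 2 * τ * ∫ t in Set.Icc 0 π, ∫ x, f (t, x) ^ 2 ∂(sphMeas 4) := by
  have hEc : Continuous (energy w) := continuous_integral_slice (contDiff_energyDensity hw)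
  -- At a time of maximal energy `M`, the energy terms on the right are bounded by `M` and can be
  -- absorbed.
  obtain ⟨T₀, hT₀, hmax⟩ := isCompact_Icc.exists_isMaxOn ⟨T, hT⟩ hEc.continuousOn
  refine (hmax hT).trans ?_
  change energy w T₀ ≤ _
  set M := energy w T₀ with hM
  have hM0 : 0 ≤ M := energy_nonneg w T₀
  set S : ℝ → ℝ := fun t => ∫ x, f (t, x) ^ 2 ∂(sphMeas 4) with hS
  have hSc : Continuous S := continuous_integral_slice (hf.pow 2)
  have hS0 : ∀ t, 0 ≤ S t := fun t => integral_nonneg fun x => sq_nonneg _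
  set e : ℝ → ℝ := fun t => ∫ x, gamma 0 w (t, x) * f (t, x) ∂(sphMeas 4) with he
  have hec : Continuous e := continuous_integral_slice ((contDiff_gamma hw 0).mul hf)
  have hsub : Set.Ioc T₀ π ⊆ Set.Icc 0 π := fun t ht => ⟨hT₀.1.trans ht.1.le, ht.2⟩
  have h1 : ∫ t in T₀..π, e t = energy w π - energy w T₀ := by
    refine intervalIntegral.integral_eq_sub_of_hasDerivAt (fun t ht => ?_)
      (hec.intervalIntegrable _ _)
    rw [Set.uIcc_of_le hT₀.2] at ht
    exact hasDerivAt_energy hw (h t ⟨hT₀.1.trans ht.1, ht.2⟩)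
  rw [hfin, zero_sub, intervalIntegral.integral_of_le hT₀.2] at h1
  -- Young's inequality with weights `1/(4τ)` and `τ`: over a support of length `τ` the first term
  -- integrates to at most `M/2`, which leaves `M ≤ M/2 + τ ∫ S`.
  have h2 : ∀ t ∈ Set.Ioc T₀ π,
      -e t ≤ (Set.Icc a (a + τ)).indicator (fun _ => M / (2 * τ)) t + τ * S t := by
    intro t ht
    by_cases hta : t ∈ Set.Icc a (a + τ)
    · rw [Set.indicator_of_mem hta]
      have h3 : -e t ≤ ∫ x, (1 / (4 * τ) * gamma 0 w (t, x) ^ 2 + τ * f (t, x) ^ 2) ∂(sphMeas 4) := by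
        rw [he]
        simp only
        rw [← integral_neg]
        refine integral_mono (integrable_slice
          (((contDiff_gamma hw 0).mul hf).neg).continuous t) (integrable_slice (g := fun p =>
            1 / (4 * τ) * gamma 0 w p ^ 2 + τ * f p ^ 2) ((contDiff_const.mul
            ((contDiff_gamma hw 0).pow 2)).add (contDiff_const.mul (hf.pow 2))).continuous t)
            fun x => ?_
        simp only
        have h4 : 0 ≤ (1 / (4 * τ)) * (gamma 0 w (t, x) + 2 * τ * f (t, x)) ^ 2 := by positivity
        have h5 : (1 / (4 * τ)) * (gamma 0 w (t, x) + 2 * τ * f (t, x)) ^ 2 =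
          1 / (4 * τ) * gamma 0 w (t, x) ^ 2 + τ * f (t, x) ^ 2 +
            gamma 0 w (t, x) * f (t, x) := by
          field_simp; ring
        linarith
      refine h3.trans ?_
      have i1 : Integrable (fun x => 1 / (4 * τ) * gamma 0 w (t, x) ^ 2) (sphMeas 4) :=
        (integrable_slice ((contDiff_gamma hw 0).pow 2).continuous t).const_mul _
      have i2 : Integrable (fun x => τ * f (t, x) ^ 2) (sphMeas 4) :=
        (integrable_slice (hf.pow 2).continuous t).const_mul _
      rw [integral_add i1 i2, integral_const_mul, integral_const_mul]
      have h6 := integral_gamma_sq_le_energy hw 0 t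
      have h7 : energy w t ≤ M := hmax (hsub ht)
      have h8 : 1 / (4 * τ) * ∫ x, gamma 0 w (t, x) ^ 2 ∂(sphMeas 4) ≤ 1 / (4 * τ) * (2 * M) := by
        gcongr
        linarith
      have h9 : 1 / (4 * τ) * (2 * M) = M / (2 * τ) := by field_simp; ring
      linarith
    · rw [Set.indicator_of_notMem hta, zero_add]
      have h3 : e t = 0 := by
        refine integral_eq_zero_of_ae ?_
        filter_upwards [ae_norm_eq_one] with x hx
        rw [hsupp t (hsub ht) hta x hx, mul_zero, Pi.zero_apply]
      rw [h3, neg_zero]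
      exact mul_nonneg hτ.le (hS0 t)
  have hi1 : IntegrableOn ((Set.Icc a (a + τ)).indicator (fun _ => M / (2 * τ)))
      (Set.Ioc T₀ π) := (integrable_const _).indicator measurableSet_Icc
  have hi2 : IntegrableOn (fun t => τ * S t) (Set.Ioc T₀ π) :=
    (continuous_const.mul hSc).integrableOn_Ioc
  have h3 : -∫ t in Set.Ioc T₀ π, e t ≤ M / 2 + τ * ∫ t in Set.Icc 0 π, S t := by
    rw [← integral_neg]
    refine (setIntegral_mono_on hec.neg.integrableOn_Ioc (hi1.add hi2) measurableSet_Ioc h2).trans ?_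
    rw [integral_add' hi1 hi2, integral_const_mul]
    refine add_le_add ?_ ?_
    · rw [setIntegral_indicator measurableSet_Icc, setIntegral_const, smul_eq_mul]
      have h4 : volume.real (Set.Ioc T₀ π ∩ Set.Icc a (a + τ)) ≤ τ := by
        refine (measureReal_mono Set.inter_subset_right measure_Icc_lt_top.ne).trans ?_
        simp [hτ.le]
      calc _ ≤ τ * (M / (2 * τ)) := by gcongr
        _ = M / 2 := by field_simp
    · exact mul_le_mul_of_nonneg_left (setIntegral_mono_set hSc.integrableOn_Icc
        (Filter.Eventually.of_forall hS0) (LE.le.eventuallyLE hsub)) hτ.le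
  rw [h1] at h3
  linarith

/-! ### Norms over the slab `0 ≤ T ≤ π` -/

/-- The slab `0 ≤ T ≤ π`. -/
def slab : Set Cyl := {p | p.1 ∈ Set.Icc 0 π}

theorem continuous_incl : Continuous incl :=
  continuous_fst.prodMk (continuous_subtype_val.comp continuous_snd)

theorem restrict_slab : cylMeasure.restrict slab =
    (volume.restrict (Set.Icc 0 π)).prod
      (volume : Measure (EuclideanSpace ℝ (Fin 4))).toSphere := by
  rw [cylMeasure, show slab = Set.Icc 0 π ×ˢ Set.univ by ext; simp [slab], ← Measure.prod_restrict,
    Measure.restrict_univ]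

theorem isCompact_slab : IsCompact slab := by
  rw [show slab = Set.Icc 0 π ×ˢ Set.univ by ext; simp [slab]]
  exact isCompact_Icc.prod isCompact_univ

instance : IsFiniteMeasure (cylMeasure.restrict slab) := by
  rw [restrict_slab]; infer_instance

instance : IsLocallyFiniteMeasure cylMeasure := by unfold cylMeasure; infer_instance

theorem integrableOn_slab {g : Ambient → ℝ} (hg : Continuous g) :
    IntegrableOn (fun p => g (incl p)) slab cylMeasure :=
  (hg.comp continuous_incl).continuousOn.integrableOn_compact isCompact_slab

theorem integral_slab {g : Ambient → ℝ} (hg : Continuous g) :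
    ∫ p in slab, g (incl p) ∂cylMeasure =
      ∫ t in Set.Icc 0 π, ∫ x, g (t, x) ∂(sphMeas 4) := by
  have h := integrableOn_slab hg
  rw [IntegrableOn, restrict_slab] at h
  rw [restrict_slab, integral_prod _ h]
  simp only [integral_sphMeas]
  rfl

theorem lintegral_slab {g : Ambient → ℝ} (hg : Continuous g) (hg0 : ∀ p, 0 ≤ g p) :
    ∫⁻ p in slab, ENNReal.ofReal (g (incl p)) ∂cylMeasure =
      ENNReal.ofReal (∫ t in Set.Icc 0 π, ∫ x, g (t, x) ∂(sphMeas 4)) := by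
  rw [← integral_slab hg, ofReal_integral_eq_lintegral_ofReal (integrableOn_slab hg)
    (Filter.Eventually.of_forall fun p => hg0 _)]

/-- The energy estimate, integrated in time. -/
theorem lintegral_gamma_sq_le {w f : Ambient → ℝ} (hw : ContDiff ℝ ∞ w) (hf : ContDiff ℝ ∞ f)
    (h : ∀ T ∈ Set.Icc 0 π, ∀ x, ‖x‖ = 1 → box w (T, x) + w (T, x) = f (T, x))
    (hfin : energy w π = 0) {a τ : ℝ} (hτ : 0 < τ)
    (hsupp : ∀ T ∈ Set.Icc 0 π, T ∉ Set.Icc a (a + τ) → ∀ x, ‖x‖ = 1 → f (T, x) = 0)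
    (i : Fin 7) :
    ∫⁻ p in slab, ENNReal.ofReal (gamma i w (incl p) ^ 2) ∂cylMeasure ≤
      ENNReal.ofReal (4 * π * τ) *
        ∫⁻ p in slab, ENNReal.ofReal (f (incl p) ^ 2) ∂cylMeasure := by
  rw [lintegral_slab (g := fun p => gamma i w p ^ 2) ((contDiff_gamma hw i).pow 2).continuous
    fun p => sq_nonneg _, lintegral_slab (g := fun p => f p ^ 2) (hf.pow 2).continuous
    fun p => sq_nonneg _, ← ENNReal.ofReal_mul (by positivity)]
  refine ENNReal.ofReal_le_ofReal ?_
  set S := ∫ t in Set.Icc 0 π, ∫ x, f (t, x) ^ 2 ∂(sphMeas 4)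
  have h1 : ∀ t ∈ Set.Icc 0 π, ∫ x, gamma i w (t, x) ^ 2 ∂(sphMeas 4) ≤ 4 * τ * S := by
    intro t ht
    have h2 := energy_le hw hf h hfin hτ hsupp ht
    have h3 := integral_gamma_sq_le_energy hw i t
    linarith
  refine (setIntegral_mono_on (continuous_integral_slice
    ((contDiff_gamma hw i).pow 2)).integrableOn_Icc (integrableOn_const (by simp))
    measurableSet_Icc h1).trans ?_
  rw [setIntegral_const, smul_eq_mul, Real.volume_real_Icc_of_le pi_pos.le]
  exact le_of_eq (by ring)

/-! ### Poincaré's inequality in time. -/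

theorem sq_integral_le {g : ℝ → ℝ} (hg : Continuous g) {a b : ℝ} (hab : a ≤ b) :
    (∫ t in a..b, g t) ^ 2 ≤ (b - a) * ∫ t in a..b, g t ^ 2 := by
  rcases hab.eq_or_lt with rfl | hlt
  · simp
  set I := ∫ t in a..b, g t with hI
  have h : 0 ≤ ∫ t in a..b, ((b - a) * g t - I) ^ 2 :=
    intervalIntegral.integral_nonneg hab fun t _ => sq_nonneg _
  have h2 : ∫ t in a..b, ((b - a) * g t - I) ^ 2 =
      (b - a) ^ 2 * (∫ t in a..b, g t ^ 2) - (b - a) * I ^ 2 := by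
    have e : ∀ t, ((b - a) * g t - I) ^ 2 =
        (b - a) ^ 2 * g t ^ 2 - 2 * (b - a) * I * g t + I ^ 2 := fun t => by ring
    have i1 : IntervalIntegrable (fun t => (b - a) ^ 2 * g t ^ 2) volume a b :=
      (continuous_const.mul (hg.pow 2)).intervalIntegrable _ _
    have i2 : IntervalIntegrable (fun t => 2 * (b - a) * I * g t) volume a b :=
      (continuous_const.mul hg).intervalIntegrable _ _
    simp only [e]
    rw [intervalIntegral.integral_add (i1.sub i2) (by simp), intervalIntegral.integral_sub i1 i2,
      intervalIntegral.integral_const_mul, intervalIntegral.integral_const_mul,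
      intervalIntegral.integral_const, ← hI, smul_eq_mul]
    ring
  rw [h2] at h
  have h3 : 0 < b - a := sub_pos.2 hlt
  nlinarith

/-- Poincaré's inequality in time, for a function whose support in time is short. -/
theorem integral_sq_le_of_support {g : ℝ → ℝ} (hg : ContDiff ℝ 1 g) (hπ : g π = 0) {a ℓ : ℝ}
    (hℓ : 0 ≤ ℓ) (h : ∀ t ∈ Set.Icc 0 π, g t ≠ 0 → t ∈ Set.Ico a (a + ℓ)) :
    ∫ t in Set.Icc 0 π, g t ^ 2 ≤ ℓ ^ 2 * ∫ t in Set.Icc 0 π, deriv g t ^ 2 := by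
  set J := ∫ t in Set.Icc 0 π, deriv g t ^ 2 with hJ
  have hdc : Continuous (deriv g) := hg.continuous_deriv le_rfl
  have hJ0 : 0 ≤ J := integral_nonneg fun t => sq_nonneg _
  have h1 : ∀ t ∈ Set.Icc 0 π, g t ^ 2 ≤ (Set.Icc a (a + ℓ)).indicator (fun _ => ℓ * J) t := by
    intro t ht
    by_cases h0 : g t = 0
    · rw [h0]
      simpa using Set.indicator_nonneg (fun _ _ => mul_nonneg hℓ hJ0) t
    have hta := h t ht h0
    rw [Set.indicator_of_mem (Set.Ico_subset_Icc_self hta)]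
    -- A zero of `g` to the right of `t` at distance at most `ℓ`: either `π`, or the right end of
    -- the window, which `Set.Ico` excludes from the support.
    obtain ⟨b, hb1, hb2, hb3, hb4⟩ : ∃ b, t ≤ b ∧ b ≤ π ∧ b ≤ a + ℓ ∧ g b = 0 := by
      rcases le_total π (a + ℓ) with hc | hc
      · exact ⟨π, ht.2, le_rfl, hc, hπ⟩
      · refine ⟨a + ℓ, hta.2.le, hc, le_rfl, ?_⟩
        by_contra h2
        exact absurd (h (a + ℓ) ⟨ht.1.trans hta.2.le, hc⟩ h2).2 (lt_irrefl _)
    have h2 : ∫ s in t..b, deriv g s = g b - g t :=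
      intervalIntegral.integral_deriv_eq_sub (fun s _ => hg.differentiable (by simp) s)
        (hdc.intervalIntegrable _ _)
    have h3 := sq_integral_le hdc hb1
    rw [h2, hb4, zero_sub, neg_sq] at h3
    refine h3.trans ?_
    have h4 : ∫ s in t..b, deriv g s ^ 2 ≤ J := by
      rw [intervalIntegral.integral_of_le hb1]
      exact setIntegral_mono_set (hdc.pow 2).integrableOn_Icc
        (Filter.Eventually.of_forall fun s => sq_nonneg _)
        (LE.le.eventuallyLE fun s hs => ⟨ht.1.trans hs.1.le, hs.2.trans hb2⟩)
    have h5 : 0 ≤ ∫ s in t..b, deriv g s ^ 2 :=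
      intervalIntegral.integral_nonneg hb1 fun s _ => sq_nonneg _
    have h6 : b - t ≤ ℓ := by linarith [hta.1]
    exact mul_le_mul h6 h4 h5 hℓ
  refine (setIntegral_mono_on (hg.continuous.pow 2).integrableOn_Icc
    ((integrable_const _).indicator measurableSet_Icc) measurableSet_Icc h1).trans ?_
  rw [setIntegral_indicator measurableSet_Icc, setIntegral_const, smul_eq_mul]
  have h4 : volume.real (Set.Icc 0 π ∩ Set.Icc a (a + ℓ)) ≤ ℓ := by
    refine (measureReal_mono Set.inter_subset_right measure_Icc_lt_top.ne).trans ?_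
    simp [hℓ]
  calc _ ≤ ℓ * (ℓ * J) := by gcongr
    _ = ℓ ^ 2 * J := by ring

theorem deriv_slice_time {w : Ambient → ℝ} (hw : ContDiff ℝ ∞ w) (t : ℝ)
    (x : EuclideanSpace ℝ (Fin 4)) : deriv (fun t => w (t, x)) t = gamma 0 w (t, x) := by
  have h2 := ((hw.differentiable (by simp) (t, x)).hasFDerivAt.comp t
    (hasFDerivAt_prodMk_left (𝕜 := ℝ) t x)).hasDerivAt.deriv
  simp only [Function.comp_def] at h2
  rw [h2]
  change _ = fderiv ℝ w (t, x) (gammaField 0 (t, x))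
  rw [gammaField_eq, if_pos rfl, gammaLin_zero]
  rfl

/-- The one-dimensional inequality on each fibre. The window may slide with `X`; only its length
enters, so no measurability of `a` is needed. -/
theorem lintegral_sq_le_of_support {w : Ambient → ℝ} (hw : ContDiff ℝ ∞ w)
    (hπ : ∀ X : S3, w (π, X) = 0) {ℓ : ℝ} (hℓ : 0 ≤ ℓ) (a : S3 → ℝ)
    (h : ∀ X : S3, ∀ t ∈ Set.Icc 0 π, w (t, X) ≠ 0 → t ∈ Set.Ico (a X) (a X + ℓ)) :
    ∫⁻ p in slab, ENNReal.ofReal (w (incl p) ^ 2) ∂cylMeasure ≤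
      ENNReal.ofReal (ℓ ^ 2) *
        ∫⁻ p in slab, ENNReal.ofReal (gamma 0 w (incl p) ^ 2) ∂cylMeasure := by
  have hc1 : Continuous fun p : Cyl => w (incl p) ^ 2 :=
    (hw.pow 2).continuous.comp continuous_incl
  have hc2 : Continuous fun p : Cyl => gamma 0 w (incl p) ^ 2 :=
    ((contDiff_gamma hw 0).pow 2).continuous.comp continuous_incl
  rw [restrict_slab, lintegral_prod_symm' _ hc1.measurable.ennreal_ofReal,
    lintegral_prod_symm' _ hc2.measurable.ennreal_ofReal,
    ← lintegral_const_mul' _ _ ENNReal.ofReal_ne_top]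
  refine lintegral_mono fun X => ?_
  have hs : ContDiff ℝ ∞ fun t => w (t, (X : EuclideanSpace ℝ (Fin 4))) :=
    hw.comp (contDiff_id.prodMk contDiff_const)
  have h1 := integral_sq_le_of_support (hs.of_le (by simp)) (hπ X) hℓ (h X)
  simp only [deriv_slice_time hw] at h1
  have h2 : Continuous fun t => gamma 0 w (t, (X : EuclideanSpace ℝ (Fin 4))) :=
    (contDiff_gamma hw 0).continuous.comp (Continuous.prodMk_left _)
  have i1 : IntegrableOn (fun t => w (t, (X : EuclideanSpace ℝ (Fin 4))) ^ 2) (Set.Icc 0 π) :=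
    (hs.continuous.pow 2).integrableOn_Icc
  have i2 : IntegrableOn (fun t => gamma 0 w (t, (X : EuclideanSpace ℝ (Fin 4))) ^ 2)
    (Set.Icc 0 π) := (h2.pow 2).integrableOn_Icc
  have e1 := ofReal_integral_eq_lintegral_ofReal (μ := volume.restrict (Set.Icc 0 π))
    i1 (Filter.Eventually.of_forall fun t => sq_nonneg _)
  have e2 := ofReal_integral_eq_lintegral_ofReal (μ := volume.restrict (Set.Icc 0 π))
    i2 (Filter.Eventually.of_forall fun t => sq_nonneg _)
  simp only [incl]
  rw [← e1, ← e2, ← ENNReal.ofReal_mul (sq_nonneg _)]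
  exact ENNReal.ofReal_le_ofReal h1

/-! ### The fields `Γᵢ` are tangent to `ℝ × S³` -/

theorem exists_integral_curve (i : Fin 7) (P : Cyl) : ∃ c : ℝ → Cyl, Continuous c ∧ c 0 = P ∧
    HasDerivAt (fun θ => incl (c θ)) (gammaField i (incl P)) 0 := by
  rw [gammaField_eq]
  refine Fin.cases ?_ (fun i => ?_) i
  · refine ⟨fun θ => (P.1 + θ, P.2), by fun_prop, by simp, ?_⟩
    rw [if_pos rfl, gammaLin_zero]
    exact ((hasDerivAt_id (0 : ℝ)).const_add P.1).prodMk (hasDerivAt_const 0 P.2.1)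
  · obtain ⟨j, k, hjk, h⟩ := gammaLin_succ_exists i
    refine ⟨fun θ => (P.1, ⟨rotIsom j k hjk θ P.2, by simp⟩), ?_, ?_, ?_⟩
    · refine continuous_const.prodMk (Continuous.subtype_mk ?_ _)
      simp only [rotIsom_apply]
      fun_prop
    · simp [rotIsom_zero]
    · rw [if_neg (Fin.succ_ne_zero i), h]
      exact (hasDerivAt_const 0 P.1).prodMk (hasDerivAt_rotIsom j k hjk P.2)

/-- `Γᵢ` differentiates along a curve that stays in `ℝ × S³`. This is needed because the support
condition on test functions says nothing about their values off the cylinder. -/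
theorem gamma_congr_of_eventuallyEq {φ ψ : Ambient → ℝ} (hφ : ContDiff ℝ ∞ φ)
    (hψ : ContDiff ℝ ∞ ψ) {P : Cyl} (h : ∀ᶠ Q in nhds P, φ (incl Q) = ψ (incl Q)) (i : Fin 7) :
    gamma i φ (incl P) = gamma i ψ (incl P) := by
  obtain ⟨c, hc, hc0, hd⟩ := exists_integral_curve i P
  have hg : ∀ {g : Ambient → ℝ}, ContDiff ℝ ∞ g →
      HasDerivAt (fun θ => g (incl (c θ))) (gamma i g (incl P)) 0 := by
    intro g hg
    have h1 : HasFDerivAt g (fderiv ℝ g (incl P)) (incl (c 0)) := by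
      rw [hc0]; exact (hg.differentiable (by simp) _).hasFDerivAt
    exact h1.comp_hasDerivAt 0 hd
  have h2 : (fun θ => φ (incl (c θ))) =ᶠ[nhds 0] fun θ => ψ (incl (c θ)) := by
    have : Filter.Tendsto c (nhds 0) (nhds P) := by rw [← hc0]; exact hc.tendsto 0
    exact this.eventually h
  rw [← (hg hφ).deriv, ← (hg hψ).deriv, h2.deriv_eq]

theorem gamma_const (a : ℝ) (i : Fin 7) (p : Ambient) : gamma i (fun _ => a) p = 0 := by
  simp [gamma]

theorem IsTestOn.eventually_zero {U : Set Cyl} {φ : Ambient → ℝ} (_hφ : IsTestOn U φ) {P : Cyl}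
    (hP : P ∉ tsupport fun p : Cyl => φ (incl p)) : ∀ᶠ Q in nhds P, φ (incl Q) = 0 :=
  (notMem_tsupport_iff_eventuallyEq.1 hP)

theorem IsTestOn.eq_zero {U : Set Cyl} {φ : Ambient → ℝ} (hφ : IsTestOn U φ) {P : Cyl}
    (hP : P ∉ U) : φ (incl P) = 0 :=
  (hφ.eventually_zero fun h => hP (hφ.subset h)).self_of_nhds

theorem tsupport_gamma_subset {φ : Ambient → ℝ} (hφ : ContDiff ℝ ∞ φ) (i : Fin 7) :
    (tsupport fun p : Cyl => gamma i φ (incl p)) ⊆ tsupport fun p : Cyl => φ (incl p) := by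
  intro P hP
  by_contra h
  refine (notMem_tsupport_iff_eventuallyEq.2 ?_) hP
  filter_upwards [eventually_eventually_nhds.2 (notMem_tsupport_iff_eventuallyEq.1 h)] with Q hQ
  rw [gamma_congr_of_eventuallyEq hφ contDiff_const (ψ := fun _ => 0) hQ i, gamma_const]
  rfl

theorem IsTestOn.gamma {U : Set Cyl} {φ : Ambient → ℝ} (hφ : IsTestOn U φ) (i : Fin 7) :
    IsTestOn U (gamma i φ) where
  contDiff := contDiff_gamma hφ.contDiff i
  compact := hφ.compact.of_isClosed_subset (isClosed_tsupport _)
    (tsupport_gamma_subset hφ.contDiff i)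
  subset := (tsupport_gamma_subset hφ.contDiff i).trans hφ.subset

theorem IsTestOn.mono {U V : Set Cyl} {φ : Ambient → ℝ} (hφ : IsTestOn U φ) (h : U ⊆ V) :
    IsTestOn V φ := ⟨hφ.contDiff, hφ.compact, hφ.subset.trans h⟩

theorem IsTestOn.mul_left {U : Set Cyl} {φ χ : Ambient → ℝ} (hφ : IsTestOn U φ)
    (hχ : ContDiff ℝ ∞ χ) : IsTestOn U (fun p => χ p * φ p) where
  contDiff := hχ.mul hφ.contDiff
  compact := hφ.compact.mul_left (f := fun p : Cyl => χ (incl p))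
  subset := (tsupport_mul_subset_right (f := fun p : Cyl => χ (incl p))).trans hφ.subset

theorem IsTestOn.continuous {U : Set Cyl} {φ : Ambient → ℝ} (hφ : IsTestOn U φ) :
    Continuous fun p : Cyl => φ (incl p) := hφ.contDiff.continuous.comp continuous_incl

/-! ### The tube around the end of the cylinder and the geometry of light cones -/

theorem polarR_nonneg (X : S3) : 0 ≤ polarR X := arccos_nonneg _

theorem continuous_polarR : Continuous polarR := by
  unfold polarR
  fun_prop

/-- `π - T - R`. -/
def nullDist (p : Cyl) : ℝ := π - p.1 - polarR p.2

theorem continuous_nullDist : Continuous nullDist :=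
  (continuous_const.sub continuous_fst).sub (continuous_polarR.comp continuous_snd)

/-- The part of `{T > 0, R + T < π}` where `R ≤ c (π - T - R)²`. -/
def tube (c : ℝ) : Set Cyl := {p | 0 < p.1 ∧ 0 < nullDist p ∧ polarR p.2 ≤ c * nullDist p ^ 2}

/-- With `z = 1/y` this is `z/(1 + z) ≤ arctan z`, which follows by comparing derivatives. -/
theorem inv_le_arctan_gap {y : ℝ} (hy : 0 < y) : 1 / (1 + y) ≤ π / 2 - arctan y := by
  rw [← arctan_inv_of_pos hy]
  have hz : 0 < y⁻¹ := inv_pos.2 hy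
  have e : 1 / (1 + y) = y⁻¹ / (1 + y⁻¹) := by field_simp; ring
  rw [e]
  have hd : ∀ z, 0 ≤ z → HasDerivAt (fun z => arctan z - z / (1 + z))
      (1 / (1 + z ^ 2) - 1 / (1 + z) ^ 2) z := by
    intro z hz
    have h1 : HasDerivAt (fun z : ℝ => z / (1 + z)) ((1 * (1 + z) - z * 1) / (1 + z) ^ 2) z :=
      (hasDerivAt_id z).fun_div ((hasDerivAt_id z).const_add 1) (by simp; positivity)
    refine ((hasDerivAt_arctan z).fun_sub h1).congr_deriv ?_
    ring
  have hmono : MonotoneOn (fun z => arctan z - z / (1 + z)) (Set.Ici 0) := by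
    refine monotoneOn_of_deriv_nonneg (convex_Ici 0)
      (fun z hz => (hd z hz).continuousAt.continuousWithinAt)
      (fun z hz => (hd z (interior_subset hz)).differentiableAt.differentiableWithinAt) ?_
    intro z hz
    have hz0 : 0 ≤ z := interior_subset hz
    rw [(hd z hz0).deriv, sub_nonneg]
    exact one_div_le_one_div_of_le (by positivity) (by nlinarith)
  have h := hmono Set.self_mem_Ici hz.le hz.le
  simp only [arctan_zero, zero_div, sub_zero] at h
  linarith

theorem arctan_sub_le {t r B : ℝ} (ht : 0 < t) (hr : 0 ≤ r) (hrB : r < B) :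
    arctan (t + r) - arctan (t - r) ≤ 4 * B * (1 + B) ^ 2 / (1 + t) ^ 2 := by
  have hB : 0 < B := hr.trans_lt hrB
  have h : ∀ y ∈ Set.Icc (t - r) (t + r), deriv arctan y ≤ 2 * (1 + B) ^ 2 / (1 + t) ^ 2 := by
    intro y hy
    simp only [Real.deriv_arctan]
    rw [div_le_div_iff₀ (by positivity) (by positivity)]
    have h1 : 1 + t ≤ (1 + B) + y := by linarith [hy.1]
    nlinarith [sq_nonneg ((1 + B) - y), sq_nonneg (y * B), mul_nonneg hB.le (sq_nonneg y),
      pow_le_pow_left₀ (by linarith) h1 2]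
  have hmv := (convex_Icc (t - r) (t + r)).image_sub_le_mul_sub_of_deriv_le
    continuous_arctan.continuousOn differentiable_arctan.differentiableOn
    (fun y hy => h y (interior_subset hy)) (t - r) ⟨le_rfl, by linarith⟩ (t + r)
    ⟨by linarith, le_rfl⟩ (by linarith)
  refine hmv.trans ?_
  have e : t + r - (t - r) = 2 * r := by ring
  rw [e, div_mul_eq_mul_div]
  gcongr ?_ / _
  nlinarith [mul_le_mul_of_nonneg_left hrB.le (sq_nonneg (1 + B))]

/-- For `|x| < B`, the mean value theorem gives `R = O((1 + t)⁻²)`, while `π - T - R = 2 (π/2 -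
arctan(t + r))` is at least a multiple of `(1 + t)⁻¹`. Squaring the latter bounds `R` by `(π - T -
R)²`. -/
theorem nearObstacle_subset_tube (K : Set (EuclideanSpace ℝ (Fin 3))) {B : ℝ} (hB : 0 < B) :
    ∃ c, 0 ≤ c ∧ nearObstacle K B ⊆ tube c := by
  refine ⟨B * (1 + B) ^ 4, by positivity, ?_⟩
  rintro _ ⟨⟨t, x⟩, ⟨ht, -, hx⟩, rfl⟩
  simp only at ht hx
  set r := ‖x‖ with hr
  have hr0 : 0 ≤ r := norm_nonneg x
  have hR : polarR (penrose (t, x)).2 = arctan (t + r) - arctan (t - r) := by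
    change arccos (penroseX (t, x) 0) = _
    simp only [penroseX, penroseR]
    simp only [Matrix.cons_val]
    refine arccos_cos ?_ ?_
    · rw [sub_nonneg]; exact arctan_strictMono.monotone (by linarith)
    · have := arctan_lt_pi_div_two (t + r)
      have := neg_pi_div_two_lt_arctan (t - r)
      linarith
  have hT : (penrose (t, x)).1 = arctan (t + r) + arctan (t - r) := rfl
  have hn : nullDist (penrose (t, x)) = 2 * (π / 2 - arctan (t + r)) := by
    rw [nullDist, hR, hT]; ring
  have hlow := inv_le_arctan_gap (y := t + r) (by linarith)
  refine ⟨?_, ?_, ?_⟩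
  · rw [hT]
    have : arctan (-(t + r)) < arctan (t - r) := arctan_strictMono (by linarith)
    rw [arctan_neg] at this
    linarith
  · rw [hn]
    linarith [arctan_lt_pi_div_two (t + r)]
  · rw [hR, hn]
    refine (arctan_sub_le ht hr0 hx).trans ?_
    have h1 : 1 / ((1 + B) * (1 + t)) ≤ π / 2 - arctan (t + r) := by
      refine le_trans ?_ hlow
      refine one_div_le_one_div_of_le (by positivity) ?_
      nlinarith [mul_pos hB ht]
    have h2 := pow_le_pow_left₀ (by positivity) h1 2
    calc 4 * B * (1 + B) ^ 2 / (1 + t) ^ 2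
        = B * (1 + B) ^ 4 * 4 * (1 / ((1 + B) * (1 + t))) ^ 2 := by field_simp
      _ ≤ B * (1 + B) ^ 4 * 4 * (π / 2 - arctan (t + r)) ^ 2 := by gcongr
      _ = _ := by ring

/-- Along a light cone with a point in the tube, `1 / (π - T - R)` at the vertex is comparable to
`1 / (π - T)` at that point. -/
theorem nullDist_cone {c : ℝ} {P Q : Cyl} {s : ℝ} (hQ : Q ∈ tube c)
    (hT : Q.1 = P.1 + s) (h1 : polarR P.2 ≤ s + polarR Q.2) (h3 : s ≤ polarR P.2 + polarR Q.2) :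
    nullDist Q ≤ nullDist P ∧ nullDist P ≤ nullDist Q + 2 * polarR Q.2 ∧
      1 / nullDist P ≤ 1 / (π - Q.1) + c ∧ 1 / (π - Q.1) ≤ 1 / nullDist P + 2 * c := by
  obtain ⟨hQ0, hQ1, hQ2⟩ := hQ
  have hR0 := polarR_nonneg Q.2
  have e1 : nullDist Q ≤ nullDist P := by unfold nullDist; linarith
  have e2 : nullDist P ≤ nullDist Q + 2 * polarR Q.2 := by unfold nullDist; linarith
  have e3 : π - Q.1 = nullDist Q + polarR Q.2 := by unfold nullDist; ring
  have hb : 0 < nullDist P := hQ1.trans_le e1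
  refine ⟨e1, e2, ?_, ?_⟩
  · rw [e3]
    have i1 : 1 / nullDist P ≤ 1 / nullDist Q := one_div_le_one_div_of_le hQ1 e1
    have i2 : 1 / nullDist Q ≤ 1 / (nullDist Q + polarR Q.2) + c := by
      rw [div_add' _ _ _ (by positivity), div_le_div_iff₀ hQ1 (by positivity)]
      have hc : 0 ≤ c := by
        by_contra hc
        nlinarith [pow_pos hQ1 2]
      nlinarith [mul_nonneg hc (mul_nonneg hR0 hQ1.le)]
    linarith
  · rw [e3]
    have i1 : 1 / (nullDist Q + polarR Q.2) ≤ 1 / nullDist Q :=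
      one_div_le_one_div_of_le hQ1 (by linarith)
    have hc : 0 ≤ c := by
      by_contra hc
      nlinarith [pow_pos hQ1 2]
    -- The reciprocals differ by at most `2 * polarR Q.2 / nullDist Q ^ 2`, and the quadratic bound
    -- in `tube` makes this at most `2 * c`.
    have i2 : 1 / nullDist Q ≤ 1 / nullDist P + 2 * c := by
      rw [div_add' _ _ _ hb.ne', div_le_div_iff₀ hQ1 hb]
      nlinarith [mul_nonneg hc (mul_nonneg (sub_nonneg.2 e1) hQ1.le)]
    linarith

/-- Smooth cutoffs in time, to `π - T ≈ 1 / n`. -/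
theorem exists_timeCutoff {c : ℝ} (n : ℕ) : ∃ χ : ℝ → ℝ, ContDiff ℝ ∞ χ ∧
    (∀ T, 0 ≤ χ T ∧ χ T ≤ 1) ∧ (∀ T, (π - T) * (n + 2 + 2 * c) ≤ 1 → χ T = 0) ∧
    (∀ T, 1 ≤ (π - T) * (n - 1 - 2 * c) → χ T = 0) ∧
    ∀ T, 0 < π - T → 1 ≤ (π - T) * (n + 1 + 2 * c) → (π - T) * (n - 2 * c) ≤ 1 →
      ∀ᶠ s in nhds T, χ s = 1 := by
  set s : Set ℝ := {T | (π - T) * (n + 2 + 2 * c) ≤ 1} ∪ {T | 1 ≤ (π - T) * (n - 1 - 2 * c)}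
  set t : Set ℝ := {T | 0 ≤ π - T} ∩ {T | 1 ≤ (π - T) * (n + 1 + 2 * c)} ∩
    {T | (π - T) * (n - 2 * c) ≤ 1}
  have hs : IsClosed s := (isClosed_le (by fun_prop) (by fun_prop)).union
    (isClosed_le (by fun_prop) (by fun_prop))
  have ht : IsClosed t := ((isClosed_le (by fun_prop) (by fun_prop)).inter
    (isClosed_le (by fun_prop) (by fun_prop))).inter (isClosed_le (by fun_prop) (by fun_prop))
  have hd : Disjoint s t := by
    rw [Set.disjoint_left]
    rintro T h ⟨⟨h1, h2⟩, h3⟩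
    simp only [Set.mem_ofPred_eq] at h1 h2 h3
    have h0 : 0 < π - T := by
      refine h1.lt_of_ne fun h0 => ?_
      rw [← h0, zero_mul] at h2
      linarith
    rcases h with h | h
    · simp only [Set.mem_ofPred_eq] at h
      nlinarith
    · simp only [Set.mem_ofPred_eq] at h
      nlinarith
  obtain ⟨f, hf0, hf1, hf⟩ :=
    exists_contMDiffMap_zero_one_nhds_of_isClosed (n := ⊤) (modelWithCornersSelf ℝ ℝ) hs ht hd
  refine ⟨f, f.contMDiff.contDiff, fun T => ⟨(hf T).1, (hf T).2⟩, fun T hT => ?_, fun T hT => ?_,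
    fun T h0 h1 h2 => ?_⟩
  · exact hf0.self_of_nhdsSet T (Or.inl hT)
  · exact hf0.self_of_nhdsSet T (Or.inr hT)
  · exact hf1.filter_mono (nhds_le_nhdsSet (s := t) ⟨⟨h0.le, h1⟩, h2⟩)

/-! ### The potential of a source in the tube -/

section Source

variable {c : ℝ} {φ : Ambient → ℝ}

theorem IsTestOn.apply_eq_zero (hφ : IsTestOn (tube c) φ) {T : ℝ}
    {x : EuclideanSpace ℝ (Fin 4)} (hx : ‖x‖ = 1) (hT : T ≤ 0 ∨ π ≤ T) : φ (T, x) = 0 := by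
  refine hφ.eq_zero (P := (T, ⟨x, by simpa using hx⟩)) ?_
  rintro ⟨h1, h2, -⟩
  have h3 := polarR_nonneg ⟨x, by simpa using hx⟩
  simp only [nullDist] at h1 h2
  rcases hT with h | h <;> linarith

theorem potential_eq_zero_of_pi_le (hφ : IsTestOn (tube c) φ) {T : ℝ} (hT : π ≤ T)
    {x : EuclideanSpace ℝ (Fin 4)} (hx : ‖x‖ = 1) : potential φ (T, x) = 0 := by
  refine potential_eq_zero fun k hk => ?_
  have hg : ‖geo x k‖ = 1 := norm_geo hx (by simpa using hk.2)
  exact hφ.apply_eq_zero hg (Or.inr (le_add_of_le_of_nonneg hT hk.1.1))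

/-- The antipodal term in `box_potential` sits at time `T + π ≥ π`, beyond the support of `φ`. -/
theorem box_potential_of_test (hφ : IsTestOn (tube c) φ) {T : ℝ} (hT : 0 ≤ T)
    {x : EuclideanSpace ℝ (Fin 4)} (hx : ‖x‖ = 1) :
    box (potential φ) (T, x) + potential φ (T, x) = φ (T, x) := by
  rw [box_potential hφ.contDiff (p := (T, x)) hx]
  simp only
  rw [hφ.apply_eq_zero (T := T + π) (by simpa using hx) (Or.inr (by linarith)), add_zero]

theorem energy_potential_pi (hφ : IsTestOn (tube c) φ) : energy (potential φ) π = 0 := by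
  refine integral_eq_zero_of_ae ?_
  filter_upwards [ae_norm_eq_one] with x hx
  simp only [energyDensity, gamma_potential hφ.contDiff,
    potential_eq_zero_of_pi_le (hφ.gamma _) le_rfl hx, potential_eq_zero_of_pi_le hφ le_rfl hx]
  simp

theorem lintegral_gamma_potential_sq_le (hφ : IsTestOn (tube c) φ) {a τ : ℝ} (hτ : 0 < τ)
    (hsupp : ∀ Q ∈ tube c, φ (incl Q) ≠ 0 → Q.1 ∈ Set.Icc a (a + τ)) (i : Fin 7) :
    ∫⁻ p in slab, ENNReal.ofReal (gamma i (potential φ) (incl p) ^ 2) ∂cylMeasure ≤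
      ENNReal.ofReal (4 * π * τ) *
        ∫⁻ p in slab, ENNReal.ofReal (φ (incl p) ^ 2) ∂cylMeasure := by
  refine lintegral_gamma_sq_le (contDiff_potential hφ.contDiff) hφ.contDiff
    (fun T hT x hx => box_potential_of_test hφ hT.1 hx) (energy_potential_pi hφ) (a := a) hτ
    (fun T _ hTa x hx => ?_) i
  by_contra h
  have h' : φ (incl (T, ⟨x, by simpa using hx⟩)) ≠ 0 := h
  exact hTa (hsupp _ (by by_contra h2; exact h' (hφ.eq_zero h2)) h')

/-- If the forward light cone of `(t, X)` meets the support of `φ`, then `t + R(X)` is within `ρ` of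
the time interval of the source. So, for fixed `X`, the potential lives in a short window of time,
and Poincaré's inequality improves the energy bound. -/
theorem lintegral_potential_sq_le (hφ : IsTestOn (tube c) φ) {a τ ρ : ℝ} (hτ : 0 < τ)
    (hρ : 0 ≤ ρ) (hsupp : ∀ Q ∈ tube c, φ (incl Q) ≠ 0 → Q.1 ∈ Set.Icc a (a + τ))
    (hrad : ∀ Q ∈ tube c, φ (incl Q) ≠ 0 → polarR Q.2 ≤ ρ) :
    ∫⁻ p in slab, ENNReal.ofReal (potential φ (incl p) ^ 2) ∂cylMeasure ≤
      ENNReal.ofReal ((2 * τ + 2 * ρ) ^ 2 * (4 * π * τ)) *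
        ∫⁻ p in slab, ENNReal.ofReal (φ (incl p) ^ 2) ∂cylMeasure := by
  -- The window has width `τ + 2ρ`; the spare `τ` makes its right end strict.
  refine (lintegral_sq_le_of_support (contDiff_potential hφ.contDiff)
    (fun X => potential_eq_zero_of_pi_le hφ le_rfl (by simp)) (ℓ := 2 * τ + 2 * ρ) (by positivity)
    (fun X => a - polarR X - ρ) ?_).trans ?_
  · intro X t ht h
    obtain ⟨k, hk, hk0⟩ : ∃ k ∈ kerSet, φ (cone (incl (t, X)) k) ≠ 0 := by
      by_contra h2
      push Not at h2
      exact h (potential_eq_zero h2)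
    obtain ⟨Q, hQ, hQ1, hQ2, -, hQ4⟩ := exists_cone_eq_incl (t, X) hk
    rw [hQ] at hk0
    have hQt : Q ∈ tube c := by by_contra h2; exact hk0 (hφ.eq_zero h2)
    have i1 := hsupp Q hQt hk0
    have i2 := hrad Q hQt hk0
    simp only at hQ1 hQ2 hQ4
    rw [hQ1] at i1
    constructor <;> linarith [i1.1, i1.2]
  · rw [ENNReal.ofReal_mul (sq_nonneg _), mul_assoc]
    gcongr
    exact lintegral_gamma_potential_sq_le hφ hτ hsupp 0

end Source

/-! ### Decomposition into shells -/

/-- The part of the diamond where `n ≤ 1 / (π - T - R) < n + 1`. -/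
def shell (n : ℕ) : Set Cyl :=
  diamondPlus ∩ {p | n ≤ 1 / nullDist p ∧ 1 / nullDist p < n + 1}

theorem nullDist_pos_of_mem {P : Cyl} (hP : P ∈ diamondPlus) : 0 < nullDist P := by
  obtain ⟨h1, h2⟩ := hP
  simp only [diamond, Set.mem_ofPred_eq] at h1 h2
  rw [abs_of_nonneg h2] at h1
  unfold nullDist
  linarith

theorem measurableSet_diamondPlus : MeasurableSet diamondPlus := by
  refine MeasurableSet.inter ?_ (measurableSet_le measurable_const measurable_fst)
  exact measurableSet_lt ((continuous_polarR.comp continuous_snd).add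
    continuous_fst.abs).measurable measurable_const

theorem measurableSet_shell (n : ℕ) : MeasurableSet (shell n) := by
  have h : Measurable fun p => 1 / nullDist p := continuous_nullDist.measurable.const_div 1
  exact measurableSet_diamondPlus.inter
    ((measurableSet_le measurable_const h).inter (measurableSet_lt h measurable_const))

theorem shell_subset_slab (n : ℕ) : shell n ⊆ slab := by
  rintro P ⟨hP, -⟩
  have h1 := nullDist_pos_of_mem hP
  have h2 := polarR_nonneg P.2
  unfold nullDist at h1
  exact ⟨hP.2, by linarith⟩

theorem diamondPlus_subset_iUnion_shell : diamondPlus ⊆ ⋃ n, shell n := by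
  intro P hP
  have h1 : 0 ≤ 1 / nullDist P := (one_div_pos.2 (nullDist_pos_of_mem hP)).le
  exact Set.mem_iUnion.2 ⟨⌊1 / nullDist P⌋₊, hP, Nat.floor_le h1, Nat.lt_floor_add_one _⟩

/-- A family of time cutoffs adapted to the shells. -/
structure IsCutoffFamily (c : ℝ) (χ : ℕ → ℝ → ℝ) : Prop where
  c_nonneg : 0 ≤ c
  contDiff : ∀ n, ContDiff ℝ ∞ (χ n)
  nonneg : ∀ n T, 0 ≤ χ n T
  le_one : ∀ n T, χ n T ≤ 1
  zero_left : ∀ (n : ℕ) T, (π - T) * (n + 2 + 2 * c) ≤ 1 → χ n T = 0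
  zero_right : ∀ (n : ℕ) T, 1 ≤ (π - T) * (n - 1 - 2 * c) → χ n T = 0
  one : ∀ (n : ℕ) T, 0 < π - T → 1 ≤ (π - T) * (n + 1 + 2 * c) → (π - T) * (n - 2 * c) ≤ 1 →
      ∀ᶠ s in nhds T, χ n s = 1

theorem exists_cutoffFamily {c : ℝ} (hc : 0 ≤ c) : ∃ χ, IsCutoffFamily c χ := by
  choose χ h1 h2 h3 h4 h5 using fun n => exists_timeCutoff (c := c) n
  exact ⟨χ, hc, h1, fun n T => (h2 n T).1, fun n T => (h2 n T).2, h3, h4, h5⟩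

section Cutoff

variable {c : ℝ} {χ : ℕ → ℝ → ℝ}

theorem IsCutoffFamily.mul_test (hχ : IsCutoffFamily c χ) {φ : Ambient → ℝ}
    (hφ : IsTestOn (tube c) φ) (n : ℕ) : IsTestOn (tube c) fun p => χ n p.1 * φ p :=
  hφ.mul_left (χ := fun p => χ n p.1) ((hχ.contDiff n).comp contDiff_fst)

/-- Localization by Huygens' principle: by `nullDist_cone`, a point of the tube on the light cone of
a point of `shell n` has `1/(π - T)` between `n - 2c` and `n + 1 + 2c`. The cutoff equals one in a
whole neighbourhood, so it is invisible to `Γᵢ` as well. -/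
theorem IsCutoffFamily.eventually_one (hχ : IsCutoffFamily c χ) {n : ℕ} {P Q : Cyl}
    (hP : P ∈ shell n) {s : ℝ} (hQ : Q ∈ tube c) (hT : Q.1 = P.1 + s)
    (h1 : polarR P.2 ≤ s + polarR Q.2) (h3 : s ≤ polarR P.2 + polarR Q.2) :
    ∀ᶠ R in nhds Q, χ n R.1 = 1 := by
  obtain ⟨-, -, h4, h5⟩ := nullDist_cone hQ hT h1 h3
  have hR := polarR_nonneg Q.2
  have hπ : 0 < π - Q.1 := by
    have := hQ.2.1
    unfold nullDist at this
    linarith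
  have hc : 0 ≤ c := by
    by_contra hc
    nlinarith [pow_pos hQ.2.1 2, hQ.2.2]
  obtain ⟨-, hn1, hn2⟩ := hP
  refine continuous_fst.continuousAt.eventually (hχ.one n Q.1 hπ ?_ ?_)
  · have i1 : 1 / (π - Q.1) ≤ n + 1 + 2 * c := by linarith
    rwa [div_le_iff₀ hπ, mul_comm] at i1
  · have i1 : n - 2 * c ≤ 1 / (π - Q.1) := by linarith
    rwa [le_div_iff₀ hπ, mul_comm] at i1

theorem IsCutoffFamily.potential_eq (hχ : IsCutoffFamily c χ) {φ : Ambient → ℝ}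
    (hφ : IsTestOn (tube c) φ) {n : ℕ} {P : Cyl} (hP : P ∈ shell n) :
    potential φ (incl P) = potential (fun p => χ n p.1 * φ p) (incl P) := by
  refine potential_congr fun k hk => ?_
  obtain ⟨Q, hQ, hQ1, hQ2, -, hQ4⟩ := exists_cone_eq_incl P hk
  rw [hQ]
  by_cases hQt : Q ∈ tube c
  · have := (hχ.eventually_one hP hQt hQ1 hQ2 hQ4).self_of_nhds
    simp [incl, this]
  · rw [hφ.eq_zero hQt, mul_zero]

theorem IsCutoffFamily.gamma_potential_eq (hχ : IsCutoffFamily c χ) {φ : Ambient → ℝ}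
    (hφ : IsTestOn (tube c) φ) {n : ℕ} {P : Cyl} (hP : P ∈ shell n) (i : Fin 7) :
    gamma i (potential φ) (incl P) = gamma i (potential fun p => χ n p.1 * φ p) (incl P) := by
  have hφn := hχ.mul_test hφ n
  rw [gamma_potential hφ.contDiff, gamma_potential hφn.contDiff]
  refine potential_congr fun k hk => ?_
  obtain ⟨Q, hQ, hQ1, hQ2, -, hQ4⟩ := exists_cone_eq_incl P hk
  rw [hQ]
  refine gamma_congr_of_eventuallyEq hφ.contDiff hφn.contDiff ?_ i
  by_cases hQt : Q ∈ tsupport fun p : Cyl => φ (incl p)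
  · filter_upwards [hχ.eventually_one hP (hφ.subset hQt) hQ1 hQ2 hQ4] with R hR
    simp [incl, hR]
  · filter_upwards [hφ.eventually_zero hQt] with R hR
    rw [hR, mul_zero]

/-- Bounded overlap: `χ n T ≠ 0` forces `|n - 1/(π - T)| < 2 + 2c`, which leaves a fixed number of
indices `n`. -/
theorem IsCutoffFamily.tsum_sq_le (hχ : IsCutoffFamily c χ) (T : ℝ) :
    ∑' n, ENNReal.ofReal (χ n T ^ 2) ≤ (⌈2 * (2 + 2 * c)⌉₊ + 2 : ℕ) := by
  set D := 2 + 2 * c with hD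
  set m := ⌊1 / (π - T) - D⌋₊ with hm
  set s := Finset.Icc m (m + ⌈2 * D⌉₊ + 1) with hs
  have h0 : ∀ n ∉ s, ENNReal.ofReal (χ n T ^ 2) = 0 := by
    intro n hn
    by_contra hne
    have hχ0 : χ n T ≠ 0 := fun h => hne (by simp [h])
    have i1 : 1 < (π - T) * (n + 2 + 2 * c) := by
      by_contra h; exact hχ0 (hχ.zero_left n T (not_lt.1 h))
    have i2 : (π - T) * (n - 1 - 2 * c) < 1 := by
      by_contra h; exact hχ0 (hχ.zero_right n T (not_lt.1 h))
    have hc := hχ.c_nonneg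
    have hπ : 0 < π - T := by
      by_contra h
      nlinarith [mul_nonneg (neg_nonneg.2 (not_lt.1 h)) (by positivity : (0 : ℝ) ≤ n + 2 + 2 * c)]
    rw [mul_comm, ← div_lt_iff₀ hπ] at i1
    rw [mul_comm, ← lt_div_iff₀ hπ] at i2
    refine hn (Finset.mem_Icc.2 ⟨Nat.floor_le_of_le (by linarith), ?_⟩)
    have i3 := Nat.lt_floor_add_one (1 / (π - T) - D)
    have i4 := Nat.le_ceil (2 * D)
    have i5 : (n : ℝ) < (m + ⌈2 * D⌉₊ + 1 : ℕ) := by push_cast; linarith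
    exact_mod_cast i5.le
  rw [tsum_eq_sum h0]
  calc ∑ n ∈ s, ENNReal.ofReal (χ n T ^ 2) ≤ ∑ n ∈ s, 1 := by
        refine Finset.sum_le_sum fun n _ => ?_
        rw [ENNReal.ofReal_le_one]
        exact pow_le_one₀ (hχ.nonneg n T) (hχ.le_one n T)
    _ = _ := by
        rw [Finset.sum_const, hs, Nat.card_Icc, nsmul_eq_mul, mul_one]
        congr 1
        omega

theorem IsCutoffFamily.lintegral_le (hχ : IsCutoffFamily c χ) {g v : Cyl → ℝ≥0∞}
    (hv : Measurable v)
    (h : ∀ n, ∫⁻ p in shell n, g p ∂cylMeasure ≤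
      ∫⁻ p in slab, ENNReal.ofReal (χ n p.1 ^ 2) * v p ∂cylMeasure) :
    ∫⁻ p in diamondPlus, g p ∂cylMeasure ≤
      (⌈2 * (2 + 2 * c)⌉₊ + 2 : ℕ) * ∫⁻ p in slab, v p ∂cylMeasure := by
  have hm : ∀ n, Measurable fun p : Cyl => ENNReal.ofReal (χ n p.1 ^ 2) := fun n =>
    (((hχ.contDiff n).continuous.comp continuous_fst).pow 2).measurable.ennreal_ofReal
  calc ∫⁻ p in diamondPlus, g p ∂cylMeasure ≤ ∫⁻ p in ⋃ n, shell n, g p ∂cylMeasure :=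
        lintegral_mono_set diamondPlus_subset_iUnion_shell
    _ ≤ ∑' n, ∫⁻ p in shell n, g p ∂cylMeasure := lintegral_iUnion_le _ _
    _ ≤ ∑' n, ∫⁻ p in slab, ENNReal.ofReal (χ n p.1 ^ 2) * v p ∂cylMeasure :=
        ENNReal.tsum_le_tsum h
    _ = ∫⁻ p in slab, ∑' n, ENNReal.ofReal (χ n p.1 ^ 2) * v p ∂cylMeasure :=
        (lintegral_tsum fun n => ((hm n).mul hv).aemeasurable).symm
    _ ≤ ∫⁻ p in slab, (⌈2 * (2 + 2 * c)⌉₊ + 2 : ℕ) * v p ∂cylMeasure := by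
        refine lintegral_mono fun p => ?_
        simp only
        rw [ENNReal.tsum_mul_right]
        exact mul_le_mul_left (hχ.tsum_sq_le p.1) _
    _ = _ := lintegral_const_mul _ hv

/-- A weighted bound on the diamond from bounds on the pieces of the source. -/
theorem IsCutoffFamily.lintegral_weight_le (hχ : IsCutoffFamily c χ) {φ : Ambient → ℝ}
    (hφ : IsTestOn (tube c) φ) {z : Ambient → ℝ} {zn : ℕ → Ambient → ℝ}
    (hz : ∀ n, ∀ P ∈ shell n, z (incl P) = zn n (incl P)) {A B : ℕ → ℝ} (hA : ∀ n, 0 ≤ A n)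
    (hzn : ∀ n, ∫⁻ p in slab, ENNReal.ofReal (zn n (incl p) ^ 2) ∂cylMeasure ≤
      ENNReal.ofReal (A n) *
        ∫⁻ p in slab, ENNReal.ofReal ((χ n p.1 * φ (incl p)) ^ 2) ∂cylMeasure)
    {β : Cyl → ℝ} (hβ : ∀ n, ∀ P ∈ shell n, β P ≤ B n) (hB : ∀ n, 0 ≤ B n)
    {η : ℝ → ℝ} (hηm : Measurable η)
    (hη : ∀ n, ∀ T ∈ Set.Ioo 0 π, χ n T ≠ 0 → A n * B n ≤ η (π - T)) :
    ∫⁻ p in diamondPlus, ENNReal.ofReal (β p * z (incl p) ^ 2) ∂cylMeasure ≤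
      (⌈2 * (2 + 2 * c)⌉₊ + 2 : ℕ) *
        ∫⁻ p in slab, ENNReal.ofReal (η (π - p.1) * φ (incl p) ^ 2) ∂cylMeasure := by
  have hmη : Measurable fun p : Cyl => η (π - p.1) * φ (incl p) ^ 2 :=
    (hηm.comp (measurable_const.sub measurable_fst)).mul (hφ.continuous.pow 2).measurable
  refine hχ.lintegral_le hmη.ennreal_ofReal fun n => ?_
  calc ∫⁻ p in shell n, ENNReal.ofReal (β p * z (incl p) ^ 2) ∂cylMeasure
      ≤ ∫⁻ p in shell n, ENNReal.ofReal (B n) * ENNReal.ofReal (zn n (incl p) ^ 2) ∂cylMeasure := by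
        refine setLIntegral_mono' (measurableSet_shell n) fun P hP => ?_
        rw [hz n P hP, ← ENNReal.ofReal_mul (hB n)]
        exact ENNReal.ofReal_le_ofReal (mul_le_mul_of_nonneg_right (hβ n P hP) (sq_nonneg _))
    _ ≤ ∫⁻ p in slab, ENNReal.ofReal (B n) * ENNReal.ofReal (zn n (incl p) ^ 2) ∂cylMeasure :=
        lintegral_mono_set (shell_subset_slab n)
    _ ≤ ENNReal.ofReal (B n) * (ENNReal.ofReal (A n) *
        ∫⁻ p in slab, ENNReal.ofReal ((χ n p.1 * φ (incl p)) ^ 2) ∂cylMeasure) := by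
        rw [lintegral_const_mul' _ _ ENNReal.ofReal_ne_top]
        exact mul_le_mul_right (hzn n) _
    _ ≤ _ := by
        rw [← lintegral_const_mul' _ _ ENNReal.ofReal_ne_top,
          ← lintegral_const_mul' _ _ ENNReal.ofReal_ne_top]
        refine lintegral_mono fun P => ?_
        simp only
        rw [← ENNReal.ofReal_mul (hA n), ← ENNReal.ofReal_mul (hB n),
          ← ENNReal.ofReal_mul (sq_nonneg _)]
        refine ENNReal.ofReal_le_ofReal ?_
        by_cases h0 : χ n P.1 = 0 ∨ φ (incl P) = 0
        · rcases h0 with h0 | h0 <;> simp [h0]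
        · push Not at h0
          have hT : P.1 ∈ Set.Ioo 0 π := by
            by_contra hT
            refine h0.2 (hφ.apply_eq_zero (T := P.1) (x := P.2) (by simp) ?_)
            by_contra h2
            push Not at h2
            exact hT h2
          have h1 := mul_le_mul_of_nonneg_right (hη n P.1 hT h0.1)
            (sq_nonneg (χ n P.1 * φ (incl P)))
          linarith

end Cutoff

/-! ### Weighted bounds for the potential -/

/-- With `D = 2 + 2c`, the support of `χ n` in `(0, π)` lies where `1/(n + D) < π - T < 1/(n - D)`.
So `π - T` is of size `1/n`, in an interval of length `2D/(n² - D²)`. -/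
theorem IsCutoffFamily.exists_interval {c : ℝ} {χ : ℕ → ℝ → ℝ} (hχ : IsCutoffFamily c χ) :
    ∃ κ Λ L : ℝ, 0 < κ ∧ 0 < Λ ∧ 0 < L ∧ ∀ n : ℕ, ∃ a, ∀ T ∈ Set.Ioo 0 π, χ n T ≠ 0 →
      κ ≤ (π - T) * (n + 1) ∧ (π - T) * (n + 1) ≤ Λ ∧
        T ∈ Set.Icc a (a + L / (n + 1) ^ 2) := by
  have hc := hχ.c_nonneg
  set D := 2 + 2 * c with hD
  have hD2 : 2 ≤ D := by linarith
  have hπ := pi_pos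
  refine ⟨1 / (1 + D), 4 + π * (2 * D + 1), 16 * D + π * (2 * D + 1) ^ 2, by positivity,
    by positivity, by positivity, fun n => ?_⟩
  have hn0 : (0 : ℝ) ≤ n := n.cast_nonneg
  have key : ∀ T ∈ Set.Ioo 0 π, χ n T ≠ 0 → 1 < (π - T) * (n + D) ∧ (π - T) * (n - D) < 1 := by
    intro T hT h
    refine ⟨?_, ?_⟩
    · by_contra h2
      exact h (hχ.zero_left n T (by linarith))
    · by_contra h2
      refine h (hχ.zero_right n T ?_)
      nlinarith [hT.2]
  have hlow : ∀ T ∈ Set.Ioo 0 π, χ n T ≠ 0 → 1 / (1 + D) ≤ (π - T) * (n + 1) := by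
    intro T hT h
    obtain ⟨h1, -⟩ := key T hT h
    rw [div_le_iff₀ (by positivity)]
    have : 0 < π - T := sub_pos.2 hT.2
    nlinarith [mul_nonneg this.le (mul_nonneg hn0 (by linarith : (0 : ℝ) ≤ D))]
  -- For `n < 2D` the upper bound `1/(n - D)` may fail; there the whole interval `(0, π)` is used,
  -- at the cost of a larger constant.
  rcases lt_or_ge (n : ℝ) (2 * D) with hn | hn
  · refine ⟨0, fun T hT h => ⟨hlow T hT h, ?_, hT.1.le, ?_⟩⟩
    · have : (π - T) * (n + 1) ≤ π * (2 * D + 1) := by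
        refine mul_le_mul ?_ (by linarith) (by positivity) hπ.le
        linarith [hT.1]
      linarith
    · rw [zero_add, le_div_iff₀ (by positivity)]
      have h2 : T * (n + 1) ^ 2 ≤ π * (2 * D + 1) ^ 2 := by
        refine mul_le_mul hT.2.le ?_ (by positivity) hπ.le
        exact pow_le_pow_left₀ (by positivity) (by linarith) 2
      linarith
  · have hnD : 0 < n - D := by linarith
    have hn1 : (1 : ℝ) ≤ n := by linarith
    refine ⟨π - 1 / (n - D), fun T hT h => ⟨hlow T hT h, ?_, ?_, ?_⟩⟩
    · obtain ⟨-, h2⟩ := key T hT h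
      have h3 : (π - T) * (n + 1) ≤ (π - T) * (4 * (n - D)) := by
        refine mul_le_mul_of_nonneg_left ?_ (sub_pos.2 hT.2).le
        linarith
      have : 0 < π * (2 * D + 1) := by positivity
      linarith
    · obtain ⟨-, h2⟩ := key T hT h
      rw [← lt_div_iff₀ hnD] at h2
      linarith
    · obtain ⟨h1, -⟩ := key T hT h
      rw [← div_lt_iff₀ (by positivity)] at h1
      have e : 1 / (n - D) - 1 / (n + D) = 2 * D / ((n - D) * (n + D)) := by
        have : (n : ℝ) + D ≠ 0 := by positivity
        field_simp
        ring
      have h3 : 2 * D / ((n - D) * (n + D)) ≤ 16 * D / (n + 1) ^ 2 := by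
        rw [div_le_div_iff₀ (by positivity) (by positivity)]
        have h4 : ((n : ℝ) + 1) ^ 2 ≤ 8 * ((n - D) * (n + D)) := by nlinarith
        nlinarith
      have h5 : 16 * D / ((n : ℝ) + 1) ^ 2 ≤
          (16 * D + π * (2 * D + 1) ^ 2) / ((n : ℝ) + 1) ^ 2 := by
        gcongr
        have : 0 ≤ π * (2 * D + 1) ^ 2 := by positivity
        linarith
      linarith

theorem eLpNorm_two_sq {μ : Measure Cyl} (f : Cyl → ℝ) :
    eLpNorm f 2 μ ^ 2 = ∫⁻ p, ENNReal.ofReal (f p ^ 2) ∂μ := by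
  have h := eLpNorm_nnreal_pow_eq_lintegral (f := f) (μ := μ) (p := 2) two_ne_zero
  simp only [NNReal.coe_ofNat, ENNReal.rpow_ofNat, ENNReal.coe_ofNat] at h
  rw [h]
  refine lintegral_congr fun p => ?_
  rw [← sq_abs, ENNReal.ofReal_pow (abs_nonneg _), ← Real.norm_eq_abs, ofReal_norm]

theorem eLpNorm_two_le {μ ν : Measure Cyl} {f g : Cyl → ℝ} {C : ℝ} (hC : 0 ≤ C)
    (h : ∫⁻ p, ENNReal.ofReal (f p ^ 2) ∂μ ≤
      ENNReal.ofReal (C ^ 2) * ∫⁻ p, ENNReal.ofReal (g p ^ 2) ∂ν) :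
    eLpNorm f 2 μ ≤ ENNReal.ofReal C * eLpNorm g 2 ν := by
  rw [← eLpNorm_two_sq, ← eLpNorm_two_sq, ENNReal.ofReal_pow hC, ← mul_pow] at h
  exact (ENNReal.pow_le_pow_left_iff two_ne_zero).1 h

theorem distP0_sq (p : Cyl) : distP0 p ^ 2 = (π - p.1) ^ 2 + polarR p.2 ^ 2 :=
  sq_sqrt (by positivity)

theorem distP0_nonneg (p : Cyl) : 0 ≤ distP0 p := sqrt_nonneg _

theorem sub_le_distP0 (p : Cyl) : π - p.1 ≤ distP0 p := by
  refine le_sqrt_of_sq_le ?_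
  nlinarith [sq_nonneg (polarR p.2)]

theorem nullDist_le_distP0 (p : Cyl) : nullDist p ≤ distP0 p := by
  refine le_trans ?_ (sub_le_distP0 p)
  have := polarR_nonneg p.2
  unfold nullDist
  linarith

theorem distP0_le_of_mem_tube {c : ℝ} {p : Cyl} (hp : p ∈ tube c) :
    0 < π - p.1 ∧ distP0 p ≤ 2 * (π - p.1) := by
  have h1 := hp.2.1
  have h2 := polarR_nonneg p.2
  unfold nullDist at h1
  refine ⟨by linarith, ?_⟩
  rw [← sq_le_sq₀ (distP0_nonneg p) (by linarith), distP0_sq]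
  nlinarith

/-- `U` is not assumed measurable, so the pointwise bound is applied on the closed support of `φ`.
-/
theorem lintegral_slab_le_of_test {U : Set Cyl} {φ : Ambient → ℝ} (hφ : IsTestOn U φ)
    {f g : Cyl → ℝ} (h : ∀ p ∈ U, f p ≤ g p) :
    ∫⁻ p in slab, ENNReal.ofReal (f p * φ (incl p) ^ 2) ∂cylMeasure ≤
      ∫⁻ p in U, ENNReal.ofReal (g p * φ (incl p) ^ 2) ∂cylMeasure := by
  set S := tsupport fun p : Cyl => φ (incl p) with hS
  have hSm : MeasurableSet S := (isClosed_tsupport _).measurableSet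
  calc ∫⁻ p in slab, ENNReal.ofReal (f p * φ (incl p) ^ 2) ∂cylMeasure
      ≤ ∫⁻ p, ENNReal.ofReal (f p * φ (incl p) ^ 2) ∂cylMeasure := setLIntegral_le_lintegral _ _
    _ = ∫⁻ p in S, ENNReal.ofReal (f p * φ (incl p) ^ 2) ∂cylMeasure := by
        rw [← lintegral_indicator hSm]
        refine lintegral_congr fun p => ?_
        by_cases hp : p ∈ S
        · rw [Set.indicator_of_mem hp]
        · rw [Set.indicator_of_notMem hp]
          simp [image_eq_zero_of_notMem_tsupport hp]
    _ ≤ ∫⁻ p in S, ENNReal.ofReal (g p * φ (incl p) ^ 2) ∂cylMeasure := by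
        refine setLIntegral_mono' hSm fun p hp => ENNReal.ofReal_le_ofReal ?_
        exact mul_le_mul_of_nonneg_right (h p (hφ.subset hp)) (sq_nonneg _)
    _ ≤ _ := lintegral_mono_set hφ.subset

/-- Bounds for the potential of a source in the tube, with `h = π - T`. -/
theorem exists_potential_bounds {c : ℝ} (hc : 0 ≤ c) : ∃ C : ℝ, 0 ≤ C ∧
    ∀ φ, IsTestOn (tube c) φ →
      (∀ i, ∫⁻ p in diamondPlus, ENNReal.ofReal (gamma i (potential φ) (incl p) ^ 2) ∂cylMeasure ≤
        ∫⁻ p in slab, ENNReal.ofReal (C * (π - p.1) ^ 2 * φ (incl p) ^ 2) ∂cylMeasure) ∧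
      (∀ i, ∫⁻ p in diamondPlus, ENNReal.ofReal ((nullDist p ^ 4)⁻¹ *
          gamma i (potential φ) (incl p) ^ 2) ∂cylMeasure ≤
        ∫⁻ p in slab, ENNReal.ofReal (C * ((π - p.1) ^ 2)⁻¹ * φ (incl p) ^ 2) ∂cylMeasure) ∧
      ∫⁻ p in diamondPlus, ENNReal.ofReal (potential φ (incl p) ^ 2) ∂cylMeasure ≤
        ∫⁻ p in slab, ENNReal.ofReal (C * (π - p.1) ^ 6 * φ (incl p) ^ 2) ∂cylMeasure := by
  obtain ⟨χ, hχ⟩ := exists_cutoffFamily hc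
  obtain ⟨κ, Λ, L, hκ, hΛ, hL, hint⟩ := hχ.exists_interval
  choose a ha using hint
  set M : ℕ := ⌈2 * (2 + 2 * c)⌉₊ + 2 with hM
  have hπ := pi_pos
  -- With `h = π - T` of size `1/(n + 1)`: the energy bound gives `(n + 1)⁻²`, hence `h²`; the
  -- weight `nullDist⁻⁴` adds `(n + 1)⁴`, hence `h⁻²`; Poincaré's inequality adds `(n + 1)⁻⁴` to the
  -- energy bound, hence `h⁶`.
  set C₁ := 4 * π * L / κ ^ 2
  set C₂ := 4 * π * L * Λ ^ 2
  set C₃ := (2 * L + 2 * (c * Λ ^ 2)) ^ 2 * (4 * π * L) / κ ^ 6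
  have hC₁ : 0 ≤ C₁ := by positivity
  have hC₂ : 0 ≤ C₂ := by positivity
  have hC₃ : 0 ≤ C₃ := by positivity
  have hM0 : (0 : ℝ) ≤ M := Nat.cast_nonneg _
  have absorb : ∀ (C : ℝ) (η : Cyl → ℝ) (φ : Ambient → ℝ), C ≤ C₁ + C₂ + C₃ → (∀ p, 0 ≤ η p) →
      (M : ℝ≥0∞) * ∫⁻ p in slab, ENNReal.ofReal (C * η p * φ (incl p) ^ 2) ∂cylMeasure ≤
        ∫⁻ p in slab, ENNReal.ofReal (M * (C₁ + C₂ + C₃) * η p * φ (incl p) ^ 2) ∂cylMeasure := by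
    intro C η φ hC hη
    rw [← lintegral_const_mul' _ _ (ENNReal.natCast_ne_top M)]
    refine lintegral_mono fun p => ?_
    simp only
    rw [← ENNReal.ofReal_natCast, ← ENNReal.ofReal_mul hM0]
    refine ENNReal.ofReal_le_ofReal ?_
    have h1 : C * (η p * φ (incl p) ^ 2) ≤ (C₁ + C₂ + C₃) * (η p * φ (incl p) ^ 2) :=
      mul_le_mul_of_nonneg_right hC (mul_nonneg (hη p) (sq_nonneg _))
    have h2 := mul_le_mul_of_nonneg_left h1 hM0
    linarith
  refine ⟨M * (C₁ + C₂ + C₃), by positivity, fun φ hφ => ?_⟩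
  have hN : ∀ n : ℕ, (0 : ℝ) < n + 1 := fun n => by positivity
  have hsupp : ∀ n, ∀ Q ∈ tube c, χ n (incl Q).1 * φ (incl Q) ≠ 0 →
      Q.1 ∈ Set.Ioo 0 π ∧ χ n Q.1 ≠ 0 := by
    intro n Q hQ h
    have h1 := hQ.2.1
    have h2 := polarR_nonneg Q.2
    unfold nullDist at h1
    exact ⟨⟨hQ.1, by linarith⟩, left_ne_zero_of_mul h⟩
  have hsupp' : ∀ n, ∀ Q ∈ tube c, χ n (incl Q).1 * φ (incl Q) ≠ 0 →
      Q.1 ∈ Set.Icc (a n) (a n + L / (n + 1) ^ 2) := fun n Q hQ h =>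
    (ha n Q.1 (hsupp n Q hQ h).1 (hsupp n Q hQ h).2).2.2
  -- The tube turns `nullDist = O(1/n)` into a radius `O(1/n²)`, the same order as the duration of
  -- the piece.
  have hrad : ∀ n, ∀ Q ∈ tube c, χ n (incl Q).1 * φ (incl Q) ≠ 0 →
      polarR Q.2 ≤ c * Λ ^ 2 / (n + 1) ^ 2 := by
    intro n Q hQ h
    have h1 := (ha n Q.1 (hsupp n Q hQ h).1 (hsupp n Q hQ h).2).2.1
    have h2 := polarR_nonneg Q.2
    have h3 : nullDist Q ≤ π - Q.1 := by unfold nullDist; linarith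
    refine hQ.2.2.trans ?_
    rw [mul_div_assoc, ← div_pow]
    refine mul_le_mul_of_nonneg_left (pow_le_pow_left₀ hQ.2.1.le ?_ 2) hc
    rw [le_div_iff₀ (hN n)]
    exact (mul_le_mul_of_nonneg_right h3 (hN n).le).trans h1
  have hinv : ∀ n : ℕ, ∀ T ∈ Set.Ioo 0 π, χ n T ≠ 0 → 1 / ((n : ℝ) + 1) ≤ (π - T) / κ := by
    intro n T hT h
    rw [div_le_div_iff₀ (hN n) hκ, one_mul]
    exact (ha n T hT h).1
  have hE : ∀ (i : Fin 7) (n : ℕ), ∫⁻ p in slab, ENNReal.ofReal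
      (gamma i (potential fun p => χ n p.1 * φ p) (incl p) ^ 2) ∂cylMeasure ≤
      ENNReal.ofReal (4 * π * (L / (n + 1) ^ 2)) *
        ∫⁻ p in slab, ENNReal.ofReal ((χ n p.1 * φ (incl p)) ^ 2) ∂cylMeasure := fun i n =>
    lintegral_gamma_potential_sq_le (hχ.mul_test hφ n) (div_pos hL (pow_pos (hN n) 2))
      (hsupp' n) i
  refine ⟨fun i => ?_, fun i => ?_, ?_⟩
  · have h := hχ.lintegral_weight_le hφ (fun n P hP => hχ.gamma_potential_eq hφ hP i)
      (A := fun n => 4 * π * (L / (n + 1) ^ 2)) (B := fun _ => 1) (fun n => by positivity) (hE i)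
      (β := fun _ => 1) (fun _ _ _ => le_rfl) (fun _ => zero_le_one)
      (η := fun h => C₁ * h ^ 2) (by fun_prop) ?_
    · simp only [one_mul] at h
      exact h.trans (absorb C₁ (fun p => (π - p.1) ^ 2) φ (by linarith) fun p => sq_nonneg _)
    · intro n T hT h
      have h1 := pow_le_pow_left₀ (by positivity) (hinv n T hT h) 2
      have h2 : 4 * π * (L / ((n : ℝ) + 1) ^ 2) * 1 = 4 * π * L * (1 / ((n : ℝ) + 1)) ^ 2 := by
        field_simp
      have h3 : C₁ * (π - T) ^ 2 = 4 * π * L * ((π - T) / κ) ^ 2 := by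
        simp only [C₁]; field_simp
      rw [h2, h3]
      exact mul_le_mul_of_nonneg_left h1 (by positivity)
  · have h := hχ.lintegral_weight_le hφ (fun n P hP => hχ.gamma_potential_eq hφ hP i)
      (A := fun n => 4 * π * (L / (n + 1) ^ 2)) (B := fun n => ((n : ℝ) + 1) ^ 4)
      (fun n => by positivity) (hE i) (β := fun p => (nullDist p ^ 4)⁻¹) ?_
      (fun n => by positivity) (η := fun h => C₂ * (h ^ 2)⁻¹) (by fun_prop) ?_
    · exact h.trans (absorb C₂ (fun p => ((π - p.1) ^ 2)⁻¹) φ (by linarith) fun p => by positivity)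
    · intro n P hP
      rw [← inv_pow, ← one_div]
      exact pow_le_pow_left₀ (one_div_pos.2 (nullDist_pos_of_mem hP.1)).le hP.2.2.le 4
    · intro n T hT h
      have hT0 : 0 < π - T := sub_pos.2 hT.2
      have h1 : (n : ℝ) + 1 ≤ Λ / (π - T) := by
        rw [le_div_iff₀ hT0, mul_comm]
        exact (ha n T hT h).2.1
      have h1 := pow_le_pow_left₀ (hN n).le h1 2
      have h2 : 4 * π * (L / ((n : ℝ) + 1) ^ 2) * ((n : ℝ) + 1) ^ 4 =
          4 * π * L * ((n : ℝ) + 1) ^ 2 := by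
        field_simp
      have h3 : C₂ * ((π - T) ^ 2)⁻¹ = 4 * π * L * (Λ / (π - T)) ^ 2 := by
        simp only [C₂]; field_simp
      rw [h2, h3]
      exact mul_le_mul_of_nonneg_left h1 (by positivity)
  · have h := hχ.lintegral_weight_le hφ (fun n P hP => hχ.potential_eq hφ hP)
      (A := fun n => (2 * (L / ((n : ℝ) + 1) ^ 2) + 2 * (c * Λ ^ 2 / ((n : ℝ) + 1) ^ 2)) ^ 2 *
        (4 * π * (L / ((n : ℝ) + 1) ^ 2))) (B := fun _ => 1) (fun n => by positivity)
      (fun n => lintegral_potential_sq_le (hχ.mul_test hφ n) (div_pos hL (pow_pos (hN n) 2))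
        (by positivity) (hsupp' n) (hrad n))
      (β := fun _ => 1) (fun _ _ _ => le_rfl) (fun _ => zero_le_one)
      (η := fun h => C₃ * h ^ 6) (by fun_prop) ?_
    · simp only [one_mul] at h
      exact h.trans (absorb C₃ (fun p => (π - p.1) ^ 6) φ (by linarith) fun p => by positivity)
    · intro n T hT h
      have h1 := pow_le_pow_left₀ (by positivity) (hinv n T hT h) 6
      have h2 : (2 * (L / ((n : ℝ) + 1) ^ 2) + 2 * (c * Λ ^ 2 / ((n : ℝ) + 1) ^ 2)) ^ 2 *
          (4 * π * (L / ((n : ℝ) + 1) ^ 2)) * 1 =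
          (2 * L + 2 * (c * Λ ^ 2)) ^ 2 * (4 * π * L) * (1 / ((n : ℝ) + 1)) ^ 6 := by
        field_simp
      have h3 : C₃ * (π - T) ^ 6 =
          (2 * L + 2 * (c * Λ ^ 2)) ^ 2 * (4 * π * L) * ((π - T) / κ) ^ 6 := by
        simp only [C₃]; field_simp
      rw [h2, h3]
      exact mul_le_mul_of_nonneg_left h1 (by positivity)

theorem diamondPlus_subset_slab : diamondPlus ⊆ slab := by
  intro P hP
  have h1 := nullDist_pos_of_mem hP
  have h2 := polarR_nonneg P.2
  unfold nullDist at h1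
  exact ⟨hP.2, by linarith⟩

theorem distP0_pos_of_mem {P : Cyl} (hP : P ∈ diamondPlus) : 0 < distP0 P :=
  (nullDist_pos_of_mem hP).trans_le (nullDist_le_distP0 P)

theorem tube_subset_diamondPlus (c : ℝ) : tube c ⊆ diamondPlus := by
  rintro P ⟨h1, h2, -⟩
  unfold nullDist at h2
  refine ⟨?_, h1.le⟩
  simp only [diamond, Set.mem_ofPred_eq]
  rw [abs_of_pos h1]
  linarith

/-- Weighted `L²` bounds for the potential of a source in a subset of the tube. -/
theorem exists_potential_eLpNorm_bounds {c : ℝ} (hc : 0 ≤ c) : ∃ C : ℝ, 0 ≤ C ∧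
    ∀ (U : Set Cyl) (φ : Ambient → ℝ), U ⊆ tube c → IsTestOn U φ →
      (∀ i, eLpNorm (fun p => gamma i (potential φ) (incl p)) 2 (cylMeasure.restrict diamondPlus) ≤
        ENNReal.ofReal C * eLpNorm (fun p => distP0 p ^ (1 : ℤ) * φ (incl p)) 2
          (cylMeasure.restrict U)) ∧
      (∀ i, eLpNorm (fun p => (distP0 p ^ 2)⁻¹ * gamma i (potential φ) (incl p)) 2
          (cylMeasure.restrict diamondPlus) ≤
        ENNReal.ofReal C * eLpNorm (fun p => distP0 p ^ (-1 : ℤ) * φ (incl p)) 2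
          (cylMeasure.restrict U)) ∧
      eLpNorm (fun p => potential φ (incl p)) 2 (cylMeasure.restrict diamondPlus) ≤
        ENNReal.ofReal C * eLpNorm (fun p => distP0 p ^ (3 : ℤ) * φ (incl p)) 2
          (cylMeasure.restrict U) ∧
      eLpNorm (fun p => potential φ (incl p)) 2 (cylMeasure.restrict diamondPlus) ≤
        ENNReal.ofReal C * eLpNorm (fun p => distP0 p ^ (-1 : ℤ) * φ (incl p)) 2
          (cylMeasure.restrict U) ∧
      eLpNorm (fun p => φ (incl p)) 2 (cylMeasure.restrict diamondPlus) ≤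
        ENNReal.ofReal C * eLpNorm (fun p => distP0 p ^ (-1 : ℤ) * φ (incl p)) 2
          (cylMeasure.restrict U) := by
  obtain ⟨C₀, hC₀, hb⟩ := exists_potential_bounds hc
  have hπ := pi_pos
  have hπ1 : 1 ≤ 2 * π := by linarith [pi_gt_three]
  -- On the tube `distP0 ≤ 2π`, so this factor trades surplus powers of the distance for the weight
  -- `distP0⁻¹`.
  set L := (2 * π) ^ 8 with hL
  have hL1 : 1 ≤ L := one_le_pow₀ hπ1
  set C := (4 * C₀ + 1) * L with hC
  have hC1 : 1 ≤ C := by nlinarith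
  refine ⟨C, by positivity, fun U φ hU hφ => ?_⟩
  have key : ∀ {f : Cyl → ℝ} {g : Cyl → ℝ} (k : ℤ),
      (∀ p ∈ tube c, f p ≤ C * (distP0 p ^ k) ^ 2) →
      ∫⁻ p in diamondPlus, ENNReal.ofReal (g p ^ 2) ∂cylMeasure ≤
        ∫⁻ p in slab, ENNReal.ofReal (f p * φ (incl p) ^ 2) ∂cylMeasure →
      eLpNorm g 2 (cylMeasure.restrict diamondPlus) ≤
        ENNReal.ofReal C * eLpNorm (fun p => distP0 p ^ k * φ (incl p)) 2
          (cylMeasure.restrict U) := by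
    intro f g k h1 h2
    refine eLpNorm_two_le (by linarith) (h2.trans ?_)
    refine (lintegral_slab_le_of_test hφ (f := f) (g := fun p => C ^ 2 * (distP0 p ^ k) ^ 2)
      fun p hp => (h1 p (hU hp)).trans ?_).trans ?_
    · exact mul_le_mul_of_nonneg_right (by nlinarith) (sq_nonneg _)
    · rw [← lintegral_const_mul' _ _ ENNReal.ofReal_ne_top]
      refine lintegral_mono fun p => ?_
      simp only
      rw [← ENNReal.ofReal_mul (sq_nonneg C)]
      exact le_of_eq (congrArg _ (by ring))
  have geom : ∀ p ∈ tube c, 0 < π - p.1 ∧ π - p.1 ≤ π ∧ π - p.1 ≤ distP0 p ∧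
      distP0 p ≤ 2 * (π - p.1) ∧ 0 < distP0 p ∧ distP0 p ≤ 2 * π := by
    intro p hp
    obtain ⟨h1, h2⟩ := distP0_le_of_mem_tube hp
    have h3 := sub_le_distP0 p
    have h4 := hp.1
    exact ⟨h1, by linarith, h3, h2, by linarith, by linarith⟩
  obtain ⟨b1, b2, b3⟩ := hb φ (hφ.mono hU)
  have inv_bound : ∀ p ∈ tube c, 1 ≤ L * (distP0 p ^ (-1 : ℤ)) ^ 2 ∧
      (π - p.1) ^ 6 ≤ L * (distP0 p ^ (-1 : ℤ)) ^ 2 := by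
    intro p hp
    obtain ⟨h1, h2, h3, h4, h5, h6⟩ := geom p hp
    rw [zpow_neg_one, inv_pow, ← div_eq_mul_inv, le_div_iff₀ (by positivity),
      le_div_iff₀ (by positivity)]
    have i1 : distP0 p ^ 2 ≤ (2 * π) ^ 2 := pow_le_pow_left₀ h5.le h6 2
    have i2 : (π - p.1) ^ 6 ≤ (2 * π) ^ 6 := pow_le_pow_left₀ h1.le (by linarith) 6
    have i3 : (1 : ℝ) ≤ (2 * π) ^ 6 := one_le_pow₀ hπ1
    have e : L = (2 * π) ^ 6 * (2 * π) ^ 2 := by rw [hL]; ring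
    rw [e]
    exact ⟨mul_le_mul i3 i1 (by positivity) (by positivity),
      mul_le_mul i2 i1 (by positivity) (by positivity)⟩
  have hCC : C₀ ≤ C := by nlinarith
  refine ⟨fun i => key 1 (fun p hp => ?_) (b1 i), fun i => key (-1) (fun p hp => ?_)
    ((lintegral_mono_ae ?_).trans (b2 i)), key 3 (fun p hp => ?_) b3,
    key (-1) (fun p hp => ?_) b3, key (f := fun _ => 1) (-1) (fun p hp => ?_) ?_⟩
  · obtain ⟨h1, h2, h3, h4, h5, h6⟩ := geom p hp
    rw [zpow_one]
    gcongr
  · obtain ⟨h1, h2, h3, h4, h5, h6⟩ := geom p hp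
    have i1 : ((π - p.1) ^ 2)⁻¹ ≤ 4 * (distP0 p ^ (-1 : ℤ)) ^ 2 := by
      rw [zpow_neg_one, inv_pow, ← div_eq_mul_inv, le_div_iff₀ (by positivity),
        inv_mul_le_iff₀ (by positivity)]
      nlinarith
    have i2 : C₀ * 4 ≤ C := by nlinarith
    calc C₀ * ((π - p.1) ^ 2)⁻¹ ≤ C₀ * (4 * (distP0 p ^ (-1 : ℤ)) ^ 2) := by gcongr
      _ = C₀ * 4 * (distP0 p ^ (-1 : ℤ)) ^ 2 := by ring
      _ ≤ _ := by gcongr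
  · filter_upwards [ae_restrict_mem measurableSet_diamondPlus] with p hp
    refine ENNReal.ofReal_le_ofReal ?_
    rw [mul_pow]
    refine mul_le_mul_of_nonneg_right ?_ (sq_nonneg _)
    have h1 := nullDist_pos_of_mem hp
    have h2 := nullDist_le_distP0 p
    rw [inv_pow, ← pow_mul]
    gcongr
  · obtain ⟨h1, h2, h3, h4, h5, h6⟩ := geom p hp
    have : (distP0 p ^ (3 : ℤ)) ^ 2 = distP0 p ^ 6 := by
      rw [show (3 : ℤ) = ((3 : ℕ) : ℤ) from rfl, zpow_natCast, ← pow_mul]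
    rw [this]
    gcongr
  · have h := (inv_bound p hp).2
    calc C₀ * (π - p.1) ^ 6 ≤ C₀ * (L * (distP0 p ^ (-1 : ℤ)) ^ 2) := by gcongr
      _ = C₀ * L * (distP0 p ^ (-1 : ℤ)) ^ 2 := by ring
      _ ≤ _ := by
        gcongr
        rw [hC]; gcongr; linarith
  · refine (inv_bound p hp).1.trans ?_
    gcongr
    rw [hC]; nlinarith
  · simp only [one_mul]
    exact lintegral_mono_set diamondPlus_subset_slab

/-! ### The weak equation tested with potentials -/

theorem continuous_distP0 : Continuous distP0 := by
  have := continuous_polarR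
  unfold distP0
  fun_prop

theorem measurable_distP0_zpow (k : ℤ) : Measurable fun p => distP0 p ^ k :=
  continuous_distP0.measurable.pow_const k

theorem IsTestOn.memLp_weight {U : Set Cyl} {φ : Ambient → ℝ} (hφ : IsTestOn U φ)
    (hU : U ⊆ diamondPlus) (k : ℤ) : MemLp (fun p => distP0 p ^ k * φ (incl p)) 2 cylMeasure := by
  have hs : (tsupport fun p => distP0 p ^ k * φ (incl p)) ⊆ tsupport fun p : Cyl => φ (incl p) :=
    tsupport_mul_subset_right (f := fun p => distP0 p ^ k)
  refine Continuous.memLp_of_hasCompactSupport ?_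
    (hφ.compact.of_isClosed_subset (isClosed_tsupport _) hs)
  refine continuous_of_tsupport fun p hp => ?_
  have hpos := distP0_pos_of_mem (hU (hφ.subset (hs hp)))
  exact (continuous_distP0.continuousAt.zpow₀ k (Or.inl hpos.ne')).mul hφ.continuous.continuousAt

theorem isTestOn_of_subset {S V : Set Cyl} {ψ : Ambient → ℝ} (hψ : ContDiff ℝ ∞ ψ)
    (hS : IsCompact S) (h : ∀ P, ψ (incl P) ≠ 0 → P ∈ S) (hSV : S ⊆ V) : IsTestOn V ψ := by
  have hs : (tsupport fun p : Cyl => ψ (incl p)) ⊆ S := closure_minimal h hS.isClosed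
  exact ⟨hψ, hS.of_isClosed_subset (isClosed_tsupport _) hs, hs.trans hSV⟩

/-- The compact set `{a ≤ T, T + R ≤ π - η}`. -/
def truncation (a η : ℝ) : Set Cyl := {P | a ≤ P.1 ∧ η ≤ nullDist P}

theorem isCompact_truncation (a : ℝ) {η : ℝ} (hη : 0 ≤ η) : IsCompact (truncation a η) := by
  refine ((isCompact_Icc (a := a) (b := π)).prod isCompact_univ).of_isClosed_subset
    ((isClosed_le continuous_const continuous_fst).inter
      (isClosed_le continuous_const continuous_nullDist)) ?_
  rintro P ⟨h1, h2⟩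
  have h3 := polarR_nonneg P.2
  unfold nullDist at h2
  exact ⟨⟨h1, by linarith⟩, trivial⟩

theorem truncation_subset_diamond {a η : ℝ} (hη : 0 < η) (ha : -η < 2 * a) :
    truncation a η ⊆ diamond := by
  rintro P ⟨h1, h2⟩
  unfold nullDist at h2
  simp only [diamond, Set.mem_ofPred_eq]
  rcases abs_cases P.1 with h | h <;> linarith [h.1]

/-- `nullDist` at a point of a forward light cone is at most its value at the vertex. So the
potential vanishes wherever `nullDist` is below its positive lower bound on the support of `φ`. -/
theorem IsTestOn.exists_truncation {c : ℝ} {φ : Ambient → ℝ} (hφ : IsTestOn (tube c) φ) :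
    ∃ η, 0 < η ∧ ∀ P, potential φ (incl P) ≠ 0 → η ≤ nullDist P := by
  obtain ⟨η, hη, h⟩ := hφ.compact.exists_forall_le' continuous_nullDist.continuousOn
    (a := 0) fun P hP => (hφ.subset hP).2.1
  refine ⟨η, hη, fun P hP => ?_⟩
  obtain ⟨k, hk, hk0⟩ : ∃ k ∈ kerSet, φ (cone (incl P) k) ≠ 0 := by
    by_contra h2
    push Not at h2
    exact hP (potential_eq_zero h2)
  obtain ⟨Q, hQ, hQ1, hQ2, -, -⟩ := exists_cone_eq_incl P hk
  rw [hQ] at hk0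
  have h1 := h Q (subset_tsupport _ hk0)
  unfold nullDist at h1 ⊢
  linarith

theorem gamma_eventuallyEq {f g : Ambient → ℝ} {p : Ambient} (h : f =ᶠ[nhds p] g) (i : Fin 7) :
    gamma i f =ᶠ[nhds p] gamma i g := by
  filter_upwards [h.fderiv (𝕜 := ℝ)] with q hq
  simp only [gamma, hq]

theorem box_eq_of_eventuallyEq {f g : Ambient → ℝ} {p : Ambient} (h : f =ᶠ[nhds p] g) :
    box f p = box g p := by
  have h2 : ∀ i, gamma i (gamma i f) p = gamma i (gamma i g) p := fun i =>
    (gamma_eventuallyEq (gamma_eventuallyEq h i) i).self_of_nhds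
  simp only [box, h2]

/-- A smooth step in time, from `0` for `T ≤ a` to `1` for `T ≥ b`. -/
def timeStep (a b T : ℝ) : ℝ := Real.smoothTransition ((T - a) / (b - a))

theorem contDiff_timeStep (a b : ℝ) : ContDiff ℝ ∞ fun p : Ambient => timeStep a b p.1 := by
  unfold timeStep
  exact Real.smoothTransition.contDiff.comp
    ((contDiff_fst.sub contDiff_const).div_const _)

theorem timeStep_eq_zero {a b T : ℝ} (hab : a < b) (hT : T ≤ a) : timeStep a b T = 0 :=
  Real.smoothTransition.zero_of_nonpos
    (div_nonpos_of_nonpos_of_nonneg (by linarith) (by linarith))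

theorem timeStep_eq_one {a b T : ℝ} (hab : a < b) (hT : b ≤ T) : timeStep a b T = 1 :=
  Real.smoothTransition.one_of_one_le ((one_le_div (by linarith)).2 (by linarith))

theorem IsTestOn.timeStep_potential {c η : ℝ} {φ : Ambient → ℝ} (hφ : IsTestOn (tube c) φ)
    (hη : 0 ≤ η) (h : ∀ P, potential φ (incl P) ≠ 0 → η ≤ nullDist P) {a b : ℝ} (hab : a < b)
    {V : Set Cyl} (hV : truncation a η ⊆ V) :
    IsTestOn V fun p => timeStep a b p.1 * potential φ p := by
  refine isTestOn_of_subset ((contDiff_timeStep a b).mul (contDiff_potential hφ.contDiff))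
    (isCompact_truncation a hη) (fun P hP => ⟨?_, h P (right_ne_zero_of_mul hP)⟩) hV
  by_contra h2
  exact left_ne_zero_of_mul hP (timeStep_eq_zero hab (not_le.1 h2).le)

/-- The weak equation tested with the backward solution. Test functions need not vanish at `T = 0`,
so it suffices to cut the potential off at slightly negative times. -/
theorem IsFreeWave.integral_eq_potential {u F : Cyl → ℝ} (hu : IsFreeWave u F) {c : ℝ}
    {φ : Ambient → ℝ} (hφ : IsTestOn (tube c) φ) :
    ∫ p in diamondPlus, u p * φ (incl p) ∂cylMeasure =
      ∫ p in diamondPlus, F p * potential φ (incl p) ∂cylMeasure := by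
  obtain ⟨η, hη, h⟩ := hφ.exists_truncation
  -- The step ends below `T = 0` and starts above `-η / 2`, so the truncation stays inside the
  -- diamond.
  have hab : -η / 3 < -η / 4 := by linarith
  have hψ := hφ.timeStep_potential hη.le h hab (truncation_subset_diamond hη (by linarith))
  have key : ∀ p ∈ diamondPlus, (fun q : Ambient => timeStep (-η / 3) (-η / 4) q.1 *
      potential φ q) =ᶠ[nhds (incl p)] potential φ := by
    intro p hp
    have h1 : -η / 4 < (incl p).1 := by
      have : (0 : ℝ) ≤ p.1 := hp.2
      change -η / 4 < p.1
      linarith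
    filter_upwards [continuous_fst.continuousAt.eventually (lt_mem_nhds h1)] with q hq
    rw [timeStep_eq_one hab (le_of_lt hq), one_mul]
  refine Eq.trans (setIntegral_congr_fun measurableSet_diamondPlus fun p hp => ?_)
    ((hu.integral_eq _ hψ).trans (setIntegral_congr_fun measurableSet_diamondPlus fun p hp => ?_))
  · have h2 := (key p hp).self_of_nhds
    simp only at h2
    rw [box_eq_of_eventuallyEq (key p hp), h2]
    congr 1
    exact (box_potential_of_test hφ hp.2 (by simp)).symm
  · have h2 := (key p hp).self_of_nhds
    simp only at h2
    rw [h2]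

theorem measurableSet_diamond_inter : MeasurableSet (diamond ∩ {p | 0 < p.1}) :=
  (measurableSet_lt ((continuous_polarR.comp continuous_snd).add
    continuous_fst.abs).measurable measurable_const).inter
    (measurableSet_lt measurable_const measurable_fst)

theorem restrict_diamondPlus :
    cylMeasure.restrict diamondPlus = cylMeasure.restrict (diamond ∩ {p | 0 < p.1}) := by
  refine Measure.restrict_congr_set ?_
  have h0 : cylMeasure ({0} ×ˢ Set.univ) = 0 := by
    rw [cylMeasure, Measure.prod_prod]
    simp
  have h1 : ∀ᵐ p ∂cylMeasure, p.1 ≠ 0 := by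
    rw [ae_iff]
    refine measure_mono_null ?_ h0
    intro p hp
    simpa using hp
  filter_upwards [h1] with p hp
  apply propext
  change (p ∈ diamond ∧ 0 ≤ p.1) ↔ (p ∈ diamond ∧ 0 < p.1)
  exact and_congr_right fun _ => ⟨fun h => lt_of_le_of_ne h hp.symm, le_of_lt⟩

theorem gammaRev_single (i : Fin 7) (φ : Ambient → ℝ) :
    gammaRev (Pi.single i 1) φ = gamma i φ := by
  fin_cases i <;> rfl

theorem memLp_of_continuous_diamondPlus {f : Cyl → ℝ} (hf : Continuous f) :
    MemLp f 2 (cylMeasure.restrict diamondPlus) := by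
  obtain ⟨M, hM⟩ := isCompact_slab.exists_bound_of_continuousOn hf.continuousOn
  have : IsFiniteMeasure (cylMeasure.restrict diamondPlus) :=
    ⟨lt_of_le_of_lt (Measure.restrict_mono diamondPlus_subset_slab le_rfl _)
      (measure_lt_top (cylMeasure.restrict slab) _)⟩
  refine MemLp.of_bound hf.aestronglyMeasurable M ?_
  filter_upwards [ae_restrict_mem measurableSet_diamondPlus] with p hp
  exact hM p (diamondPlus_subset_slab hp)

theorem IsTestOn.continuous_potential {U : Set Cyl} {φ : Ambient → ℝ} (hφ : IsTestOn U φ) :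
    Continuous fun p : Cyl => potential φ (incl p) :=
  (contDiff_potential hφ.contDiff).continuous.comp continuous_incl

theorem IsTestOn.integrable_mul_potential {c : ℝ} {φ : Ambient → ℝ} (hφ : IsTestOn (tube c) φ)
    {G : Cyl → ℝ}
    (hG : MemLp (fun p => distP0 p ^ 2 * G p) 2 (cylMeasure.restrict diamondPlus)) :
    MemLp (fun p => (distP0 p ^ 2)⁻¹ * potential φ (incl p)) 2
      (cylMeasure.restrict diamondPlus) ∧
    Integrable (fun p => G p * potential φ (incl p)) (cylMeasure.restrict diamondPlus) := by
  obtain ⟨η, hη, h⟩ := hφ.exists_truncation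
  have h1 : MemLp (fun p => (distP0 p ^ 2)⁻¹ * potential φ (incl p)) 2
      (cylMeasure.restrict diamondPlus) := by
    refine (memLp_of_continuous_diamondPlus
      (hφ.continuous_potential.const_mul (η ^ 2)⁻¹)).mono ?_ (.of_forall fun p => ?_)
    · exact ((continuous_distP0.measurable.pow_const 2).inv.mul
        hφ.continuous_potential.measurable).aestronglyMeasurable
    · rw [norm_mul, norm_mul]
      by_cases h0 : potential φ (incl p) = 0
      · simp [h0]
      · have h2 := (h p h0).trans (nullDist_le_distP0 p)
        gcongr
        rw [Real.norm_of_nonneg (by positivity), Real.norm_of_nonneg (by positivity)]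
        gcongr
  refine ⟨h1, (hG.integrable_mul h1).congr ?_⟩
  filter_upwards [ae_restrict_mem measurableSet_diamondPlus] with p hp
  have := distP0_pos_of_mem hp
  simp only [Pi.mul_apply]
  field_simp

theorem gamma_timeStep {j : Fin 7} (hj : j ≠ 0) (a b : ℝ) (p : Ambient) :
    gamma j (fun q : Ambient => timeStep a b q.1) p = 0 := by
  have h2 := ((contDiff_timeStep a b).differentiable (by simp) p).hasFDerivAt
  have h3 := h2.comp_hasDerivAt_of_eq (x := (0 : ℝ))
    (f := fun s : ℝ => (p.1, p.2 + s • gammaLin j p.2))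
    (((hasDerivAt_const (0 : ℝ) p.1).prodMk
      (((hasDerivAt_id (0 : ℝ)).smul_const (gammaLin j p.2)).const_add p.2))) (by simp)
  simp only [gamma, gammaField_eq, if_neg hj]
  simpa using h3.unique (hasDerivAt_const (0 : ℝ) (timeStep a b p.1))

/-- The weak derivative of `F` is given only on `T > 0`, where the potential is not a test function.
Cutoffs that depend on `T` alone are annihilated by rotations, so they leave no boundary term and
are removed by dominated convergence. For `∂_T` a term at `T = 0` would appear. -/
theorem HasWeakGamma.integral_potential {F G : Cyl → ℝ} {j : Fin 7} (hj : j ≠ 0)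
    (h : HasWeakGamma (diamond ∩ {p | 0 < p.1}) (Pi.single j 1) F G)
    (hF : MemLp F 2 (cylMeasure.restrict diamondPlus))
    (hG : MemLp (fun p => distP0 p ^ 2 * G p) 2 (cylMeasure.restrict diamondPlus)) {c : ℝ}
    {φ : Ambient → ℝ} (hφ : IsTestOn (tube c) φ) :
    ∫ p in diamondPlus, F p * gamma j (potential φ) (incl p) ∂cylMeasure =
      -∫ p in diamondPlus, G p * potential φ (incl p) ∂cylMeasure := by
  obtain ⟨η, hη, hη'⟩ := hφ.exists_truncation
  have hFI : Integrable (fun p => F p * gamma j (potential φ) (incl p))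
      (cylMeasure.restrict diamondPlus) := by
    rw [gamma_potential hφ.contDiff]
    exact hF.integrable_mul (memLp_of_continuous_diamondPlus (hφ.gamma j).continuous_potential)
  have hGI := (hφ.integrable_mul_potential hG).2
  rw [restrict_diamondPlus] at hFI hGI ⊢
  set χ : ℕ → ℝ → ℝ := fun n => timeStep (1 / (n + 1)) (2 / (n + 1)) with hχ
  have hab : ∀ n : ℕ, 1 / ((n : ℝ) + 1) < 2 / (n + 1) := fun n => by gcongr; norm_num
  have hχm : ∀ n, Continuous fun p : Cyl => χ n p.1 := fun n =>
    (contDiff_timeStep _ _).continuous.comp continuous_incl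
  have hlim : ∀ {f : Cyl → ℝ}, Integrable f (cylMeasure.restrict (diamond ∩ {p | 0 < p.1})) →
      Filter.Tendsto (fun n => ∫ p in diamond ∩ {p | 0 < p.1}, χ n p.1 * f p ∂cylMeasure)
        Filter.atTop (nhds (∫ p in diamond ∩ {p | 0 < p.1}, f p ∂cylMeasure)) := by
    intro f hf
    refine tendsto_integral_of_dominated_convergence (fun p => ‖f p‖)
      (fun n => (hχm n).aestronglyMeasurable.mul hf.1) hf.norm (fun n => .of_forall fun p => ?_) ?_
    · rw [norm_mul]
      refine mul_le_of_le_one_left (norm_nonneg _) ?_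
      have : 0 ≤ χ n p.1 := Real.smoothTransition.nonneg _
      rw [Real.norm_of_nonneg this]
      exact Real.smoothTransition.le_one _
    · filter_upwards [ae_restrict_mem measurableSet_diamond_inter] with p hp
      have h2 : Filter.Tendsto (fun n : ℕ => 2 / ((n : ℝ) + 1)) Filter.atTop (nhds 0) := by
        simpa using (tendsto_one_div_add_atTop_nhds_zero_nat (𝕜 := ℝ)).const_mul 2 |>.congr
          (fun n => by ring)
      refine tendsto_const_nhds.congr' ?_
      filter_upwards [h2.eventually (gt_mem_nhds hp.2)] with n hn
      simp only [hχ]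
      rw [timeStep_eq_one (hab n) hn.le, one_mul]
  have heq : ∀ n, ∫ p in diamond ∩ {p | 0 < p.1}, χ n p.1 *
      (F p * gamma j (potential φ) (incl p)) ∂cylMeasure =
      -∫ p in diamond ∩ {p | 0 < p.1}, χ n p.1 * (G p * potential φ (incl p)) ∂cylMeasure := by
    intro n
    have hn : (0 : ℝ) < 1 / (n + 1) := by positivity
    have hψ : IsTestOn (diamond ∩ {p | 0 < p.1}) fun p => χ n p.1 * potential φ p :=
      hφ.timeStep_potential hη.le hη' (hab n) fun P hP =>
        ⟨truncation_subset_diamond hη (by linarith) hP, hn.trans_le hP.1⟩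
    have h1 := h.integral_eq _ hψ
    rw [gammaRev_single, Finset.sum_pi_single'] at h1
    simp only [Finset.mem_univ, if_true, pow_one, neg_one_mul] at h1
    have hχj := fun p => gamma_timeStep hj (1 / (n + 1)) (2 / (n + 1)) p
    rw [integral_congr_ae (.of_forall fun p => ?_), h1, neg_inj]
    · exact integral_congr_ae (.of_forall fun p => by simp only [incl]; ring)
    · rw [gamma_mul (contDiff_timeStep _ _) (contDiff_potential hφ.contDiff)]
      change _ = F p * (χ n p.1 * _ + gamma j (fun q : Ambient => χ n q.1) _ * _)
      rw [hχj]
      ring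
  have h3 := hlim hFI
  simp only [heq] at h3
  exact tendsto_nhds_unique h3 (hlim hGI).neg

/-! ### Multi-indices of length at most two -/

theorem exists_eq_single_add {α : Fin 7 → ℕ} (h : ∑ i, α i ≠ 0) :
    ∃ (i : Fin 7) (β : Fin 7 → ℕ), α = Pi.single i 1 + β ∧ ∑ k, β k + 1 = ∑ k, α k := by
  obtain ⟨i, -, hi⟩ := Finset.exists_ne_zero_of_sum_ne_zero h
  have e : α = Pi.single i 1 + (α - Pi.single i 1) := by
    ext k
    rcases eq_or_ne k i with rfl | hk
    · simp only [Pi.add_apply, Pi.sub_apply, Pi.single_eq_same]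
      omega
    · simp [Pi.single_eq_of_ne hk]
  refine ⟨i, _, e, ?_⟩
  conv_rhs => rw [e]
  simp [Finset.sum_add_distrib, add_comm]

theorem eq_zero_of_sum_eq_zero {α : Fin 7 → ℕ} (h : ∑ i, α i = 0) : α = 0 := by
  ext k
  exact Finset.sum_eq_zero_iff.1 h k (Finset.mem_univ k)

theorem multiIndex_cases {α : Fin 7 → ℕ} (h : ∑ i, α i ≤ 2) :
    (α = 0 ∧ ∑ i, α i = 0) ∨ (∃ i : Fin 7, α = Pi.single i 1 ∧ ∑ i, α i = 1) ∨
      ∃ i j : Fin 7, i ≤ j ∧ α = Pi.single i 1 + Pi.single j 1 ∧ ∑ i, α i = 2 := by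
  by_cases h0 : ∑ i, α i = 0
  · exact Or.inl ⟨eq_zero_of_sum_eq_zero h0, h0⟩
  obtain ⟨i, β, e, hs⟩ := exists_eq_single_add h0
  by_cases h1 : ∑ i, β i = 0
  · refine Or.inr (Or.inl ⟨i, ?_, by omega⟩)
    rw [e, eq_zero_of_sum_eq_zero h1, add_zero]
  obtain ⟨j, γ, e', hs'⟩ := exists_eq_single_add h1
  have h2 : γ = 0 := eq_zero_of_sum_eq_zero (by omega)
  rw [h2, add_zero] at e'
  rw [e'] at e
  refine Or.inr (Or.inr ?_)
  rcases le_total i j with hij | hij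
  · exact ⟨i, j, hij, e, by omega⟩
  · exact ⟨j, i, hij, by rw [e, add_comm], by omega⟩

/-- The larger index acts last, so the field to be moved onto `F` is a rotation unless both are
`∂_T`. -/
theorem gammaRev_single_add_single {i j : Fin 7} (h : i ≤ j) (φ : Ambient → ℝ) :
    gammaRev (Pi.single i 1 + Pi.single j 1) φ = gamma j (gamma i φ) := by
  revert h
  fin_cases i <;> fin_cases j <;> intro h <;> first | rfl | exact absurd h (by decide)

theorem IsTestOn.gammaRev {U : Set Cyl} {φ : Ambient → ℝ} (hφ : IsTestOn U φ) {α : Fin 7 → ℕ}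
    (h : ∑ i, α i ≤ 2) : IsTestOn U (gammaRev α φ) := by
  rcases multiIndex_cases h with ⟨rfl, -⟩ | ⟨i, rfl, -⟩ | ⟨i, j, hij, rfl, -⟩
  · exact hφ
  · rw [gammaRev_single]
    exact hφ.gamma i
  · rw [gammaRev_single_add_single hij]
    exact (hφ.gamma i).gamma j

/-! ### Bounds for the weak derivatives as functionals -/

theorem enorm_integral_mul_le {μ : Measure Cyl} {f g : Cyl → ℝ} (hf : AEStronglyMeasurable f μ)
    (hg : AEStronglyMeasurable g μ) :
    ‖∫ p, f p * g p ∂μ‖ₑ ≤ eLpNorm f 2 μ * eLpNorm g 2 μ := by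
  refine (enorm_integral_le_lintegral_enorm _).trans ?_
  rw [← eLpNorm_one_eq_lintegral_enorm]
  have h := eLpNorm_smul_le_mul_eLpNorm (p := 2) (q := 2) (r := 1) hg hf
  simp only [smul_eq_mul] at h
  exact h

theorem IsTestOn.enorm_integral_potential_le {c : ℝ} {φ : Ambient → ℝ}
    (hφ : IsTestOn (tube c) φ) {G : Cyl → ℝ}
    (hG : MemLp (fun p => distP0 p ^ 2 * G p) 2 (cylMeasure.restrict diamondPlus)) :
    ‖∫ p in diamondPlus, G p * potential φ (incl p) ∂cylMeasure‖ₑ ≤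
      eLpNorm (fun p => distP0 p ^ 2 * G p) 2 (cylMeasure.restrict diamondPlus) *
        eLpNorm (fun p => (distP0 p ^ 2)⁻¹ * potential φ (incl p)) 2
          (cylMeasure.restrict diamondPlus) := by
  refine le_of_eq_of_le ?_
    (enorm_integral_mul_le hG.1 (hφ.integrable_mul_potential hG).1.1)
  congr 1
  refine setIntegral_congr_fun measurableSet_diamondPlus fun p hp => ?_
  have := distP0_pos_of_mem hp
  field_simp

/-- The wave equation trades `∂_T²`, which cannot be integrated by parts without a boundary term,
for squares of rotations. -/
theorem gamma_zero_gamma_zero_potential {c : ℝ} {φ : Ambient → ℝ} (hφ : IsTestOn (tube c) φ)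
    {p : Cyl} (hp : p ∈ diamondPlus) :
    potential (gamma 0 (gamma 0 φ)) (incl p) =
      ∑ k : Fin 6, gamma k.succ (potential (gamma k.succ φ)) (incl p) -
        potential φ (incl p) + φ (incl p) := by
  have h := box_potential_of_test hφ (T := p.1) hp.2 (x := p.2) (by simp)
  change box (potential φ) (incl p) + potential φ (incl p) = φ (incl p) at h
  simp only [box, gamma_potential hφ.contDiff] at h
  rw [gamma_potential (contDiff_gamma hφ.contDiff 0)] at h
  linarith

/-- Each `∫ u Γ^α φ` becomes `∫ F potential(Γ^α φ)`, up to order. The dual weights for `|α| = 0, 1,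
2` are `d³`, `d` and `d⁻¹`, exactly those in the bounds for `w`, `Γ w` and `d⁻² Γ w`. -/
theorem exists_functional_bound {c : ℝ} (hc : 0 ≤ c) : ∃ C : ℝ, 0 ≤ C ∧
    ∀ (u F : Cyl → ℝ) (DF : Fin 7 → Cyl → ℝ), IsFreeWave u F →
      (∀ i, HasWeakGamma (diamond ∩ {p | 0 < p.1}) (Pi.single i 1) F (DF i)) →
      MemLp F 2 (cylMeasure.restrict diamondPlus) →
      (∀ i, MemLp (fun p => distP0 p ^ 2 * DF i p) 2 (cylMeasure.restrict diamondPlus)) →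
      ∀ U ⊆ tube c, ∀ (α : Fin 7 → ℕ), ∑ i, α i ≤ 2 → ∀ φ, IsTestOn U φ →
        ‖∫ p in U, u p * gammaRev α φ (incl p) ∂cylMeasure‖ₑ ≤
          ENNReal.ofReal C * (eLpNorm F 2 (cylMeasure.restrict diamondPlus) +
            ∑ i, eLpNorm (fun p => distP0 p ^ 2 * DF i p) 2 (cylMeasure.restrict diamondPlus)) *
          eLpNorm (fun p => distP0 p ^ (-(1 + 2 * (((∑ i, α i : ℕ) : ℤ) - 2))) * φ (incl p)) 2
            (cylMeasure.restrict U) := by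
  obtain ⟨C, hC, hb⟩ := exists_potential_eLpNorm_bounds hc
  -- The worst case is `∂_T²`: six squares of rotations, the potential itself and the source.
  refine ⟨8 * C, by positivity, fun u F DF hu hD hF hDF U hU α hα φ hφ => ?_⟩
  obtain ⟨b1, b2, b3, b4, b5⟩ := hb U φ hU hφ
  have hφt := hφ.mono hU
  set N := eLpNorm F 2 (cylMeasure.restrict diamondPlus) +
    ∑ i, eLpNorm (fun p => distP0 p ^ 2 * DF i p) 2 (cylMeasure.restrict diamondPlus) with hN
  have hNF : eLpNorm F 2 (cylMeasure.restrict diamondPlus) ≤ N := le_self_add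
  have hND : ∀ i, eLpNorm (fun p => distP0 p ^ 2 * DF i p) 2 (cylMeasure.restrict diamondPlus) ≤
      N := fun i => (Finset.single_le_sum (f := fun i => eLpNorm (fun p => distP0 p ^ 2 * DF i p) 2
        (cylMeasure.restrict diamondPlus)) (fun _ _ => zero_le) (Finset.mem_univ i)).trans le_add_self
  have h8 : ENNReal.ofReal (8 * C) = 8 * ENNReal.ofReal C := by
    rw [ENNReal.ofReal_mul (by norm_num)]
    simp
  have step : ∀ {X a b y : ℝ≥0∞}, y ≤ a * b → a ≤ N → b ≤ ENNReal.ofReal C * X →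
      y ≤ ENNReal.ofReal C * N * X := by
    intro X a b y h1 h2 h3
    refine (h1.trans (mul_le_mul' h2 h3)).trans (le_of_eq ?_)
    ring
  have one_le : ∀ {X y : ℝ≥0∞}, y ≤ ENNReal.ofReal C * N * X →
      y ≤ ENNReal.ofReal (8 * C) * N * X := by
    intro X y h
    refine h.trans ?_
    rw [h8]
    gcongr
    exact le_mul_of_one_le_left zero_le (by norm_num)
  have hw : ∀ {f : Cyl → ℝ}, Continuous f →
      AEStronglyMeasurable f (cylMeasure.restrict diamondPlus) := fun h => h.aestronglyMeasurable
  have hred : ∀ {ψ : Ambient → ℝ}, IsTestOn U ψ → ∫ p in U, u p * ψ (incl p) ∂cylMeasure =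
      ∫ p in diamondPlus, F p * potential ψ (incl p) ∂cylMeasure := by
    intro ψ hψ
    rw [← hu.integral_eq_potential (hψ.mono hU)]
    refine (setIntegral_eq_of_subset_of_forall_sdiff_eq_zero measurableSet_diamondPlus
      (hU.trans (tube_subset_diamondPlus c)) fun p hp => ?_).symm
    rw [hψ.eq_zero hp.2, mul_zero]
  rw [hred (hφ.gammaRev hα)]
  rcases multiIndex_cases hα with ⟨rfl, hs⟩ | ⟨i, rfl, hs⟩ | ⟨i, j, hij, rfl, hs⟩
  · rw [hs]
    exact one_le (step (enorm_integral_mul_le hF.1 (hw hφ.continuous_potential)) hNF b3)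
  · rw [hs, gammaRev_single]
    refine one_le (step (enorm_integral_mul_le hF.1 (hw (hφ.gamma i).continuous_potential))
      hNF ?_)
    have h := b1 i
    rw [gamma_potential hφ.contDiff] at h
    exact h
  · rw [hs, gammaRev_single_add_single hij]
    have hDi : ∀ i j, j ≠ 0 → ‖∫ p in diamondPlus, F p *
        gamma j (potential (gamma i φ)) (incl p) ∂cylMeasure‖ₑ ≤ ENNReal.ofReal C * N *
          eLpNorm (fun p => distP0 p ^ (-1 : ℤ) * φ (incl p)) 2 (cylMeasure.restrict U) := by
      intro i j hj
      rw [(hD j).integral_potential hj hF (hDF j) (hφt.gamma i), enorm_neg]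
      refine step ((hφt.gamma i).enorm_integral_potential_le (hDF j)) (hND j) ?_
      have h := b2 i
      rw [gamma_potential hφ.contDiff] at h
      exact h
    by_cases hj : j = 0
    · have hi : i = 0 := by
        rw [hj] at hij
        exact Fin.le_zero_iff.1 hij
      subst hi hj
      have hI : ∀ {f : Cyl → ℝ}, Continuous f →
          Integrable (fun p => F p * f p) (cylMeasure.restrict diamondPlus) := fun h =>
        hF.integrable_mul (memLp_of_continuous_diamondPlus h)
      have hk : ∀ k : Fin 6, Integrable (fun p => F p *
          gamma k.succ (potential (gamma k.succ φ)) (incl p))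
            (cylMeasure.restrict diamondPlus) := by
        intro k
        rw [gamma_potential (hφ.gamma _).contDiff]
        exact hI ((hφ.gamma _).gamma _).continuous_potential
      have hkS := integrable_finsetSum Finset.univ fun k _ => hk k
      have hw0 : Integrable (fun p => F p * potential φ (incl p))
        (cylMeasure.restrict diamondPlus) := hI hφ.continuous_potential
      have e : ∫ p in diamondPlus, F p * potential (gamma 0 (gamma 0 φ)) (incl p) ∂cylMeasure =
          ∑ k : Fin 6, ∫ p in diamondPlus, F p *
            gamma k.succ (potential (gamma k.succ φ)) (incl p) ∂cylMeasure -
          ∫ p in diamondPlus, F p * potential φ (incl p) ∂cylMeasure +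
          ∫ p in diamondPlus, F p * φ (incl p) ∂cylMeasure := by
        rw [← integral_finsetSum _ fun k _ => hk k, ← integral_sub hkS hw0]
        refine Eq.trans ?_ (integral_add (hkS.sub hw0) (hI hφ.continuous))
        refine setIntegral_congr_fun measurableSet_diamondPlus fun p hp => ?_
        rw [gamma_zero_gamma_zero_potential hφt hp, ← Finset.mul_sum]
        ring
      rw [e]
      set X := eLpNorm (fun p => distP0 p ^ (-1 : ℤ) * φ (incl p)) 2 (cylMeasure.restrict U)
      have t1 : ‖∑ k : Fin 6, ∫ p in diamondPlus, F p *
            gamma k.succ (potential (gamma k.succ φ)) (incl p) ∂cylMeasure‖ₑ ≤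
          6 * (ENNReal.ofReal C * N * X) := by
        refine (enorm_sum_le _ _).trans ?_
        refine (Finset.sum_le_sum fun k _ => hDi k.succ k.succ (Fin.succ_ne_zero k)).trans ?_
        simp
      have t2 : ‖∫ p in diamondPlus, F p * potential φ (incl p) ∂cylMeasure‖ₑ ≤
          ENNReal.ofReal C * N * X :=
        step (enorm_integral_mul_le hF.1 (hw hφ.continuous_potential)) hNF b4
      have t3 : ‖∫ p in diamondPlus, F p * φ (incl p) ∂cylMeasure‖ₑ ≤
          ENNReal.ofReal C * N * X :=
        step (enorm_integral_mul_le hF.1 (hw hφ.continuous)) hNF b5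
      refine (enorm_add_le _ _).trans ((add_le_add (enorm_sub_le.trans
        (add_le_add t1 t2)) t3).trans (le_of_eq ?_))
      rw [h8, show (8 : ℝ≥0∞) = 6 + 1 + 1 by norm_num]
      change _ = _ * N * X
      ring
    · rw [← gamma_potential (hφ.gamma i).contDiff]
      exact one_le (hDi i j hj)

/-! ### Representation of functionals on test functions -/

/-- The bound makes `L` vanish on the kernel of `J`, so `L` descends to a functional of norm at most
`N` on the range of `J`. Extend it by Hahn–Banach without increasing the norm and apply Riesz. -/
theorem exists_inner_representation {E H : Type*} [AddCommGroup E] [Module ℝ E]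
    [NormedAddCommGroup H] [InnerProductSpace ℝ H] [CompleteSpace H] (J : E →ₗ[ℝ] H)
    (L : E →ₗ[ℝ] ℝ) {N : ℝ} (hN : 0 ≤ N) (h : ∀ x, |L x| ≤ N * ‖J x‖) :
    ∃ f : H, ‖f‖ ≤ N ∧ ∀ x, L x = inner ℝ f (J x) := by
  obtain ⟨s, hs⟩ := J.rangeRestrict.exists_rightInverse_of_surjective J.range_rangeRestrict
  have hs' : ∀ y : J.range, J (s y) = y := fun y =>
    congrArg Subtype.val (LinearMap.congr_fun hs y)
  have hL : ∀ x, L (s (J.rangeRestrict x)) = L x := by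
    intro x
    have h1 := h (s (J.rangeRestrict x) - x)
    have h2 : J (s (J.rangeRestrict x)) = J x := hs' _
    rw [map_sub J, h2, sub_self, norm_zero, mul_zero, map_sub] at h1
    exact sub_eq_zero.1 (abs_nonpos_iff.1 h1)
  set ℓ : StrongDual ℝ J.range := (L ∘ₗ s).mkContinuous N fun y => by
    have := h (s y)
    rwa [hs'] at this
  obtain ⟨g, hg, hgn⟩ := exists_extension_norm_eq J.range ℓ
  refine ⟨(InnerProductSpace.toDual ℝ H).symm g, ?_, fun x => ?_⟩
  · rw [LinearIsometryEquiv.norm_map, hgn]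
    exact LinearMap.mkContinuous_norm_le _ hN _
  · rw [InnerProductSpace.toDual_symm_apply]
    exact (hL x).symm.trans (hg (J.rangeRestrict x)).symm

theorem IsTestOn.add {U : Set Cyl} {φ ψ : Ambient → ℝ} (hφ : IsTestOn U φ) (hψ : IsTestOn U ψ) :
    IsTestOn U (φ + ψ) where
  contDiff := hφ.contDiff.add hψ.contDiff
  compact := hφ.compact.add hψ.compact
  subset := (tsupport_add (fun p : Cyl => φ (incl p)) fun p => ψ (incl p)).trans
    (Set.union_subset hφ.subset hψ.subset)

theorem isTestOn_zero (U : Set Cyl) : IsTestOn U 0 where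
  contDiff := contDiff_const
  compact := HasCompactSupport.zero
  subset := by
    have : (fun p : Cyl => (0 : Ambient → ℝ) (incl p)) = 0 := rfl
    rw [this]
    simp

/-- The space of functions that restrict to test functions on `U`. -/
def testSpace (U : Set Cyl) : Submodule ℝ (Ambient → ℝ) where
  carrier := {φ | IsTestOn U φ}
  add_mem' := IsTestOn.add
  zero_mem' := isTestOn_zero U
  smul_mem' a _ hφ := hφ.mul_left (χ := fun _ => a) contDiff_const

theorem IsTestOn.integrable_mul {U : Set Cyl} {φ : Ambient → ℝ} (hφ : IsTestOn U φ)
    {u : Cyl → ℝ} (hu : LocallyIntegrableOn u U cylMeasure) :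
    Integrable (fun p => u p * φ (incl p)) (cylMeasure.restrict U) := by
  set S := tsupport fun p : Cyl => φ (incl p) with hS
  have h1 : IntegrableOn u S cylMeasure := hu.integrableOn_compact_subset hφ.subset hφ.compact
  have h2 : IntegrableOn (fun p => u p * φ (incl p)) S cylMeasure :=
    h1.mul_continuousOn hφ.continuous.continuousOn hφ.compact
  have h3 : Integrable (fun p => u p * φ (incl p)) cylMeasure := by
    refine (integrableOn_iff_integrable_of_support_subset fun p hp => ?_).1 h2
    exact subset_tsupport _ (right_ne_zero_of_mul (Function.mem_support.1 hp))
  exact h3.restrict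

theorem gammaRev_add {φ ψ : Ambient → ℝ} (hφ : ContDiff ℝ ∞ φ) (hψ : ContDiff ℝ ∞ ψ)
    {α : Fin 7 → ℕ} (h : ∑ i, α i ≤ 2) : gammaRev α (φ + ψ) = gammaRev α φ + gammaRev α ψ := by
  have key : ∀ {f g : Ambient → ℝ}, ContDiff ℝ ∞ f → ContDiff ℝ ∞ g → ∀ i,
      gamma i (f + g) = gamma i f + gamma i g := fun hf hg i => gamma_add hf hg i
  rcases multiIndex_cases h with ⟨rfl, -⟩ | ⟨i, rfl, -⟩ | ⟨i, j, hij, rfl, -⟩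
  · rfl
  · simp only [gammaRev_single, key hφ hψ]
  · simp only [gammaRev_single_add_single hij, key hφ hψ,
      key (contDiff_gamma hφ i) (contDiff_gamma hψ i)]

theorem gammaRev_smul {φ : Ambient → ℝ} (hφ : ContDiff ℝ ∞ φ) (a : ℝ)
    {α : Fin 7 → ℕ} (h : ∑ i, α i ≤ 2) : gammaRev α (a • φ) = a • gammaRev α φ := by
  have key : ∀ {f : Ambient → ℝ}, ContDiff ℝ ∞ f → ∀ i, gamma i (a • f) = a • gamma i f :=
    fun hf i => gamma_const_smul hf a i
  rcases multiIndex_cases h with ⟨rfl, -⟩ | ⟨i, rfl, -⟩ | ⟨i, j, hij, rfl, -⟩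
  · rfl
  · simp only [gammaRev_single, key hφ]
  · simp only [gammaRev_single_add_single hij, key hφ, key (contDiff_gamma hφ i)]

theorem locallyIntegrableOn_weight_mul {U : Set Cyl} (hU : U ⊆ diamondPlus) {f : Cyl → ℝ}
    (hf : Integrable f (cylMeasure.restrict U)) (k : ℤ) :
    LocallyIntegrableOn (fun p => distP0 p ^ k * f p) U cylMeasure := by
  intro p hp
  have hpos := distP0_pos_of_mem (hU hp)
  have hcont : ContinuousAt (fun q => distP0 q ^ k) p :=
    continuous_distP0.continuousAt.zpow₀ k (Or.inl hpos.ne')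
  set V := {q | ‖distP0 q ^ k‖ < ‖distP0 p ^ k‖ + 1} with hV
  have hVm : MeasurableSet V :=
    measurableSet_lt (measurable_distP0_zpow k).norm measurable_const
  have hVn : V ∈ nhds p := hcont.norm.eventually (gt_mem_nhds (lt_add_one _))
  refine ⟨V ∩ U, Filter.inter_mem (mem_nhdsWithin_of_mem_nhds hVn) self_mem_nhdsWithin, ?_⟩
  rw [IntegrableOn, ← Measure.restrict_restrict hVm]
  refine (hf.restrict (s := V)).bdd_mul (c := ‖distP0 p ^ k‖ + 1)
    (measurable_distP0_zpow k).aestronglyMeasurable ?_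
  filter_upwards [ae_restrict_mem hVm] with q hq
  exact le_of_lt hq

/-- Riesz representation for `φ ↦ ∫ u Γ^α φ`, with test functions embedded in `L²` by `φ ↦
distP0^(-k) φ`. The representing function, times `distP0^(-k)` and a sign, is the weak derivative,
and its `L²` norm is the weighted norm sought. -/
theorem exists_weak_gamma {U : Set Cyl} (hU : U ⊆ diamondPlus) {u : Cyl → ℝ}
    (hu : LocallyIntegrableOn u U cylMeasure) {α : Fin 7 → ℕ} (hα : ∑ i, α i ≤ 2) (k : ℤ)
    {N : ℝ≥0∞} (hN : N ≠ ⊤)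
    (h : ∀ φ, IsTestOn U φ → ‖∫ p in U, u p * gammaRev α φ (incl p) ∂cylMeasure‖ₑ ≤
      N * eLpNorm (fun p => distP0 p ^ (-k) * φ (incl p)) 2 (cylMeasure.restrict U)) :
    ∃ g : Cyl → ℝ, HasWeakGamma U α u g ∧
      eLpNorm (fun p => distP0 p ^ k * g p) 2 (cylMeasure.restrict U) ≤ N := by
  set μ := cylMeasure.restrict U with hμ
  have hfin : IsFiniteMeasure μ :=
    ⟨lt_of_le_of_lt (Measure.restrict_mono (hU.trans diamondPlus_subset_slab) le_rfl _)
      (measure_lt_top (cylMeasure.restrict slab) _)⟩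
  have hpos : ∀ᵐ p ∂μ, 0 < distP0 p := by
    refine ae_restrict_of_ae_restrict_of_subset hU ?_
    filter_upwards [ae_restrict_mem measurableSet_diamondPlus] with p hp
    exact distP0_pos_of_mem hp
  have hmem : ∀ φ : testSpace U, MemLp (fun p => distP0 p ^ (-k) * φ.1 (incl p)) 2 μ := fun φ =>
    (IsTestOn.memLp_weight φ.2 hU (-k)).restrict U
  set J : testSpace U →ₗ[ℝ] Lp ℝ 2 μ :=
    { toFun := fun φ => (hmem φ).toLp
      map_add' := fun φ ψ => by
        rw [← MemLp.toLp_add]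
        congr 1
        ext p
        exact mul_add _ _ _
      map_smul' := fun a φ => by
        rw [← MemLp.toLp_const_smul]
        congr 1
        ext p
        exact mul_left_comm _ _ _ } with hJ
  set L : testSpace U →ₗ[ℝ] ℝ :=
    { toFun := fun φ => ∫ p in U, u p * gammaRev α φ (incl p) ∂cylMeasure
      map_add' := fun φ ψ => by
        rw [← integral_add ((IsTestOn.gammaRev φ.2 hα).integrable_mul hu)
          ((IsTestOn.gammaRev ψ.2 hα).integrable_mul hu)]
        congr 1
        ext p
        rw [Submodule.coe_add, gammaRev_add (IsTestOn.contDiff φ.2) (IsTestOn.contDiff ψ.2) hα]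
        exact mul_add _ _ _
      map_smul' := fun a φ => by
        rw [RingHom.id_apply, smul_eq_mul, ← integral_const_mul]
        congr 1
        ext p
        rw [Submodule.coe_smul, gammaRev_smul (IsTestOn.contDiff φ.2) a hα]
        exact mul_left_comm _ _ _ } with hL
  have hbound : ∀ φ, |L φ| ≤ N.toReal * ‖J φ‖ := by
    intro φ
    have h1 := h φ.1 φ.2
    have h2 : ‖J φ‖ = (eLpNorm (fun p => distP0 p ^ (-k) * φ.1 (incl p)) 2 μ).toReal :=
      Lp.norm_toLp _ (hmem φ)
    rw [h2, ← ENNReal.toReal_mul, ← Real.norm_eq_abs, ← toReal_enorm]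
    exact ENNReal.toReal_mono (ENNReal.mul_ne_top hN (hmem φ).2.ne) h1
  obtain ⟨f, hfN, hf⟩ := exists_inner_representation J L ENNReal.toReal_nonneg hbound
  have hfm : MemLp f 2 μ := Lp.memLp f
  -- The sign cancels the `(-1)^|α|` in the definition of the weak derivative.
  refine ⟨fun p => distP0 p ^ (-k) * ((-1) ^ (∑ i, α i) * f p), ⟨hu, ?_, fun φ hφ => ?_⟩, ?_⟩
  · exact locallyIntegrableOn_weight_mul hU
      ((hfm.integrable (by norm_num)).const_mul _) (-k)
  · have h1 := hf ⟨φ, hφ⟩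
    rw [L2.inner_def] at h1
    refine Eq.trans h1 ?_
    rw [← integral_const_mul]
    refine integral_congr_ae ?_
    filter_upwards [(hmem ⟨φ, hφ⟩).coeFn_toLp] with p hp
    have hp' : (J ⟨φ, hφ⟩ : Cyl → ℝ) p = distP0 p ^ (-k) * φ (incl p) := hp
    have hs : ((-1 : ℝ) ^ (∑ i, α i)) * (-1) ^ (∑ i, α i) = 1 := by
      rw [← mul_pow]; simp
    rw [hp']
    simp only [RCLike.inner_apply, conj_trivial]
    linear_combination (-(distP0 p ^ (-k) * φ (incl p) * f p)) * hs
  · have h1 : eLpNorm (fun p => distP0 p ^ k * (distP0 p ^ (-k) *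
        ((-1) ^ (∑ i, α i) * f p))) 2 μ = eLpNorm f 2 μ := by
      refine eLpNorm_congr_norm_ae ?_
      filter_upwards [hpos] with p hp
      rw [← mul_assoc, ← zpow_add₀ hp.ne']
      simp
    rw [h1, ← ENNReal.ofReal_toReal hN, ← ENNReal.ofReal_toReal hfm.2.ne]
    rw [Lp.norm_def] at hfN
    exact ENNReal.ofReal_le_ofReal hfN

end EinsteinCylinder

end

/-! ### Assembly of the estimate over all multi-indices. -/

open EinsteinCylinder
theorem lemma4p4 (K : Set (EuclideanSpace ℝ (Fin 3))) (hK : IsCompact K) (A : ℝ) (hA : 0 < A)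
    (hKA : K ⊆ Metric.closedBall 0 (A / 2)) :
    ∃ C : ℝ≥0, ∀ (u F : Cyl → ℝ) (DF : Fin 7 → Cyl → ℝ),
      IsFreeWave u F →
      (∀ i, HasWeakGamma (diamond ∩ {p | 0 < p.1}) (Pi.single i 1) F (DF i)) →
      MemLp F 2 (cylMeasure.restrict diamondPlus) →
      (∀ i, MemLp (fun p => distP0 p ^ 2 * DF i p) 2 (cylMeasure.restrict diamondPlus)) →
      ∃ Du : (Fin 7 → ℕ) → Cyl → ℝ,
        (∀ α, ∑ i, α i ≤ 2 → HasWeakGamma (nearObstacle K (3 * A)) α u (Du α)) ∧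
        ∑ m ∈ Finset.range 3, ∑ α ∈ Finset.piAntidiag (Finset.univ : Finset (Fin 7)) m,
            eLpNorm (fun p => distP0 p ^ (1 + 2 * ((m : ℤ) - 2)) * Du α p) 2
              (cylMeasure.restrict (nearObstacle K (3 * A))) ≤
          (C : ℝ≥0∞) * (eLpNorm F 2 (cylMeasure.restrict diamondPlus) +
            ∑ i, eLpNorm (fun p => distP0 p ^ 2 * DF i p) 2
              (cylMeasure.restrict diamondPlus)) := by
  obtain ⟨c, hc, hsub⟩ := nearObstacle_subset_tube K (B := 3 * A) (by positivity)
  obtain ⟨C, hC, hb⟩ := exists_functional_bound hc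
  have hsub' := hsub.trans (tube_subset_diamondPlus c)
  -- Every term has the same bound, so the constant is multiplied by the number of multi-indices of
  -- length at most two.
  refine ⟨(∑ m ∈ Finset.range 3, (Finset.piAntidiag (Finset.univ : Finset (Fin 7)) m).card :
    ℕ) * C.toNNReal, fun u F DF hu hD hF hDF => ?_⟩
  set N := eLpNorm F 2 (cylMeasure.restrict diamondPlus) +
    ∑ i, eLpNorm (fun p => distP0 p ^ 2 * DF i p) 2 (cylMeasure.restrict diamondPlus) with hN
  have hNtop : ENNReal.ofReal C * N ≠ ⊤ :=
    ENNReal.mul_ne_top ENNReal.ofReal_ne_top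
      (ENNReal.add_ne_top.2 ⟨hF.2.ne, ENNReal.sum_ne_top.2 fun i _ => (hDF i).2.ne⟩)
  have hex : ∀ α : Fin 7 → ℕ, ∃ g : Cyl → ℝ, ∑ i, α i ≤ 2 →
      HasWeakGamma (nearObstacle K (3 * A)) α u g ∧
        eLpNorm (fun p => distP0 p ^ (1 + 2 * (((∑ i, α i : ℕ) : ℤ) - 2)) * g p) 2
          (cylMeasure.restrict (nearObstacle K (3 * A))) ≤ ENNReal.ofReal C * N := by
    intro α
    by_cases hα : ∑ i, α i ≤ 2
    · obtain ⟨g, hg⟩ := exists_weak_gamma hsub' (hu.locInt.mono_set hsub') hα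
        (1 + 2 * (((∑ i, α i : ℕ) : ℤ) - 2)) hNtop
        (hb u F DF hu hD hF hDF _ hsub α hα)
      exact ⟨g, fun _ => hg⟩
    -- Nothing is claimed for `|α| > 2`; zero is an arbitrary default.
    · exact ⟨0, fun h => absurd h hα⟩
  choose Du hDu using hex
  refine ⟨Du, fun α hα => (hDu α hα).1, ?_⟩
  have hterm : ∀ m ∈ Finset.range 3, ∀ α ∈ Finset.piAntidiag (Finset.univ : Finset (Fin 7)) m,
      eLpNorm (fun p => distP0 p ^ (1 + 2 * ((m : ℤ) - 2)) * Du α p) 2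
        (cylMeasure.restrict (nearObstacle K (3 * A))) ≤ ENNReal.ofReal C * N := by
    intro m hm α hα
    have hs : ∑ i, α i = m := (Finset.mem_piAntidiag.1 hα).1
    have hm2 := Finset.mem_range.1 hm
    have h := (hDu α (by omega)).2
    rwa [hs] at h
  refine (Finset.sum_le_sum fun m hm => Finset.sum_le_card_nsmul _ _ _ (hterm m hm)).trans ?_
  rw [← Finset.sum_smul, nsmul_eq_mul, ENNReal.coe_mul, ENNReal.coe_natCast, mul_assoc]
  rfl
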